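/- **Theorem 1.2.** Let $(A,\mathfrak m)$ be a Noetherian local ring with $d=\dim A>0$. Assume that the associated graded ring $\mathrm G(\mathfrak m)=\bigoplus_{n\ge 0}\mathfrak m^n/\mathfrak m^{n+1}$ is Gorenstein and that $x_1,\dots,x_d$ are elements of $A$ such that the ideal $(x_1,\dots,x_d)$ is a reduction of $\mathfrak m$. Let $a_1,\dots,a_d,q$ be positive integers and put $$Q=(x_1^{a_1},\dots,x_d^{a_d}),\qquad I=Q:\mathfrak m^q .$$ Then $\rho=\max\{n\ge 0\mid (\mathfrak m/Q)^n\neq (0)\}$ exists; put $\ell=\rho+1-q$. Let $\overline Q$ denote the integral closure of the ideal $Q$. The following three conditions are equivalent: 1. $I\subseteq\overline Q$. 2. $\mathfrak m^qI=\mathfrak m^qQ$. 3. $\ell\ge a_i$ for all $1\le i\le d$. When this is the case, the following assertions hold: * (i) the reduction number $\mathrm r_Q(I)=\min\{n\ge 0\mid I^{n+1}=QI^n\}$ exists and equals $\lceil q/\ell\rceil$; * (ii) the graded rings $\mathrm G(I)=\bigoplus_{n\ge 0}I^n/I^{n+1}$ and $\mathrm F(I)=\bigoplus_{n\ge 0}I^n/\mathfrak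 mI^n$ are Cohen–Macaulay. -/

import Mathlib

open IsLocalRing

universe u

namespace QuasiSocle

noncomputable section

section Graded

variable {A : Type u} [CommRing A]

/-- The homogeneous ideal `⨁ₙ J Iⁿ tⁿ` of the Rees algebra `⨁ₙ Iⁿ tⁿ`. -/
def reesIdeal (J I : Ideal A) : Ideal (reesAlgebra I) where
  carrier := {f | ∀ n, (f : Polynomial A).coeff n ∈ J * I ^ n}
  add_mem' {f g} hf hg n := by
    simpa using (J * I ^ n).add_mem (hf n) (hg n)
  zero_mem' n := by simp
  smul_mem' c f hf n := by
    have h : ((c • f : reesAlgebra I) : Polynomial A) = (c : Polynomial A) * (f : Polynomial A) :=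
      rfl
    rw [h, Polynomial.coeff_mul]
    refine Ideal.sum_mem _ fun p hp => ?_
    rw [← Finset.HasAntidiagonal.mem_antidiagonal.mp hp, pow_add, ← mul_assoc, mul_comm J, mul_assoc]
    exact Ideal.mul_mem_mul (c.2 p.1) (hf p.2)

/-- The associated graded ring `G(I) = ⨁ₙ Iⁿ / Iⁿ⁺¹`, as the quotient of the Rees algebra
`⨁ₙ Iⁿ tⁿ` by its homogeneous ideal `⨁ₙ Iⁿ⁺¹ tⁿ`. -/
abbrev AssociatedGradedRing (I : Ideal A) : Type u :=
  reesAlgebra I ⧸ reesIdeal I I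

/-- The fiber cone `F(I) = ⨁ₙ Iⁿ / 𝔪 Iⁿ` of an ideal of a local ring, as the quotient of the
Rees algebra `⨁ₙ Iⁿ tⁿ` by its homogeneous ideal `⨁ₙ 𝔪 Iⁿ tⁿ`. -/
abbrev FiberCone [IsLocalRing A] (I : Ideal A) : Type u :=
  reesAlgebra I ⧸ reesIdeal (maximalIdeal A) I

end Graded

/-- A local ring is Cohen-Macaulay if it is Noetherian and its maximal ideal contains a regular
sequence of length equal to the Krull dimension. -/
def IsCohenMacaulayLocalRing (R : Type u) [CommRing R] [IsLocalRing R] : Prop :=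
  IsNoetherianRing R ∧ ∃ rs : List R, (∀ r ∈ rs, r ∈ maximalIdeal R) ∧
    RingTheory.Sequence.IsRegular R rs ∧ ringKrullDim R = (rs.length : WithBot ℕ∞)

/-- A Noetherian ring is Cohen-Macaulay if its localizations at maximal ideals are. -/
def IsCohenMacaulayRing (R : Type u) [CommRing R] : Prop :=
  IsNoetherianRing R ∧ ∀ (P : Ideal R) [P.IsMaximal],
    IsCohenMacaulayLocalRing (Localization.AtPrime P)

/-- A local ring is Gorenstein if it is Noetherian and has finite injective dimension as a module
over itself. -/
def IsGorensteinLocalRing (R : Type u) [CommRing R] [IsLocalRing R] : Prop :=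
  IsNoetherianRing R ∧
    ∃ n : ℕ, CategoryTheory.HasInjectiveDimensionLE (ModuleCat.of R R) n

/-- A Noetherian ring is Gorenstein if its localizations at maximal ideals are. -/
def IsGorensteinRing (R : Type u) [CommRing R] : Prop :=
  IsNoetherianRing R ∧ ∀ (P : Ideal R) [P.IsMaximal],
    IsGorensteinLocalRing (Localization.AtPrime P)

section Ideals

variable {A : Type u} [CommRing A]

/-- `J` is a reduction of `I`: `J ⊆ I` and `Iⁿ⁺¹ = J Iⁿ` for some `n ≥ 0`. -/
def IsReduction (J I : Ideal A) : Prop :=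
  J ≤ I ∧ ∃ n : ℕ, I ^ (n + 1) = J * I ^ n

/-- The integral closure of an ideal `Q`: all `x` that satisfy an equation
`xⁿ + c₁ xⁿ⁻¹ + ⋯ + cₙ = 0` with `n ≥ 1` and `cⱼ ∈ Qʲ`. -/
def integralClosureOfIdeal (Q : Ideal A) : Set A :=
  {x | ∃ n : ℕ, 0 < n ∧ ∃ c : ℕ → A, (∀ j ∈ Finset.Icc 1 n, c j ∈ Q ^ j) ∧
    x ^ n + ∑ j ∈ Finset.Icc 1 n, c j * x ^ (n - j) = 0}

/-- `r` is the reduction number of `I` with respect to `Q`: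
the least `n ≥ 0` such that `Iⁿ⁺¹ = Q Iⁿ`. -/
def IsReductionNumber (Q I : Ideal A) (r : ℕ) : Prop :=
  IsLeast {n : ℕ | I ^ (n + 1) = Q * I ^ n} r

/-- `ρ` is the index of nilpotency of the ideal `J`: the largest `n` such that `Jⁿ ≠ 0`. -/
def IsNilpotencyIndex (J : Ideal A) (ρ : ℕ) : Prop :=
  IsGreatest {n : ℕ | J ^ n ≠ ⊥} ρ

end Ideals

end

end QuasiSocle

/-! Write m for the maximal ideal, yᵢ = xᵢ^aᵢ, and G for the associated graded ring of m. Everything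
is read off from the forms of degree aᵢ that the yᵢ define in G. The localization of G at its
irrelevant ideal has finite injective dimension and dimension at least d, and these forms generate
an ideal primary to its maximal ideal. Hence they are a regular sequence, and the quotient by them
has a one-dimensional socle (`gorenstein_regularModulo`, `gorenstein_socle`). Comparing homogeneous
components turns this into two statements about A itself (`regular_and_socle_of_gorenstein`).

Regularity gives Q ∩ mⁿ ⊆ ∑ yᵢ m^(n-aᵢ) (`partialIdeal_inf_pow_le`). The socle statement says that
every nonzero form of the quotient has a multiple that is nonzero in the top degree ρ; climbing the
m-adic filtration then yields I = Q + m^ℓ (`colon_pow_maximalIdeal`), with exponent 0 if ℓ is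
negative.

If all aᵢ ≤ ℓ, the first formula gives m^(k+ℓ) ⊆ Q m^k whenever k + ℓ > ρ. For k = q this is m^q I =
m^q Q. For k = nℓ, together with m^ρ ⊄ Q, it shows that Iⁿ⁺¹ = Q Iⁿ exactly when q ≤ nℓ, which is
the reduction number. The equality m^q I = m^q Q implies integrality by the determinant trick on the
faithful ideal m^q. Conversely xᵢ^ℓ lies in I, and it can be integral over Q only if aᵢ ≤ ℓ, because
the xᵢ are parameters.

The same formula gives the Valabrega-Valla condition Q ∩ m^c Iⁿ⁺¹ ⊆ Q m^c Iⁿ; with c = 0 and c = 1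
it makes the degree one forms of the yᵢ regular in G(I) and F(I). The Cohen-Macaulay property is
needed at every maximal ideal P, homogeneous or not. Such a P contains a monic polynomial in each of
these forms; its top form is a power of the given form, so these d polynomials are again a regular
sequence (`regularModulo_of_topForms`). A prime containing them has a quotient finite over A, hence
is maximal, so P is minimal over them and has height d. -/

namespace QuasiSocle

open CategoryTheory Abelian

/-! ### Regular sequences and long exact sequences of Ext. -/

section RegularModulo

/-- `l` is a weakly regular sequence on `R ⧸ J`. -/
def RegularModulo {R : Type*} [CommRing R] (J : Ideal R) : List R → Prop
  | [] => True
  | x :: l => (∀ u, x * u ∈ J → u ∈ J) ∧ RegularModulo (J ⊔ Ideal.span {x}) l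

variable {R : Type u} [CommRing R]

/-- The complex `R ⧸ J → R ⧸ J → R ⧸ (J + (x))` whose first map is multiplication by `x`. -/
noncomputable abbrev mulQuotComplex (J : Ideal R) (x : R) : ShortComplex (ModuleCat.{u} R) :=
  ShortComplex.mk (x • 𝟙 (ModuleCat.of R (R ⧸ J)))
    (ModuleCat.ofHom (Y := R ⧸ (J ⊔ Ideal.span {x})) (Submodule.factor le_sup_left)) (by
      refine ModuleCat.hom_ext (LinearMap.ext fun y => ?_)
      obtain ⟨y, rfl⟩ := Submodule.Quotient.mk_surjective _ y
      refine (Submodule.Quotient.mk_eq_zero (J ⊔ Ideal.span {x}) (x := x * y)).mpr ?_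
      exact Ideal.mem_sup_right (Ideal.mul_mem_right _ _ (Ideal.mem_span_singleton_self x)))

theorem mulQuotComplex_shortExact {J : Ideal R} {x : R} (h : ∀ u, x * u ∈ J → u ∈ J) :
    (mulQuotComplex J x).ShortExact := by
  refine ModuleCat.shortComplex_shortExact _ ?_ ?_ ?_
  · intro y
    obtain ⟨y, rfl⟩ := Submodule.Quotient.mk_surjective _ y
    constructor
    · intro hy
      have hy' : y ∈ J ⊔ Ideal.span {x} := by
        rw [← Submodule.Quotient.mk_eq_zero]
        exact hy
      obtain ⟨j, hj, z, hz, rfl⟩ := Submodule.mem_sup.mp hy'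
      obtain ⟨w, rfl⟩ := Ideal.mem_span_singleton'.mp hz
      refine ⟨Submodule.Quotient.mk w, ?_⟩
      change x • (Submodule.Quotient.mk w : R ⧸ J) = _
      rw [← Submodule.Quotient.mk_smul, Submodule.Quotient.eq, smul_eq_mul]
      convert J.neg_mem hj using 1
      ring
    · rintro ⟨w, hw⟩
      obtain ⟨w, rfl⟩ := Submodule.Quotient.mk_surjective _ w
      rw [← hw]
      refine (Submodule.Quotient.mk_eq_zero (J ⊔ Ideal.span {x}) (x := x * w)).mpr ?_
      exact Ideal.mem_sup_right (Ideal.mul_mem_right _ _ (Ideal.mem_span_singleton_self x))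
  · intro y z hyz
    obtain ⟨y, rfl⟩ := Submodule.Quotient.mk_surjective _ y
    obtain ⟨z, rfl⟩ := Submodule.Quotient.mk_surjective _ z
    have : x * y - x * z ∈ J := (Submodule.Quotient.eq J).mp hyz
    rw [← mul_sub] at this
    exact (Submodule.Quotient.eq J).mpr (h _ this)
  · exact Submodule.factor_surjective le_sup_left

theorem smul_ext_eq_zero {N M : ModuleCat.{u} R} {x : R} (hx : ∀ y : N, x • y = 0) {i : ℕ}
    (e : Ext N M i) : x • e = 0 := by
  have h : x • 𝟙 N = 0 := by
    ext y
    exact hx y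
  have : x • e = (Ext.mk₀ (x • 𝟙 N)).comp e (zero_add i) := by simp [Ext.mk₀_smul]
  rw [this, h]
  simp

/-- The first element x acts as zero on Ext(N, R ⧸ J), so every class is the image under the
connecting map of a class in one degree lower with coefficients in R ⧸ (J + (x)), where induction
applies. -/
theorem ext_vanish_of_regularModulo {N : ModuleCat.{u} R} (l : List R)
    (hN : ∀ x ∈ l, ∀ y : N, x • y = 0) (J : Ideal R) (hl : RegularModulo J l) :
    ∀ i < l.length, ∀ e : Ext N (ModuleCat.of R (R ⧸ J)) i, e = 0 := by
  induction l generalizing J with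
  | nil => simp
  | cons x l ih =>
    intro i hi e
    have hS := mulQuotComplex_shortExact hl.1
    have he : e.comp (Ext.mk₀ (mulQuotComplex J x).f) (add_zero i) = 0 := by
      rw [← Ext.smul_eq_comp_mk₀]
      exact smul_ext_eq_zero (hN x (by simp)) e
    cases i with
    | zero =>
      obtain ⟨f, rfl⟩ := Ext.addEquiv₀.symm.surjective e
      have := hS.mono_f
      simp only [Ext.addEquiv₀_symm_apply, Ext.mk₀_comp_mk₀] at he ⊢
      rw [Ext.mk₀_eq_zero_iff] at he ⊢
      exact Limits.zero_of_comp_mono _ he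
    | succ i =>
      obtain ⟨e', rfl⟩ := Ext.covariant_sequence_exact₁ N hS e he rfl
      have : e' = 0 := ih (fun y hy => hN y (by simp [hy])) _ hl.2 i (by simpa using hi) e'
      rw [this, Ext.zero_comp]

theorem ofList_cons_sup (J : Ideal R) (x : R) (l : List R) :
    J ⊔ Ideal.ofList (x :: l) = J ⊔ Ideal.span {x} ⊔ Ideal.ofList l := by
  rw [Ideal.ofList_cons, sup_assoc]

/-- Dimension shifting: each element of the regular sequence costs one degree of vanishing. -/
theorem ext_vanish_quotient {N : ModuleCat.{u} R} (l : List R) (J : Ideal R)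
    (hl : RegularModulo J l) (s : ℕ)
    (h : ∀ i < s + l.length, ∀ e : Ext N (ModuleCat.of R (R ⧸ J)) i, e = 0) :
    ∀ i < s, ∀ e : Ext N (ModuleCat.of R (R ⧸ (J ⊔ Ideal.ofList l))) i, e = 0 := by
  induction l generalizing J with
  | nil =>
    rw [Ideal.ofList_nil, sup_bot_eq]
    simpa using h
  | cons x l ih =>
    rw [ofList_cons_sup]
    refine ih _ hl.2 fun i hi e => ?_
    have hS := mulQuotComplex_shortExact hl.1
    obtain ⟨e', rfl⟩ := Ext.covariant_sequence_exact₃ N hS e rfl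
      (h (i + 1) (by simp only [List.length_cons]; omega) _)
    have : e' = 0 := h i (by simp only [List.length_cons]; omega) e'
    rw [this, Ext.zero_comp]

/-- Each element of a regular sequence raises the projective dimension of the quotient by at most
one; only the consequence for Ext into a fixed M is recorded. -/
theorem ext_vanish_of_length_lt {M : ModuleCat.{u} R} (l : List R) (J : Ideal R)
    (hl : RegularModulo J l) (s : ℕ)
    (h : ∀ i, s < i → ∀ e : Ext (ModuleCat.of R (R ⧸ J)) M i, e = 0) :
    ∀ i, s + l.length < i →
      ∀ e : Ext (ModuleCat.of R (R ⧸ (J ⊔ Ideal.ofList l))) M i, e = 0 := by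
  induction l generalizing J s with
  | nil =>
    rw [Ideal.ofList_nil, sup_bot_eq]
    simpa using h
  | cons x l ih =>
    rw [ofList_cons_sup]
    intro i hi
    refine ih _ hl.2 (s + 1) (fun i hi e => ?_) i (by simp only [List.length_cons] at hi; omega)
    have hS := mulQuotComplex_shortExact hl.1
    obtain ⟨i, rfl⟩ : ∃ j, i = 1 + j := ⟨i - 1, by omega⟩
    obtain ⟨e', rfl⟩ := Ext.contravariant_sequence_exact₃ hS M e (h _ (by omega) _) rfl
    have : e' = 0 := h i (by omega) e'
    rw [this, Ext.comp_zero]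

/-- Rees's shift from Ext in degree `l.length` over R ⧸ J to Hom over R ⧸ (J + (l)), made natural in
the first variable. Each connecting map is onto for N₂, because x kills Ext, and injective for N₁,
because the preceding Ext vanishes. -/
theorem hom_extend_of_ext_extend {N₁ N₂ : ModuleCat.{u} R} (ι : N₁ ⟶ N₂) (l : List R)
    (h₁ : ∀ x ∈ l, ∀ y : N₁, x • y = 0) (h₂ : ∀ x ∈ l, ∀ y : N₂, x • y = 0)
    (J : Ideal R) (hl : RegularModulo J l)
    (h : ∀ e : Ext N₁ (ModuleCat.of R (R ⧸ J)) l.length,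
      ∃ e' : Ext N₂ (ModuleCat.of R (R ⧸ J)) l.length,
        (Ext.mk₀ ι).comp e' (zero_add _) = e) :
    ∀ e : Ext N₁ (ModuleCat.of R (R ⧸ (J ⊔ Ideal.ofList l))) 0,
      ∃ e' : Ext N₂ (ModuleCat.of R (R ⧸ (J ⊔ Ideal.ofList l))) 0,
        (Ext.mk₀ ι).comp e' (zero_add _) = e := by
  induction l generalizing J with
  | nil =>
    rw [Ideal.ofList_nil, sup_bot_eq]
    simpa using h
  | cons x l ih =>
    rw [ofList_cons_sup]
    refine ih (fun y hy => h₁ y (by simp [hy])) (fun y hy => h₂ y (by simp [hy])) _ hl.2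
      fun e => ?_
    have hS := mulQuotComplex_shortExact hl.1
    obtain ⟨b, hb⟩ := h (e.comp hS.extClass rfl)
    have hb' : b.comp (Ext.mk₀ (mulQuotComplex J x).f) (add_zero _) = 0 := by
      rw [← Ext.smul_eq_comp_mk₀]
      exact smul_ext_eq_zero (h₂ x (by simp)) b
    obtain ⟨c, rfl⟩ := Ext.covariant_sequence_exact₁ N₂ hS b hb' rfl
    refine ⟨c, ?_⟩
    rw [← sub_eq_zero]
    have hc : ((Ext.mk₀ ι).comp c (zero_add _) - e).comp hS.extClass rfl = 0 := by
      rw [sub_eq_add_neg, Ext.add_comp, Ext.neg_comp, Ext.comp_assoc _ _ _ _ _ (by omega), hb,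
        add_neg_cancel]
      rfl
    obtain ⟨e', he'⟩ := Ext.covariant_sequence_exact₃ N₁ hS _ rfl hc
    have : e' = 0 := ext_vanish_of_regularModulo (x :: l) h₁ J hl _ (by simp) e'
    rw [← he', this, Ext.zero_comp]

end RegularModulo

end QuasiSocle

namespace QuasiSocle

open CategoryTheory Abelian

/-! ### Ext vanishing through prime filtrations, and depth. -/

section Homological

variable {R : Type u} [CommRing R]

theorem ext_eq_zero_of_retract {N N' M : ModuleCat.{u} R} {i : ℕ} (f : N ⟶ N') (g : N' ⟶ N)
    (hfg : f ≫ g = 𝟙 N) (h : ∀ e : Ext N' M i, e = 0) (e : Ext N M i) : e = 0 := by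
  have : e = (Ext.mk₀ f).comp ((Ext.mk₀ g).comp e (zero_add i)) (zero_add i) := by
    rw [Ext.mk₀_comp_mk₀_assoc, hfg, Ext.mk₀_id_comp]
  rw [this, h ((Ext.mk₀ g).comp e (zero_add i)), Ext.comp_zero]

theorem ext_eq_zero_of_linearEquiv {N N' : Type u} [AddCommGroup N] [Module R N] [AddCommGroup N']
    [Module R N'] {M : ModuleCat.{u} R} {i : ℕ} (f : N ≃ₗ[R] N')
    (h : ∀ e : Ext (ModuleCat.of R N') M i, e = 0) (e : Ext (ModuleCat.of R N) M i) : e = 0 :=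
  ext_eq_zero_of_retract f.toModuleIso.hom f.toModuleIso.inv (Iso.hom_inv_id _) h e

theorem ext_eq_zero_of_subsingleton {N : Type u} [AddCommGroup N] [Module R N] [Subsingleton N]
    {M : ModuleCat.{u} R} {i : ℕ} (e : Ext (ModuleCat.of R N) M i) : e = 0 := by
  have h : 𝟙 (ModuleCat.of R N) = 0 :=
    ModuleCat.hom_ext (LinearMap.ext fun y => Subsingleton.elim (α := N) _ _)
  rw [← Ext.mk₀_id_comp e, h, Ext.mk₀_zero, Ext.zero_comp]

theorem ext_eq_zero_of_exact {N₁ N₂ N₃ : Type u} [AddCommGroup N₁] [Module R N₁] [AddCommGroup N₂]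
    [Module R N₂] [AddCommGroup N₃] [Module R N₃] {M : ModuleCat.{u} R} {i : ℕ}
    (f : N₁ →ₗ[R] N₂) (g : N₂ →ₗ[R] N₃) (hf : Function.Injective f)
    (hg : Function.Surjective g) (hfg : Function.Exact f g)
    (h₁ : ∀ e : Ext (ModuleCat.of R N₁) M i, e = 0)
    (h₃ : ∀ e : Ext (ModuleCat.of R N₃) M i, e = 0)
    (e : Ext (ModuleCat.of R N₂) M i) : e = 0 := by
  have hS : (ShortComplex.mk (ModuleCat.ofHom f) (ModuleCat.ofHom g)
      (ModuleCat.hom_ext hfg.linearMap_comp_eq_zero)).ShortExact :=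
    ModuleCat.shortComplex_shortExact _ hfg hf hg
  obtain ⟨e', rfl⟩ := Ext.contravariant_sequence_exact₂ hS M e (h₁ _)
  rw [h₃ e', Ext.comp_zero]

theorem ext_extend_of_injective {N₁ N₂ : Type u} [AddCommGroup N₁] [Module R N₁] [AddCommGroup N₂]
    [Module R N₂] [Module.Finite R N₂] {M : ModuleCat.{u} R} {i : ℕ}
    (f : N₁ →ₗ[R] N₂) (hf : Function.Injective f)
    (h : ∀ (N : Type u) [AddCommGroup N] [Module R N] [Module.Finite R N],
      ∀ e : Ext (ModuleCat.of R N) M (i + 1), e = 0)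
    (e : Ext (ModuleCat.of R N₁) M i) :
    ∃ e' : Ext (ModuleCat.of R N₂) M i,
      (Ext.mk₀ (ModuleCat.ofHom f)).comp e' (zero_add i) = e := by
  have hfg : Function.Exact f (LinearMap.range f).mkQ := LinearMap.exact_map_mkQ_range f
  have hS : (ShortComplex.mk (ModuleCat.ofHom f) (ModuleCat.ofHom (LinearMap.range f).mkQ)
      (ModuleCat.hom_ext hfg.linearMap_comp_eq_zero)).ShortExact :=
    ModuleCat.shortComplex_shortExact _ hfg hf (Submodule.mkQ_surjective _)
  exact Ext.contravariant_sequence_exact₁ hS M e (add_comm 1 i) (h _ _)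

variable [IsNoetherianRing R] [IsLocalRing R]

/-- The hypothesis makes multiplication by x surjective on the finite module Ext(R ⧸ p, M), so
Nakayama's lemma applies. -/
theorem ext_quotient_eq_zero_of_mem_maximalIdeal {M : ModuleCat.{u} R} [Module.Finite R M] {i : ℕ}
    {p : Ideal R} {x : R} (hx : x ∈ maximalIdeal R) (hp : ∀ u, x * u ∈ p → u ∈ p)
    (h : ∀ e : Ext (ModuleCat.of R (R ⧸ (p ⊔ Ideal.span {x}))) M (i + 1), e = 0)
    (e : Ext (ModuleCat.of R (R ⧸ p)) M i) : e = 0 := by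
  have hS := mulQuotComplex_shortExact hp
  have key : ∀ e : Ext (ModuleCat.of R (R ⧸ p)) M i,
      ∃ e' : Ext (ModuleCat.of R (R ⧸ p)) M i, x • e' = e := by
    intro e
    obtain ⟨e', he'⟩ := Ext.contravariant_sequence_exact₁ hS M e (add_comm 1 i) (h _)
    refine ⟨e', ?_⟩
    rw [← he']
    simp [Ext.mk₀_smul]
  have hbot : (⊤ : Submodule R (Ext (ModuleCat.of R (R ⧸ p)) M i)) = ⊥ := by
    refine Submodule.eq_bot_of_le_smul_of_le_jacobson_bot (Ideal.span {x}) _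
      (Module.Finite.fg_top) ?_ ?_
    · intro e _
      obtain ⟨e', rfl⟩ := key e
      exact Submodule.smul_mem_smul (Ideal.mem_span_singleton_self x) trivial
    · rw [IsLocalRing.jacobson_eq_maximalIdeal ⊥ bot_ne_top]
      simpa [Ideal.span_le] using hx
  have : e ∈ (⊤ : Submodule R (Ext (ModuleCat.of R (R ⧸ p)) M i)) := trivial
  rw [hbot] at this
  exact this

omit [IsNoetherianRing R] in
theorem eq_maximalIdeal_of_pow_le {p : Ideal R} [p.IsPrime] {n : ℕ}
    (h : maximalIdeal R ^ n ≤ p) : p = maximalIdeal R :=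
  le_antisymm (IsLocalRing.le_maximalIdeal (Ideal.IsPrime.ne_top ‹_›))
    (Ideal.IsPrime.le_of_pow_le h)

theorem ext_eq_zero_of_residue {M : ModuleCat.{u} R} [Module.Finite R M] {i : ℕ}
    (h : ∀ (N : Type u) [AddCommGroup N] [Module R N] [Module.Finite R N],
      ∀ e : Ext (ModuleCat.of R N) M (i + 1), e = 0)
    (hk : ∀ e : Ext (ModuleCat.of R (R ⧸ maximalIdeal R)) M i, e = 0)
    (N : Type u) [AddCommGroup N] [Module R N] [hN : Module.Finite R N] :
    ∀ e : Ext (ModuleCat.of R N) M i, e = 0 := by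
  induction hN using IsNoetherianRing.induction_on_isQuotientEquivQuotientPrime R with
  | subsingleton N => exact ext_eq_zero_of_subsingleton
  | quotient N p f =>
    refine ext_eq_zero_of_linearEquiv f ?_
    have := p.2
    by_cases hp : maximalIdeal R ≤ p.1
    · obtain hp' : p.1 = maximalIdeal R :=
        le_antisymm (IsLocalRing.le_maximalIdeal p.2.ne_top) hp
      rw [hp']
      exact hk
    · obtain ⟨x, hx, hxp⟩ := Set.not_subset.mp hp
      exact ext_quotient_eq_zero_of_mem_maximalIdeal hx
        (fun u hu => (p.2.mem_or_mem hu).resolve_left hxp) (h _)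
  | exact N₁ N₂ N₃ f g hf hg hfg h₁ h₃ => exact ext_eq_zero_of_exact f g hf hg hfg h₁ h₃

/-- A form of Ischebeck's theorem: Ext vanishes below depth M - dim N, with D as a lower bound for
the depth and the length of l as an upper bound for the dimension. On a factor R ⧸ p, the first
element x of l either lies in p and can be dropped, or is a nonzerodivisor and trades one element
for one degree. -/
theorem ext_eq_zero_of_primary {M : ModuleCat.{u} R} [Module.Finite R M] {D : ℕ}
    (hk : ∀ i < D, ∀ e : Ext (ModuleCat.of R (R ⧸ maximalIdeal R)) M i, e = 0) (l : List R)
    (hl : ∀ x ∈ l, x ∈ maximalIdeal R)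
    (N : Type u) [AddCommGroup N] [Module R N] [hN : Module.Finite R N]
    (n : ℕ) (hn : maximalIdeal R ^ n ≤ Module.annihilator R N ⊔ Ideal.ofList l)
    (i : ℕ) (hi : i + l.length < D) :
    ∀ e : Ext (ModuleCat.of R N) M i, e = 0 := by
  induction l generalizing N n i with
  | nil =>
    rw [Ideal.ofList_nil, sup_bot_eq] at hn
    revert hn
    induction hN using IsNoetherianRing.induction_on_isQuotientEquivQuotientPrime R with
    | subsingleton N => exact fun _ => ext_eq_zero_of_subsingleton
    | quotient N p f =>
      intro hn
      refine ext_eq_zero_of_linearEquiv f ?_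
      have := p.2
      rw [f.annihilator_eq, Ideal.annihilator_quotient] at hn
      rw [eq_maximalIdeal_of_pow_le hn]
      exact hk i (by simpa using hi)
    | exact N₁ N₂ N₃ f g hf hg hfg h₁ h₃ =>
      intro hn
      exact ext_eq_zero_of_exact f g hf hg hfg
        (h₁ (hn.trans (f.annihilator_le_of_injective hf)))
        (h₃ (hn.trans (g.annihilator_le_of_surjective hg)))
  | cons x l ih =>
    have hl' : ∀ y ∈ l, y ∈ maximalIdeal R := fun y hy => hl y (by simp [hy])
    simp only [List.length_cons] at hi
    revert hn
    induction hN using IsNoetherianRing.induction_on_isQuotientEquivQuotientPrime R with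
    | subsingleton N => exact fun _ => ext_eq_zero_of_subsingleton
    | quotient N p f =>
      intro hn
      refine ext_eq_zero_of_linearEquiv f ?_
      have := p.2
      rw [f.annihilator_eq, Ideal.annihilator_quotient, ofList_cons_sup] at hn
      by_cases hxp : x ∈ p.1
      · refine ih hl' _ n ?_ i (by omega)
        rw [Ideal.annihilator_quotient]
        refine hn.trans (sup_le_sup_right (sup_le le_rfl ?_) _)
        simpa [Ideal.span_le] using hxp
      · refine ext_quotient_eq_zero_of_mem_maximalIdeal (hl x (by simp))
          (fun u hu => (p.2.mem_or_mem hu).resolve_left hxp) (ih hl' _ n ?_ (i + 1) (by omega))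
        rwa [Ideal.annihilator_quotient]
    | exact N₁ N₂ N₃ f g hf hg hfg h₁ h₃ =>
      intro hn
      exact ext_eq_zero_of_exact f g hf hg hfg
        (h₁ (hn.trans (sup_le_sup_right (f.annihilator_le_of_injective hf) _)))
        (h₃ (hn.trans (sup_le_sup_right (g.annihilator_le_of_surjective hg) _)))

/-- If x u ∈ J, then 1 ↦ u defines a map R ⧸ (J + (x)) → R ⧸ J. The source has dimension at most the
length of the remaining sequence, which is less than the depth of the target, so the map is zero and
u ∈ J. -/
theorem regularModulo_of_primary (l : List R) (hl : ∀ x ∈ l, x ∈ maximalIdeal R) (J : Ideal R)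
    (hk : ∀ i < l.length,
      ∀ e : Ext (ModuleCat.of R (R ⧸ maximalIdeal R)) (ModuleCat.of R (R ⧸ J)) i, e = 0)
    (n : ℕ) (hn : maximalIdeal R ^ n ≤ J ⊔ Ideal.ofList l) : RegularModulo J l := by
  induction l generalizing J with
  | nil => trivial
  | cons x l ih =>
    have hl' : ∀ y ∈ l, y ∈ maximalIdeal R := fun y hy => hl y (by simp [hy])
    rw [ofList_cons_sup] at hn
    have hx : ∀ u, x * u ∈ J → u ∈ J := by
      intro u hu
      let f : (R ⧸ (J ⊔ Ideal.span {x})) →ₗ[R] R ⧸ J :=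
        Submodule.liftQ _ (LinearMap.toSpanSingleton R _ (Submodule.Quotient.mk u)) (by
          refine sup_le (fun y hy => ?_) ?_
          · refine (Submodule.Quotient.mk_eq_zero J (x := y * u)).mpr (J.mul_mem_right _ hy)
          · rw [Ideal.span, Submodule.span_le, Set.singleton_subset_iff]
            exact (Submodule.Quotient.mk_eq_zero J (x := x * u)).mpr hu)
      have h0 := ext_eq_zero_of_primary (M := ModuleCat.of R (R ⧸ J)) hk l hl'
        (R ⧸ (J ⊔ Ideal.span {x})) n (by rwa [Ideal.annihilator_quotient]) 0
        (by simp) (Ext.mk₀ (ModuleCat.ofHom f))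
      rw [Ext.mk₀_eq_zero_iff] at h0
      have h1 : f (Submodule.Quotient.mk 1) = 0 := by
        have : f = 0 := by simpa using congrArg ModuleCat.Hom.hom h0
        rw [this]
        rfl
      have h2 : f (Submodule.Quotient.mk 1) = Submodule.Quotient.mk u :=
        one_smul R (Submodule.Quotient.mk u : R ⧸ J)
      rw [h2, Submodule.Quotient.mk_eq_zero] at h1
      exact h1
    refine ⟨hx, ih hl' _ ?_ hn⟩
    have := ext_vanish_quotient (N := ModuleCat.of R (R ⧸ maximalIdeal R)) [x] J ⟨hx, trivial⟩
      l.length hk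
    rwa [Ideal.ofList_singleton] at this

end Homological

end QuasiSocle

namespace QuasiSocle

open CategoryTheory Abelian

/-! ### Local rings of finite injective dimension: parameters and socle. -/

section Gorenstein

variable {R : Type u} [CommRing R] [IsLocalRing R]

/-- The map from the residue field that sends `1` to an element of the socle. -/
noncomputable def socleHom {N : Type u} [AddCommGroup N] [Module R N] (a : N)
    (ha : ∀ r ∈ maximalIdeal R, r • a = 0) : (R ⧸ maximalIdeal R) →ₗ[R] N :=
  Submodule.liftQ _ (LinearMap.toSpanSingleton R N a) (fun r hr => ha r hr)

theorem socleHom_mk {N : Type u} [AddCommGroup N] [Module R N] (a : N)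
    (ha : ∀ r ∈ maximalIdeal R, r • a = 0) (r : R) :
    socleHom a ha (Submodule.Quotient.mk r) = r • a := rfl

theorem socleHom_injective {N : Type u} [AddCommGroup N] [Module R N] {a : N} (h0 : a ≠ 0)
    (ha : ∀ r ∈ maximalIdeal R, r • a = 0) : Function.Injective (socleHom a ha) := by
  rw [injective_iff_map_eq_zero]
  intro y hy
  obtain ⟨r, rfl⟩ := Submodule.Quotient.mk_surjective _ y
  rw [socleHom_mk] at hy
  rw [Submodule.Quotient.mk_eq_zero]
  by_contra hr
  have hu : IsUnit r := by simpa using hr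
  exact h0 (hu.smul_eq_zero.mp hy)

variable [IsNoetherianRing R]

/-- A maximal regular sequence, obtained by Noetherian induction on J. -/
theorem exists_regularModulo_socle (J : Ideal R) (hJ : J ≠ ⊤) :
    ∃ l : List R, (∀ x ∈ l, x ∈ maximalIdeal R) ∧ RegularModulo J l ∧
      ∃ s : R ⧸ (J ⊔ Ideal.ofList l), s ≠ 0 ∧ ∀ r ∈ maximalIdeal R, r • s = 0 := by
  induction J using WellFoundedGT.induction with
  | ind J ih =>
    by_cases h : ∃ x ∈ maximalIdeal R, ∀ u, x * u ∈ J → u ∈ J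
    · obtain ⟨x, hx, hxJ⟩ := h
      have hlt : J < J ⊔ Ideal.span {x} := by
        refine lt_of_le_of_ne le_sup_left fun he => hJ ?_
        have hxm : x ∈ J := by
          rw [he]
          exact Ideal.mem_sup_right (Ideal.mem_span_singleton_self x)
        rw [Ideal.eq_top_iff_one]
        exact hxJ 1 (by simpa using hxm)
      have hne : J ⊔ Ideal.span {x} ≠ ⊤ := by
        refine ne_top_of_le_ne_top (IsLocalRing.maximalIdeal.isMaximal R).ne_top
          (sup_le (IsLocalRing.le_maximalIdeal hJ) ?_)
        simpa [Ideal.span_le] using hx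
      obtain ⟨l, hl, hreg, hs⟩ := ih _ hlt hne
      refine ⟨x :: l, ?_, ⟨hxJ, hreg⟩, ?_⟩
      · intro y hy
        rcases List.mem_cons.mp hy with rfl | hy
        exacts [hx, hl y hy]
      · rwa [ofList_cons_sup]
    · push Not at h
      -- No element of the maximal ideal is regular on R ⧸ J, so by prime avoidance the maximal
      -- ideal lies in an associated prime, whose generator s is a socle element.
      have hsub : (maximalIdeal R : Set R) ⊆ ⋃ p ∈ associatedPrimes R (R ⧸ J), p := by
        rw [biUnion_associatedPrimes_eq_compl_regular]
        intro x hx hreg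
        obtain ⟨u, hu, huJ⟩ := h x hx
        refine huJ ?_
        rw [← Submodule.Quotient.mk_eq_zero]
        refine hreg (?_ : x • _ = x • _)
        rw [smul_zero]
        exact (Submodule.Quotient.mk_eq_zero J (x := x * u)).mpr hu
      rw [Ideal.subset_union_prime_finite (associatedPrimes.finite R (R ⧸ J)) ⊥ ⊥
        (fun p hp _ _ => hp.isPrime)] at hsub
      obtain ⟨p, hp, hle⟩ := hsub
      obtain ⟨hpp, s, hs⟩ := isAssociatedPrime_iff.mp hp
      refine ⟨[], by simp, trivial, ?_⟩
      rw [Ideal.ofList_nil, sup_bot_eq]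
      refine ⟨s, ?_, fun r hr => ?_⟩
      · rintro rfl
        refine hpp.ne_top ?_
        rw [hs, Ideal.eq_top_iff_one, Submodule.mem_colon_singleton, smul_zero]
        exact Submodule.zero_mem _
      · have := hle hr
        rwa [hs, Submodule.mem_colon_singleton, Submodule.mem_bot] at this

/-- The injective dimension is at most `l.length`. Above that degree Ext(R ⧸ (l), R) is zero by
projective dimension; since the residue field embeds in R ⧸ (l), its Ext in degree i is a quotient
of that zero module once Ext in degree i + 1 vanishes on the cokernel. -/
theorem ext_eq_zero_of_socle {l : List R} (hl : RegularModulo (⊥ : Ideal R) l)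
    {s : R ⧸ ((⊥ : Ideal R) ⊔ Ideal.ofList l)} (hs0 : s ≠ 0)
    (hs : ∀ r ∈ maximalIdeal R, r • s = 0)
    (hid : ∃ n : ℕ, HasInjectiveDimensionLE (ModuleCat.of R R) n)
    (N : Type u) [AddCommGroup N] [Module R N] [Module.Finite R N]
    (e : Ext (ModuleCat.of R N) (ModuleCat.of R (R ⧸ (⊥ : Ideal R))) (l.length + 1)) : e = 0 := by
  obtain ⟨n, hn⟩ := hid
  let eq : R ≃ₗ[R] R ⧸ (⊥ : Ideal R) := (Submodule.quotEquivOfEqBot ⊥ rfl).symm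
  have hid' : HasInjectiveDimensionLT (ModuleCat.of R (R ⧸ (⊥ : Ideal R))) (n + 1) :=
    hasInjectiveDimensionLT_of_iso eq.toModuleIso (n + 1)
  have hproj : Projective (ModuleCat.of R (R ⧸ (⊥ : Ideal R))) := by
    rw [← IsProjective.iff_projective]
    exact Module.Projective.of_equiv eq
  have hpd : ∀ i, l.length < i → ∀ e : Ext (ModuleCat.of R (R ⧸ ((⊥ : Ideal R) ⊔ Ideal.ofList l)))
      (ModuleCat.of R (R ⧸ (⊥ : Ideal R))) i, e = 0 := by
    intro i hi
    refine ext_vanish_of_length_lt l ⊥ hl 0 (fun i hi e => ?_) i (by omega)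
    obtain ⟨i, rfl⟩ : ∃ j, i = j + 1 := ⟨i - 1, by omega⟩
    exact e.eq_zero_of_projective
  -- Descending induction on the degree: k = 0 lies beyond the given injective dimension, and k = n
  -- + 1 reaches degree `l.length + 1`.
  have step : ∀ k, ∀ (N : Type u) [AddCommGroup N] [Module R N] [Module.Finite R N],
      ∀ e : Ext (ModuleCat.of R N) (ModuleCat.of R (R ⧸ (⊥ : Ideal R)))
        (l.length + 1 + (n + 1 - k)), e = 0 := by
    intro k
    induction k with
    | zero =>
      intro N _ _ _ e
      exact e.eq_zero_of_hasInjectiveDimensionLT (n + 1) (by omega)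
    | succ k ih =>
      by_cases hk : n + 1 ≤ k
      · have : n + 1 - (k + 1) = n + 1 - k := by omega
        rwa [this]
      · have : n + 1 - k = n + 1 - (k + 1) + 1 := by omega
        rw [this, ← add_assoc] at ih
        refine ext_eq_zero_of_residue ih fun e => ?_
        obtain ⟨e', rfl⟩ := ext_extend_of_injective (socleHom s hs) (socleHom_injective hs0 hs) ih e
        rw [hpd _ (by omega) e', Ext.comp_zero]
  have := step (n + 1) N
  rw [Nat.sub_self] at this
  exact this e

/-- R ⧸ (l) behaves like an injective module over itself: the map from the line spanned by a to the
line spanned by t extends to N, because the corresponding extension problem for Ext in degree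
`l.length` over R is unobstructed. -/
theorem exists_hom_of_socle {l : List R} (hl : RegularModulo (⊥ : Ideal R) l)
    {s : R ⧸ ((⊥ : Ideal R) ⊔ Ideal.ofList l)} (hs0 : s ≠ 0)
    (hs : ∀ r ∈ maximalIdeal R, r • s = 0) (hlm : ∀ x ∈ l, x ∈ maximalIdeal R)
    (hid : ∃ n : ℕ, HasInjectiveDimensionLE (ModuleCat.of R R) n)
    (N : Type u) [AddCommGroup N] [Module R N] [Module.Finite R N]
    (hN : ∀ x ∈ l, ∀ y : N, x • y = 0) (a : N) (ha0 : a ≠ 0)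
    (ha : ∀ r ∈ maximalIdeal R, r • a = 0) (t : R ⧸ ((⊥ : Ideal R) ⊔ Ideal.ofList l))
    (ht : ∀ r ∈ maximalIdeal R, r • t = 0) :
    ∃ g : N →ₗ[R] R ⧸ ((⊥ : Ideal R) ⊔ Ideal.ofList l), g a = t := by
  obtain ⟨e', he'⟩ := hom_extend_of_ext_extend (ModuleCat.ofHom (socleHom a ha)) l
    (fun x hx y => by
      obtain ⟨y, rfl⟩ := Submodule.Quotient.mk_surjective _ y
      exact (Submodule.Quotient.mk_eq_zero (maximalIdeal R) (x := x * y)).mpr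
        (Ideal.mul_mem_right _ _ (hlm x hx))) hN ⊥ hl
    (ext_extend_of_injective (socleHom a ha) (socleHom_injective ha0 ha)
      (ext_eq_zero_of_socle hl hs0 hs hid)) (Ext.mk₀ (ModuleCat.ofHom (socleHom t ht)))
  obtain ⟨g, rfl⟩ := Ext.addEquiv₀.symm.surjective e'
  rw [Ext.addEquiv₀_symm_apply, Ext.mk₀_comp_mk₀] at he'
  have h1 := Ext.addEquiv₀.symm.injective he'
  refine ⟨g.hom, ?_⟩
  have h2 := congrArg (fun f => f.hom (Submodule.Quotient.mk (1 : R))) h1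
  have h3 : g.hom ((1 : R) • a) = (1 : R) • t := h2
  simpa using h3

/-- With its maximal regular sequence generating an ideal primary to the maximal ideal, R is
Cohen-Macaulay. -/
theorem exists_pow_le_of_socle {l : List R} (hl : RegularModulo (⊥ : Ideal R) l)
    {s : R ⧸ ((⊥ : Ideal R) ⊔ Ideal.ofList l)} (hs0 : s ≠ 0)
    (hs : ∀ r ∈ maximalIdeal R, r • s = 0) (hlm : ∀ x ∈ l, x ∈ maximalIdeal R)
    (hid : ∃ n : ℕ, HasInjectiveDimensionLE (ModuleCat.of R R) n) :
    ∃ n, maximalIdeal R ^ n ≤ Ideal.ofList l := by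
  have hK : (⊥ : Ideal R) ⊔ Ideal.ofList l = Ideal.ofList l := bot_sup_eq _
  let F : ℕ →o Ideal R := ⟨fun n => Submodule.colon (Ideal.ofList l) ((maximalIdeal R ^ n : Ideal R) : Set R),
    fun m n hmn => Submodule.colon_mono le_rfl (Ideal.pow_le_pow_right hmn)⟩
  obtain ⟨n, hn⟩ := monotone_stabilizes_iff_noetherian.mpr ‹IsNoetherianRing R› F
  refine ⟨n, ?_⟩
  -- If a violated this inclusion, its class in R ⧸ I would be a nonzero socle element and could be
  -- mapped to s ≠ 0. That map is multiplication by some b with b mⁿ⁺¹ ⊆ (l); the colon chain is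
  -- stationary at n, so b a ∈ (l), a contradiction.
  have key : maximalIdeal R ^ n ≤ maximalIdeal R ^ (n + 1) ⊔ Ideal.ofList l := by
    intro a ha
    by_contra haK
    set I := maximalIdeal R ^ (n + 1) ⊔ Ideal.ofList l ⊔ maximalIdeal R * Ideal.span {a} with hI
    have haI : a ∉ I := by
      intro h
      obtain ⟨y, hy, z, hz, hyz⟩ := Submodule.mem_sup.mp h
      rw [Ideal.mem_mul_span_singleton] at hz
      obtain ⟨r, hr, rfl⟩ := hz
      have hu : IsUnit (1 - r) := by
        by_contra h1
        have := Ideal.add_mem _ ((IsLocalRing.mem_maximalIdeal _).mpr h1) hr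
        rw [sub_add_cancel] at this
        exact (Ideal.ne_top_iff_one _).mp (IsLocalRing.maximalIdeal.isMaximal R).ne_top this
      apply haK
      rw [← Ideal.unit_mul_mem_iff_mem _ hu]
      convert hy using 1
      linear_combination -hyz
    obtain ⟨g, hg⟩ := exists_hom_of_socle hl hs0 hs hlm hid (R ⧸ I)
      (fun x hx y => by
        obtain ⟨y, rfl⟩ := Submodule.Quotient.mk_surjective _ y
        refine (Submodule.Quotient.mk_eq_zero I (x := x * y)).mpr (Ideal.mul_mem_right _ _ ?_)
        refine Ideal.mem_sup_left (Ideal.mem_sup_right ?_)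
        exact Ideal.subset_span hx) (Submodule.Quotient.mk a)
      (fun h => haI ((Submodule.Quotient.mk_eq_zero I).mp h))
      (fun r hr => (Submodule.Quotient.mk_eq_zero I (x := r * a)).mpr (Ideal.mem_sup_right
        (Ideal.mul_mem_mul hr (Ideal.mem_span_singleton_self a)))) s hs
    obtain ⟨b, hb⟩ := Submodule.Quotient.mk_surjective _ (g (Submodule.Quotient.mk 1))
    have hgr : ∀ r : R, g (Submodule.Quotient.mk r) = Submodule.Quotient.mk (r * b) := by
      intro r
      have : (Submodule.Quotient.mk r : R ⧸ I) = r • Submodule.Quotient.mk 1 := by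
        rw [← Submodule.Quotient.mk_smul, smul_eq_mul, mul_one]
      rw [this, map_smul, ← hb, ← Submodule.Quotient.mk_smul, smul_eq_mul]
    have hb1 : b ∈ F (n + 1) := by
      refine Submodule.mem_colon.mpr fun r hr => ?_
      have : (Submodule.Quotient.mk r : R ⧸ I) = 0 := (Submodule.Quotient.mk_eq_zero I).mpr
        (Ideal.mem_sup_left (Ideal.mem_sup_left hr))
      have h2 := hgr r
      rw [this, map_zero, eq_comm, Submodule.Quotient.mk_eq_zero, hK] at h2
      rwa [smul_eq_mul, mul_comm]
    rw [← hn (n + 1) (by omega)] at hb1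
    have hba := Submodule.mem_colon.mp hb1 a ha
    rw [hgr] at hg
    apply hs0
    rw [← hg, Submodule.Quotient.mk_eq_zero, hK, mul_comm]
    exact hba
  refine Submodule.le_of_le_smul_of_le_jacobson_bot (I := maximalIdeal R)
    (IsNoetherian.noetherian _) (IsLocalRing.maximalIdeal_le_jacobson _) ?_
  rw [smul_eq_mul, ← pow_succ', sup_comm]
  exact key

theorem height_le_length_of_pow_le {l : List R} {n : ℕ} (hlm : ∀ x ∈ l, x ∈ maximalIdeal R)
    (hn : maximalIdeal R ^ n ≤ Ideal.ofList l) : (maximalIdeal R).height ≤ l.length := by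
  classical
  have hmem : maximalIdeal R ∈ (Ideal.span (l.toFinset : Set R)).minimalPrimes := by
    refine ⟨⟨inferInstance, ?_⟩, fun p hp _ => ?_⟩
    · rw [Ideal.span_le]
      intro x hx
      exact hlm x (by simpa using hx)
    · have := hp.1
      refine Ideal.IsPrime.le_of_pow_le (hn.trans (le_trans ?_ hp.2))
      refine Ideal.span_mono fun x hx => ?_
      simpa using hx
  refine (Ideal.height_le_card_of_mem_minimalPrimes_span_finset hmem).trans ?_
  exact_mod_cast l.toFinset_card_le

/-- A maximal regular sequence has length at least the height of the maximal ideal by Krull's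
theorem, and it supplies the Ext vanishing required of θ. -/
theorem gorenstein_regularModulo (hid : ∃ n : ℕ, HasInjectiveDimensionLE (ModuleCat.of R R) n)
    (θ : List R) (hθ : ∀ x ∈ θ, x ∈ maximalIdeal R) (hdim : θ.length ≤ (maximalIdeal R).height)
    (n : ℕ) (hn : maximalIdeal R ^ n ≤ Ideal.ofList θ) : RegularModulo ⊥ θ := by
  obtain ⟨l, hlm, hl, s, hs0, hs⟩ := exists_regularModulo_socle (⊥ : Ideal R) bot_ne_top
  obtain ⟨k, hk⟩ := exists_pow_le_of_socle hl hs0 hs hlm hid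
  have hlen : θ.length ≤ l.length := by
    exact_mod_cast hdim.trans (height_le_length_of_pow_le hlm hk)
  refine regularModulo_of_primary θ hθ ⊥ (fun i hi => ?_) n (by rwa [bot_sup_eq])
  refine ext_vanish_of_regularModulo l (fun x hx y => ?_) ⊥ hl i (by omega)
  obtain ⟨y, rfl⟩ := Submodule.Quotient.mk_surjective _ y
  exact (Submodule.Quotient.mk_eq_zero (maximalIdeal R) (x := x * y)).mpr
        (Ideal.mul_mem_right _ _ (hlm x hx))

/-- A map R ⧸ (θ) → R ⧸ (θ) taking s to t exists by the extension property, and it is multiplication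
by the image b of 1. -/
theorem gorenstein_socle (hid : ∃ n : ℕ, HasInjectiveDimensionLE (ModuleCat.of R R) n)
    (θ : List R) (hθ : ∀ x ∈ θ, x ∈ maximalIdeal R) (hreg : RegularModulo ⊥ θ) (s t : R)
    (hs0 : s ∉ Ideal.ofList θ) (hs : ∀ r ∈ maximalIdeal R, r * s ∈ Ideal.ofList θ)
    (ht : ∀ r ∈ maximalIdeal R, r * t ∈ Ideal.ofList θ) :
    ∃ b, t - b * s ∈ Ideal.ofList θ := by
  have hK : (⊥ : Ideal R) ⊔ Ideal.ofList θ = Ideal.ofList θ := bot_sup_eq _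
  rw [← hK] at hs0 hs ht ⊢
  set K := (⊥ : Ideal R) ⊔ Ideal.ofList θ
  have hs0' : (Submodule.Quotient.mk s : R ⧸ K) ≠ 0 :=
    fun h => hs0 ((Submodule.Quotient.mk_eq_zero K).mp h)
  have hs' : ∀ r ∈ maximalIdeal R, r • (Submodule.Quotient.mk s : R ⧸ K) = 0 :=
    fun r hr => (Submodule.Quotient.mk_eq_zero K (x := r * s)).mpr (hs r hr)
  have ht' : ∀ r ∈ maximalIdeal R, r • (Submodule.Quotient.mk t : R ⧸ K) = 0 :=
    fun r hr => (Submodule.Quotient.mk_eq_zero K (x := r * t)).mpr (ht r hr)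
  obtain ⟨g, hg⟩ := exists_hom_of_socle hreg hs0' hs' hθ hid (R ⧸ K) (fun x hx y => by
    obtain ⟨y, rfl⟩ := Submodule.Quotient.mk_surjective _ y
    refine (Submodule.Quotient.mk_eq_zero K (x := x * y)).mpr (Ideal.mul_mem_right _ _ ?_)
    rw [hK]
    exact Ideal.subset_span hx) _ hs0' hs' _ ht'
  obtain ⟨b, hb⟩ := Submodule.Quotient.mk_surjective _ (g (Submodule.Quotient.mk 1))
  refine ⟨b, ?_⟩
  rw [← Submodule.Quotient.eq, ← hg]
  have : (Submodule.Quotient.mk s : R ⧸ K) = s • Submodule.Quotient.mk 1 := by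
    rw [← Submodule.Quotient.mk_smul, smul_eq_mul, mul_one]
  rw [this, map_smul, ← hb, ← Submodule.Quotient.mk_smul, smul_eq_mul, mul_comm]

end Gorenstein

end QuasiSocle

namespace QuasiSocle

/-! ### The extended Rees algebra and its dimension. -/

section ExtendedRees

open LaurentPolynomial

/-- The extended Rees algebra `A[I t, t⁻¹]`. -/
noncomputable def extendedRees {A : Type u} [CommRing A] (I : Ideal A) : Subalgebra A A[T;T⁻¹] :=
  Algebra.adjoin A (insert (T (-1)) ((fun u => C u * T 1) '' (I : Set A)))

variable {A : Type u} [CommRing A]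

theorem T_mem_extendedRees (I : Ideal A) : (T (-1) : A[T;T⁻¹]) ∈ extendedRees I :=
  Algebra.subset_adjoin (Set.mem_insert _ _)

theorem C_mul_T_mem_extendedRees {I : Ideal A} {u : A} (hu : u ∈ I) :
    (C u * T 1 : A[T;T⁻¹]) ∈ extendedRees I :=
  Algebra.subset_adjoin (Set.mem_insert_of_mem _ ⟨u, hu, rfl⟩)

theorem C_mem_extendedRees (I : Ideal A) (u : A) : (C u : A[T;T⁻¹]) ∈ extendedRees I := by
  rw [C_eq_algebraMap]
  exact Subalgebra.algebraMap_mem _ _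

theorem extendedRees_isNoetherianRing [IsNoetherianRing A] (I : Ideal A) :
    IsNoetherianRing (extendedRees I) := by
  classical
  obtain ⟨s, hs⟩ := IsNoetherian.noetherian I
  have hfg : (extendedRees I).FG := by
    refine ⟨insert (T (-1)) (s.image fun u => C u * T 1), le_antisymm ?_ ?_⟩
    · refine Algebra.adjoin_mono ?_
      simp only [Finset.coe_insert, Finset.coe_image]
      refine Set.insert_subset_insert (Set.image_mono ?_)
      rw [← hs]
      exact Submodule.subset_span
    · refine Algebra.adjoin_le ?_
      rintro _ (rfl | ⟨u, hu, rfl⟩)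
      · exact Algebra.subset_adjoin (by simp)
      · have hu' : u ∈ Submodule.span A (s : Set A) := hs ▸ hu
        change C u * T 1 ∈ _
        clear hu
        induction hu' using Submodule.span_induction with
        | mem u hu => exact Algebra.subset_adjoin (by simpa using Or.inr ⟨u, hu, rfl⟩)
        | zero => simp
        | add u v hu hv h1 h2 =>
          rw [map_add, add_mul]
          exact add_mem h1 h2
        | smul a u hu h1 =>
          rw [smul_eq_mul, map_mul, mul_assoc, C_eq_algebraMap, ← Algebra.smul_def]
          exact Subalgebra.smul_mem _ h1 a
  have : Algebra.FiniteType A (extendedRees I) := ⟨(Subalgebra.fg_top _).mpr hfg⟩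
  exact Algebra.FiniteType.isNoetherianRing A _

theorem toLaurent_mem_extendedRees {I : Ideal A} {f : Polynomial A} (hf : f ∈ reesAlgebra I) :
    Polynomial.toLaurent f ∈ extendedRees I := by
  rw [← adjoin_monomial_eq_reesAlgebra] at hf
  have : Algebra.adjoin A ((Submodule.map (Polynomial.monomial 1) I : Submodule A (Polynomial A)) :
      Set (Polynomial A)) ≤ (extendedRees I).comap (Polynomial.toLaurentAlg (R := A)) := by
    refine Algebra.adjoin_le ?_
    rintro _ ⟨u, hu, rfl⟩
    change Polynomial.toLaurent (Polynomial.monomial 1 u) ∈ extendedRees I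
    rw [← Polynomial.C_mul_X_pow_eq_monomial, Polynomial.toLaurent_C_mul_X_pow]
    exact C_mul_T_mem_extendedRees hu
  exact this hf

/-- Reduction of coefficients modulo an ideal. -/
noncomputable def extendedReesMap (I p : Ideal A) : extendedRees I →+* (A ⧸ p)[T;T⁻¹] :=
  (AddMonoidAlgebra.mapRingHom ℤ (Ideal.Quotient.mk p)).comp (extendedRees I).val.toRingHom

theorem mem_ker_extendedReesMap {I p : Ideal A} (e : extendedRees I) :
    e ∈ RingHom.ker (extendedReesMap I p) ↔ ∀ n, (e : A[T;T⁻¹]).coeff n ∈ p := by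
  rw [RingHom.mem_ker, LaurentPolynomial.ext_iff]
  refine forall_congr' fun n => ?_
  rw [← Ideal.Quotient.eq_zero_iff_mem]
  simp [extendedReesMap]

/-- Contracting p A[t, t⁻¹] embeds Spec A strictly monotonically in the spectrum of the extended
Rees algebra. The image of the maximal ideal does not contain t⁻¹, and adding t⁻¹ gives one more
step in the chain. -/
theorem le_height_of_extendedRees [IsLocalRing A] [IsNoetherianRing A] {I : Ideal A} (hI : I ≠ ⊤) :
    ∃ N : Ideal (extendedRees I), N.IsPrime ∧ (⟨T (-1), T_mem_extendedRees I⟩ ∈ N) ∧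
      (∀ e : extendedRees I, (∀ n, (e : A[T;T⁻¹]).coeff n ∈ maximalIdeal A) → e ∈ N) ∧
      (maximalIdeal A).height + 1 ≤ N.height := by
  have hIm : I ≤ maximalIdeal A := IsLocalRing.le_maximalIdeal hI
  let P : PrimeSpectrum A → PrimeSpectrum (extendedRees I) := fun p =>
    ⟨RingHom.ker (extendedReesMap I p.1), RingHom.ker_isPrime _⟩
  have hP : StrictMono P := by
    refine Monotone.strictMono_of_injective ?_ ?_
    · intro p q hpq e he
      rw [mem_ker_extendedReesMap] at he ⊢
      exact fun n => hpq (he n)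
    · intro p q hpq
      have key : ∀ (p : PrimeSpectrum A) (u : A), u ∈ p.1 ↔
          (⟨C u, C_mem_extendedRees I u⟩ : extendedRees I) ∈ (P p).1 := by
        intro p u
        rw [mem_ker_extendedReesMap]
        refine ⟨fun hu n => ?_, fun h => by simpa using h 0⟩
        simp only [C_apply]
        split_ifs
        exacts [hu, p.1.zero_mem]
      ext u
      exact (key p u).trans ((by rw [hpq]) : _ ↔ _) |>.trans (key q u).symm
  let m : PrimeSpectrum A := ⟨maximalIdeal A, inferInstance⟩
  -- Modulo `(P m).1` the elements u t with u ∈ I vanish, so the extended Rees algebra lands in the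
  -- polynomial ring in t⁻¹ (embedded by η), where t⁻¹ is not a unit.
  have hne : (P m).1 ⊔ Ideal.span {⟨T (-1), T_mem_extendedRees I⟩} ≠ ⊤ := by
    intro h
    obtain ⟨p, hp, z, hz, hpz⟩ := Submodule.mem_sup.mp ((Ideal.eq_top_iff_one _).mp h)
    obtain ⟨e, rfl⟩ := Ideal.mem_span_singleton'.mp hz
    let η : Polynomial (A ⧸ maximalIdeal A) →+* (A ⧸ maximalIdeal A)[T;T⁻¹] :=
      (invert : _ ≃ₐ[A ⧸ maximalIdeal A] _).toRingEquiv.toRingHom.comp Polynomial.toLaurent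
    have hη : Function.Injective η :=
      (invert : _ ≃ₐ[A ⧸ maximalIdeal A] _).injective.comp Polynomial.toLaurent_injective
    have hηX : η Polynomial.X = T (-1) := by
      simp [η]
    have hle : ∀ e : A[T;T⁻¹], e ∈ extendedRees I →
        ∃ g, AddMonoidAlgebra.mapRingHom ℤ (Ideal.Quotient.mk (maximalIdeal A)) e = η g := by
      intro e he
      induction he using Algebra.adjoin_induction with
      | mem e he =>
        rcases he with rfl | ⟨u, hu, rfl⟩
        · refine ⟨Polynomial.X, ?_⟩
          rw [hηX, T, AddMonoidAlgebra.mapRingHom_single, map_one]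
          rfl
        · refine ⟨0, ?_⟩
          have h0 : Ideal.Quotient.mk (maximalIdeal A) u = 0 :=
            Ideal.Quotient.eq_zero_iff_mem.mpr (hIm hu)
          simp only [map_zero, map_mul]
          rw [← single_eq_C, AddMonoidAlgebra.mapRingHom_single, h0]
          simp
      | algebraMap a =>
        refine ⟨Polynomial.C (Ideal.Quotient.mk _ a), ?_⟩
        rw [← C_eq_algebraMap, ← single_eq_C, AddMonoidAlgebra.mapRingHom_single]
        simp [η]
      | add x y _ _ hx hy =>
        obtain ⟨g, hg⟩ := hx
        obtain ⟨g', hg'⟩ := hy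
        exact ⟨g + g', by rw [map_add, map_add, hg, hg']⟩
      | mul x y _ _ hx hy =>
        obtain ⟨g, hg⟩ := hx
        obtain ⟨g', hg'⟩ := hy
        exact ⟨g * g', by rw [map_mul, map_mul, hg, hg']⟩
    obtain ⟨g, hg⟩ := hle e e.2
    have h1 := congrArg (extendedReesMap I (maximalIdeal A)) hpz
    rw [map_add, map_mul, RingHom.mem_ker.mp hp, zero_add, map_one] at h1
    have h2 : extendedReesMap I (maximalIdeal A) e = η g := hg
    have h3 : extendedReesMap I (maximalIdeal A) ⟨T (-1), T_mem_extendedRees I⟩ =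
        η Polynomial.X := by
      rw [hηX]
      change AddMonoidAlgebra.mapRingHom ℤ _ (AddMonoidAlgebra.single (-1) 1) = _
      rw [AddMonoidAlgebra.mapRingHom_single, map_one]
      rfl
    rw [h2, h3, ← map_mul, ← map_one η] at h1
    have h4 := congrArg (fun f => Polynomial.coeff f 0) (hη h1)
    simp at h4
  obtain ⟨N, hN, hle⟩ := Ideal.exists_le_maximal _ hne
  have hTN : (⟨T (-1), T_mem_extendedRees I⟩ : extendedRees I) ∈ N :=
    hle (Ideal.mem_sup_right (Ideal.mem_span_singleton_self _))
  have hNp : N.IsPrime := hN.isPrime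
  refine ⟨N, hNp, hTN, fun e he => hle (Ideal.mem_sup_left ?_), ?_⟩
  · rw [mem_ker_extendedReesMap]
    exact he
  · have hlt : (P m).1 < N := by
      refine lt_of_le_of_ne (le_sup_left.trans hle) fun he => ?_
      rw [← he, mem_ker_extendedReesMap] at hTN
      have := hTN (-1)
      refine (Ideal.ne_top_iff_one _).mp m.2.ne_top ?_
      simpa using this
    have hPm : (P m).1.IsPrime := (P m).2
    refine le_trans ?_ (Ideal.height_add_one_le_of_lt_of_isPrime hlt)
    gcongr
    have := Order.height_le_height_apply_of_strictMono P hP m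
    rwa [← PrimeSpectrum.height_eq_orderHeight, ← PrimeSpectrum.height_eq_orderHeight] at this

end ExtendedRees

/-! ### The irrelevant ideal of the associated graded ring and its height. -/

section IrrelevantIdeal

variable {A : Type u} [CommRing A] [IsLocalRing A]

/-- The degree zero component, modulo the maximal ideal, of the associated graded ring of the
maximal ideal. -/
noncomputable def residueMap :
    AssociatedGradedRing (maximalIdeal A) →+* A ⧸ maximalIdeal A :=
  Ideal.Quotient.lift _ (((Ideal.Quotient.mk _).comp Polynomial.constantCoeff).comp
    (reesAlgebra (maximalIdeal A)).val.toRingHom) (fun f hf => by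
      have := hf 0
      rw [pow_zero, mul_one] at this
      exact Ideal.Quotient.eq_zero_iff_mem.mpr this)

/-- The irrelevant maximal ideal of the associated graded ring of the maximal ideal. -/
noncomputable def irrelevantIdeal : Ideal (AssociatedGradedRing (maximalIdeal A)) :=
  RingHom.ker residueMap

theorem mk_mem_irrelevantIdeal (f : reesAlgebra (maximalIdeal A)) :
    Ideal.Quotient.mk _ f ∈ (irrelevantIdeal (A := A)) ↔
      (f : Polynomial A).coeff 0 ∈ maximalIdeal A := by
  rw [irrelevantIdeal, RingHom.mem_ker, ← Ideal.Quotient.eq_zero_iff_mem]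
  rfl

instance irrelevantIdeal_isMaximal : (irrelevantIdeal (A := A)).IsMaximal := by
  have hs : Function.Surjective (residueMap (A := A)) := by
    intro y
    obtain ⟨y, rfl⟩ := Ideal.Quotient.mk_surjective y
    refine ⟨Ideal.Quotient.mk _ (algebraMap A _ y), ?_⟩
    change Ideal.Quotient.mk _ (Polynomial.coeff (Polynomial.C y) 0) = _
    simp
  let := Ideal.Quotient.field (maximalIdeal A)
  exact RingHom.ker_isMaximal_of_surjective residueMap hs

theorem height_le_height_comap_of_surjective {S B : Type*} [CommRing S] [CommRing B] (π : S →+* B)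
    (hπ : Function.Surjective π) (N : Ideal B) [hN : N.IsPrime] :
    N.height ≤ (N.comap π).height := by
  have hs : StrictMono (PrimeSpectrum.comap π) :=
    Monotone.strictMono_of_injective (fun p q hpq => Ideal.comap_mono hpq)
      (PrimeSpectrum.comap_injective_of_surjective π hπ)
  have := Order.height_le_height_apply_of_strictMono _ hs ⟨N, hN⟩
  rwa [← PrimeSpectrum.height_eq_orderHeight, ← PrimeSpectrum.height_eq_orderHeight] at this

open LaurentPolynomial

section

omit [IsLocalRing A]

/-- The inclusion of the Rees algebra into the extended Rees algebra. -/
noncomputable def reesToExtendedRees (I : Ideal A) : reesAlgebra I →+* extendedRees I :=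
  (Polynomial.toLaurent.comp (reesAlgebra I).val.toRingHom).codRestrict
      (extendedRees I).toSubring (fun f => toLaurent_mem_extendedRees f.2)

theorem coe_reesToExtendedRees (I : Ideal A) (f : reesAlgebra I) :
    (reesToExtendedRees I f : A[T;T⁻¹]) = Polynomial.toLaurent (f : Polynomial A) := rfl

theorem exists_sub_reesToExtendedRees_mem (I : Ideal A) (e : extendedRees I) :
    ∃ f, Ideal.Quotient.mk (Ideal.span {(⟨T (-1), T_mem_extendedRees I⟩ : extendedRees I)})
      (reesToExtendedRees I f) = Ideal.Quotient.mk _ e := by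
  set σ := (Ideal.Quotient.mk (Ideal.span
    {(⟨T (-1), T_mem_extendedRees I⟩ : extendedRees I)})).comp (reesToExtendedRees I) with hσ
  change ∃ f, σ f = _
  obtain ⟨e, he⟩ := e
  induction he using Algebra.adjoin_induction with
  | mem e he =>
    rcases he with rfl | ⟨u, hu, rfl⟩
    · refine ⟨0, ?_⟩
      rw [map_zero, eq_comm, Ideal.Quotient.eq_zero_iff_mem]
      exact Ideal.mem_span_singleton_self _
    · refine ⟨⟨Polynomial.monomial 1 u, reesAlgebra.monomial_mem.mpr (by simpa using hu)⟩, ?_⟩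
      refine congrArg (Ideal.Quotient.mk _) (Subtype.ext ?_)
      rw [coe_reesToExtendedRees]
      simp [← Polynomial.C_mul_X_pow_eq_monomial]
  | algebraMap a =>
    refine ⟨algebraMap A _ a, ?_⟩
    refine congrArg (Ideal.Quotient.mk _) (Subtype.ext ?_)
    rw [coe_reesToExtendedRees]
    change Polynomial.toLaurent (Polynomial.C a) = _
    rw [Polynomial.toLaurent_C]
    rfl
  | add x y hx' hy' hx hy =>
    obtain ⟨g, hg⟩ := hx
    obtain ⟨g', hg'⟩ := hy
    exact ⟨g + g', by rw [map_add, hg, hg', ← map_add]; rfl⟩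
  | mul x y hx' hy' hx hy =>
    obtain ⟨g, hg⟩ := hx
    obtain ⟨g', hg'⟩ := hy
    exact ⟨g * g', by rw [map_mul, hg, hg', ← map_mul]; rfl⟩

theorem reesToExtendedRees_mem_of_mem_reesIdeal {I : Ideal A} {f : reesAlgebra I}
    (hf : f ∈ reesIdeal I I) :
    reesToExtendedRees I f ∈
      Ideal.span {(⟨T (-1), T_mem_extendedRees I⟩ : extendedRees I)} := by
  have hfX : (f : Polynomial A) * Polynomial.X ∈ reesAlgebra I := by
    intro n
    cases n with
    | zero => simp
    | succ n =>
      rw [Polynomial.coeff_mul_X, pow_succ']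
      exact hf n
  refine Ideal.mem_span_singleton'.mpr ⟨reesToExtendedRees I ⟨_, hfX⟩, Subtype.ext ?_⟩
  change Polynomial.toLaurent ((f : Polynomial A) * Polynomial.X) * T (-1) = _
  rw [map_mul, Polynomial.toLaurent_X, mul_assoc, ← T_add]
  simp [coe_reesToExtendedRees]

theorem coeff_toLaurent_mem {p : Ideal A} {f : Polynomial A} (hf : ∀ n, f.coeff n ∈ p) (n : ℤ) :
    (Polynomial.toLaurent f).coeff n ∈ p := by
  rw [LaurentPolynomial.coeff_toLaurent]
  by_cases hn : ∃ k : ℕ, (k : ℤ) = n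
  · obtain ⟨k, rfl⟩ := hn
    have h := Finsupp.mapDomain_apply (Nat.castEmbedding (R := ℤ)).injective
      f.toFinsupp.coeff k
    exact h ▸ hf k
  · rw [Finsupp.mapDomain_of_notMem_range _ _ (by simpa using hn)]
    exact Ideal.zero_mem _

end

/-- Dividing the extended Rees algebra by t⁻¹ lowers the height of N by at most one, and G(m)
surjects onto the quotient. The contraction of N contains the irrelevant ideal, which is maximal, so
the two agree. -/
theorem height_le_height_irrelevantIdeal [IsNoetherianRing A] :
    (maximalIdeal A).height ≤
      Ideal.height (R := AssociatedGradedRing (maximalIdeal A)) irrelevantIdeal := by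
  obtain ⟨N, hN, hTN, hmN, hht⟩ :=
    le_height_of_extendedRees (IsLocalRing.maximalIdeal.isMaximal A).ne_top
  have := extendedRees_isNoetherianRing (maximalIdeal A)
  have h2 := hht.trans (Ideal.height_le_height_add_one_of_mem hTN)
  rw [ENat.add_le_add_iff_right (by simp)] at h2
  refine h2.trans ?_
  set τ := Ideal.span {(⟨T (-1), T_mem_extendedRees (maximalIdeal A)⟩ :
    extendedRees (maximalIdeal A))}
  have hker : RingHom.ker (Ideal.Quotient.mk τ) ≤ N := by
    rw [Ideal.mk_ker, Ideal.span_le]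
    simpa using hTN
  have hN' : (N.map (Ideal.Quotient.mk τ)).IsPrime :=
    Ideal.map_isPrime_of_surjective Ideal.Quotient.mk_surjective hker
  let π : AssociatedGradedRing (maximalIdeal A) →+* extendedRees (maximalIdeal A) ⧸ τ :=
    Ideal.Quotient.lift _ ((Ideal.Quotient.mk _).comp (reesToExtendedRees _)) (fun f hf =>
      Ideal.Quotient.eq_zero_iff_mem.mpr (reesToExtendedRees_mem_of_mem_reesIdeal hf))
  have hπ : Function.Surjective π := by
    intro y
    obtain ⟨e, rfl⟩ := Ideal.Quotient.mk_surjective y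
    obtain ⟨f, hf⟩ := exists_sub_reesToExtendedRees_mem _ e
    exact ⟨Ideal.Quotient.mk _ f, hf⟩
  refine (height_le_height_comap_of_surjective
    (S := AssociatedGradedRing (maximalIdeal A)) π hπ _).trans (le_of_eq ?_)
  congr 1
  refine (irrelevantIdeal_isMaximal.eq_of_le (Ideal.IsPrime.comap π).ne_top fun g hg => ?_).symm
  obtain ⟨f, rfl⟩ := Ideal.Quotient.mk_surjective g
  rw [mk_mem_irrelevantIdeal] at hg
  refine Ideal.mem_map_of_mem _ (hmN (reesToExtendedRees _ f) (coeff_toLaurent_mem fun n => ?_))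
  cases n with
  | zero => exact hg
  | succ n => exact Ideal.pow_le_self (Nat.succ_ne_zero n) (f.2 (n + 1))

end IrrelevantIdeal

end QuasiSocle

namespace QuasiSocle

/-! ### Initial segments of a sequence. -/

section PartialIdeal

/-- The ideal generated by `K` and the first `j` terms of a sequence. -/
def partialIdeal {S : Type*} [CommRing S] (K : Ideal S) (y : ℕ → S) : ℕ → Ideal S
  | 0 => K
  | j + 1 => partialIdeal K y j ⊔ Ideal.span {y j}

variable {S : Type*} [CommRing S]

theorem partialIdeal_mono (K : Ideal S) (y : ℕ → S) : Monotone (partialIdeal K y) :=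
  monotone_nat_of_le_succ fun _ => le_sup_left

theorem le_partialIdeal (K : Ideal S) (y : ℕ → S) (j : ℕ) : K ≤ partialIdeal K y j :=
  partialIdeal_mono K y (Nat.zero_le j)

theorem mem_partialIdeal_of_lt (K : Ideal S) (y : ℕ → S) {i j : ℕ} (hij : i < j) :
    y i ∈ partialIdeal K y j :=
  partialIdeal_mono K y hij (Ideal.mem_sup_right (Ideal.mem_span_singleton_self _))

theorem mem_partialIdeal_succ {K : Ideal S} {y : ℕ → S} {j : ℕ} {u : S} :
    u ∈ partialIdeal K y (j + 1) ↔ ∃ v ∈ partialIdeal K y j, ∃ w, u = v + y j * w := by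
  constructor
  · intro h
    obtain ⟨v, hv, z, hz, rfl⟩ := Submodule.mem_sup.mp h
    obtain ⟨w, rfl⟩ := Ideal.mem_span_singleton'.mp hz
    exact ⟨v, hv, w, by ring⟩
  · rintro ⟨v, hv, w, rfl⟩
    exact Ideal.add_mem _ (Ideal.mem_sup_left hv)
      (Ideal.mem_sup_right (Ideal.mul_mem_right _ _ (Ideal.mem_span_singleton_self _)))

theorem partialIdeal_le {K L : Ideal S} {y : ℕ → S} {j : ℕ} (hK : K ≤ L)
    (hy : ∀ i < j, y i ∈ L) : partialIdeal K y j ≤ L := by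
  induction j with
  | zero => exact hK
  | succ j ih =>
    refine sup_le (ih fun i hi => hy i (by omega)) ?_
    rw [Ideal.span_le, Set.singleton_subset_iff]
    exact hy j (by omega)

theorem partialIdeal_eq_span (y : ℕ → S) (j : ℕ) :
    partialIdeal ⊥ y j = Ideal.span (y '' Set.Iio j) := by
  refine le_antisymm (partialIdeal_le bot_le fun i hi => Ideal.subset_span ⟨i, hi, rfl⟩) ?_
  rw [Ideal.span_le]
  rintro _ ⟨i, hi, rfl⟩
  exact mem_partialIdeal_of_lt _ _ hi

theorem partialIdeal_sup_ofList (K : Ideal S) (y : ℕ → S) (k n : ℕ) :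
    partialIdeal K y k ⊔ Ideal.ofList ((List.range' k n).map y) = partialIdeal K y (k + n) := by
  induction n generalizing k with
  | zero => simp
  | succ n ih =>
    rw [List.range'_succ, List.map_cons, ofList_cons_sup]
    exact (ih (k + 1)).trans (by rw [Nat.add_right_comm, add_assoc])

theorem ofList_range_map (y : ℕ → S) (n : ℕ) :
    Ideal.ofList ((List.range' 0 n).map y) = partialIdeal ⊥ y n := by
  have := partialIdeal_sup_ofList ⊥ y 0 n
  rwa [partialIdeal, bot_sup_eq, zero_add] at this

theorem regularModulo_range_iff (K : Ideal S) (y : ℕ → S) (k n : ℕ) :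
    RegularModulo (partialIdeal K y k) ((List.range' k n).map y) ↔
      ∀ j, k ≤ j → j < k + n →
        ∀ u, y j * u ∈ partialIdeal K y j → u ∈ partialIdeal K y j := by
  induction n generalizing k with
  | zero =>
    simp only [List.range'_zero, List.map_nil, RegularModulo, true_iff]
    intro j h1 h2
    omega
  | succ n ih =>
    rw [List.range'_succ, List.map_cons]
    change _ ∧ RegularModulo (partialIdeal K y (k + 1)) _ ↔ _
    rw [ih]
    constructor
    · rintro ⟨h1, h2⟩ j hkj hj
      rcases hkj.eq_or_lt with rfl | hlt
      · exact h1
      · exact h2 j hlt (by omega)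
    · intro h
      exact ⟨h k le_rfl (by omega), fun j h1 h2 => h j (by omega) (by omega)⟩

theorem partialIdeal_map {S' : Type*} [CommRing S'] (φ : S →+* S') (y : ℕ → S) (j : ℕ) :
    partialIdeal ⊥ (fun i => φ (y i)) j = (partialIdeal ⊥ y j).map φ := by
  induction j with
  | zero => simp [partialIdeal]
  | succ j ih => simp [partialIdeal, ih, Ideal.map_sup, Ideal.map_span]

theorem RegularModulo.isWeaklyRegular {l : List S} (hl : RegularModulo ⊥ l) :
    RingTheory.Sequence.IsWeaklyRegular S l := by
  have key : ∀ (l : List S) (J : Ideal S), RegularModulo J l → ∀ (i : ℕ) (h : i < l.length),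
      ∀ u, l[i] * u ∈ J ⊔ Ideal.ofList (l.take i) → u ∈ J ⊔ Ideal.ofList (l.take i) := by
    intro l
    induction l with
    | nil => intro J _ i h; simp at h
    | cons x l ih =>
      intro J hl i h
      cases i with
      | zero => simpa using hl.1
      | succ i =>
        rw [List.take_succ_cons, ofList_cons_sup]
        exact ih _ hl.2 i (by simpa using h)
  refine ⟨fun i h => ?_⟩
  rw [isSMulRegular_quotient_iff_mem_of_smul_mem]
  intro u hu
  rw [smul_eq_mul, Ideal.mul_top, ← bot_sup_eq (a := Ideal.ofList _)] at hu ⊢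
  exact key l ⊥ hl i h u hu

end PartialIdeal

/-! ### Degree components of ideals generated by forms in graded quotients of the Rees algebra. -/

section LeadIdeal

variable {A : Type u} [CommRing A]

/-- The ideal `∑_{i < j} yᵢ Iⁿ⁻ᵃⁱ`. -/
def weightedIdeal (I : Ideal A) (y : ℕ → A) (a : ℕ → ℕ) : ℕ → ℕ → Ideal A
  | 0, _ => ⊥
  | j + 1, n => weightedIdeal I y a j n ⊔ Ideal.span {y j} * I ^ (n - a j)

theorem mem_weightedIdeal_succ {I : Ideal A} {y : ℕ → A} {a : ℕ → ℕ} {j n : ℕ} {u : A} :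
    u ∈ weightedIdeal I y a (j + 1) n ↔
      ∃ v ∈ weightedIdeal I y a j n, ∃ w ∈ I ^ (n - a j), u = v + y j * w := by
  constructor
  · intro h
    obtain ⟨v, hv, z, hz, rfl⟩ := Submodule.mem_sup.mp h
    obtain ⟨w, hw, rfl⟩ := Ideal.mem_span_singleton_mul.mp hz
    exact ⟨v, hv, w, hw, rfl⟩
  · rintro ⟨v, hv, w, hw, rfl⟩
    exact Ideal.add_mem _ (Ideal.mem_sup_left hv)
      (Ideal.mem_sup_right (Ideal.mem_span_singleton_mul.mpr ⟨w, hw, rfl⟩))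

theorem weightedIdeal_mono_left (I : Ideal A) (y : ℕ → A) (a : ℕ → ℕ) (n : ℕ) :
    Monotone fun j => weightedIdeal I y a j n :=
  monotone_nat_of_le_succ fun _ => le_sup_left

theorem weightedIdeal_le_partialIdeal (I : Ideal A) (y : ℕ → A) (a : ℕ → ℕ) (j n : ℕ) :
    weightedIdeal I y a j n ≤ partialIdeal ⊥ y j := by
  induction j with
  | zero => exact le_rfl
  | succ j ih => exact sup_le_sup ih Ideal.mul_le_left

theorem weightedIdeal_zero (I : Ideal A) (y : ℕ → A) (a : ℕ → ℕ) (j : ℕ) :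
    weightedIdeal I y a j 0 = partialIdeal ⊥ y j := by
  induction j with
  | zero => rfl
  | succ j ih => simp [weightedIdeal, partialIdeal, ih]

/-- The degree `n` part of the ideal of `⨁ Iⁿ / J Iⁿ` generated by the forms of degree `aᵢ` given
by `yᵢ`, for `i < j`. -/
def leadIdeal (J I : Ideal A) (y : ℕ → A) (a : ℕ → ℕ) (j n : ℕ) : Ideal A :=
  weightedIdeal I y a j n ⊔ J * I ^ n

theorem mem_leadIdeal_succ {J I : Ideal A} {y : ℕ → A} {a : ℕ → ℕ} {j n : ℕ} {u : A} :
    u ∈ leadIdeal J I y a (j + 1) n ↔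
      ∃ v ∈ leadIdeal J I y a j n, ∃ w ∈ I ^ (n - a j), u = v + y j * w := by
  constructor
  · intro h
    obtain ⟨v, hv, z, hz, rfl⟩ := Submodule.mem_sup.mp h
    obtain ⟨v', hv', w, hw, rfl⟩ := mem_weightedIdeal_succ.mp hv
    exact ⟨v' + z, Submodule.add_mem_sup hv' hz, w, hw, by ring⟩
  · rintro ⟨v, hv, w, hw, rfl⟩
    obtain ⟨v', hv', z, hz, rfl⟩ := Submodule.mem_sup.mp hv
    rw [add_right_comm]
    exact Submodule.add_mem_sup (mem_weightedIdeal_succ.mpr ⟨v', hv', w, hw, rfl⟩) hz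

theorem leadIdeal_mono_left (J I : Ideal A) (y : ℕ → A) (a : ℕ → ℕ) (n : ℕ) :
    Monotone fun j => leadIdeal J I y a j n :=
  fun _ _ h => sup_le_sup_right (weightedIdeal_mono_left I y a n h) _

theorem mul_pow_le_leadIdeal (J I : Ideal A) (y : ℕ → A) (a : ℕ → ℕ) (j n : ℕ) :
    J * I ^ n ≤ leadIdeal J I y a j n := le_sup_right

theorem pow_le_mul_pow {J I : Ideal A} (hIJ : I ≤ J) {k n : ℕ} (h : n < k) :
    I ^ k ≤ J * I ^ n := by
  refine (Ideal.pow_le_pow_right h).trans ?_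
  rw [Nat.succ_eq_add_one, pow_succ']
  exact Ideal.mul_mono_left hIJ

theorem coeff_monomial_mul_eq (k : ℕ) (r : A) (p : Polynomial A) (n : ℕ) :
    (Polynomial.monomial k r * p).coeff n = if k ≤ n then r * p.coeff (n - k) else 0 := by
  rw [← Polynomial.C_mul_X_pow_eq_monomial, mul_assoc, Polynomial.coeff_C_mul,
    Polynomial.coeff_X_pow_mul']
  split_ifs <;> simp

theorem mem_reesIdeal_iff {J I : Ideal A} {f : reesAlgebra I} :
    f ∈ reesIdeal J I ↔ ∀ n, (f : Polynomial A).coeff n ∈ J * I ^ n := Iff.rfl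

variable {J I : Ideal A} {y : ℕ → A} {a : ℕ → ℕ} {h : ℕ → reesAlgebra I}

theorem coeff_mem_leadIdeal (hh : ∀ i, (h i : Polynomial A) = Polynomial.monomial (a i) (y i))
    {j : ℕ} {f : reesAlgebra I} (hf : f ∈ partialIdeal (reesIdeal J I) h j) (n : ℕ) :
    (f : Polynomial A).coeff n ∈ leadIdeal J I y a j n := by
  induction j generalizing f with
  | zero => exact Ideal.mem_sup_right (hf n)
  | succ j ih =>
    obtain ⟨v, hv, w, rfl⟩ := mem_partialIdeal_succ.mp hf
    have : ((v + h j * w : reesAlgebra I) : Polynomial A).coeff n =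
        (v : Polynomial A).coeff n + if a j ≤ n then y j * (w : Polynomial A).coeff (n - a j)
          else 0 := by
      rw [← coeff_monomial_mul_eq, ← hh]
      simp
    rw [this]
    split_ifs
    · exact mem_leadIdeal_succ.mpr ⟨_, ih hv, _, w.2 _, rfl⟩
    · rw [add_zero]
      exact leadIdeal_mono_left J I y a n (Nat.le_succ j) (ih hv)

theorem mem_pow_of_coe_eq_monomial
    (hh : ∀ i, (h i : Polynomial A) = Polynomial.monomial (a i) (y i)) (i : ℕ) :
    y i ∈ I ^ a i := by
  rw [← reesAlgebra.monomial_mem, ← hh]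
  exact (h i).2

theorem monomial_mem_partialIdeal (hIJ : I ≤ J)
    (hh : ∀ i, (h i : Polynomial A) = Polynomial.monomial (a i) (y i))
    {j n : ℕ} {c : A} (hc : c ∈ leadIdeal J I y a j n) :
    ∃ hc' : Polynomial.monomial n c ∈ reesAlgebra I,
      (⟨Polynomial.monomial n c, hc'⟩ : reesAlgebra I) ∈ partialIdeal (reesIdeal J I) h j := by
  have hz : ∀ z ∈ J * I ^ n, ∃ hc' : Polynomial.monomial n z ∈ reesAlgebra I,
      (⟨Polynomial.monomial n z, hc'⟩ : reesAlgebra I) ∈ reesIdeal J I := by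
    intro z hz
    refine ⟨reesAlgebra.monomial_mem.mpr (Ideal.mul_le_right hz),
      mem_reesIdeal_iff.mpr fun k => ?_⟩
    change (Polynomial.monomial n z).coeff k ∈ _
    rw [Polynomial.coeff_monomial]
    split_ifs with hnk
    · rwa [← hnk]
    · exact Ideal.zero_mem _
  induction j generalizing c with
  | zero => exact hz c (by simpa [leadIdeal, weightedIdeal] using hc)
  | succ j ih =>
    obtain ⟨v, hv, w, hw, rfl⟩ := mem_leadIdeal_succ.mp hc
    obtain ⟨hv', hv''⟩ := ih hv
    by_cases hn : a j ≤ n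
    · have hwm : Polynomial.monomial (n - a j) w ∈ reesAlgebra I :=
        reesAlgebra.monomial_mem.mpr hw
      have heq : Polynomial.monomial n (v + y j * w) = Polynomial.monomial n v +
          (h j : Polynomial A) * Polynomial.monomial (n - a j) w := by
        rw [hh, Polynomial.monomial_mul_monomial, map_add, Nat.add_sub_cancel' hn]
      refine ⟨heq ▸ add_mem hv' (mul_mem (h j).2 hwm), ?_⟩
      exact mem_partialIdeal_succ.mpr ⟨_, hv'', ⟨_, hwm⟩, Subtype.ext heq⟩
    -- The exponent n - a j is truncated to 0 here. No harm results: y j has order a j > n, so the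
    -- extra term already lies in J Iⁿ.
    · obtain ⟨hz', hz''⟩ := hz (y j * w) (pow_le_mul_pow hIJ (not_le.mp hn)
        (Ideal.mul_mem_right _ _ (mem_pow_of_coe_eq_monomial hh j)))
      have heq : Polynomial.monomial n (v + y j * w) = Polynomial.monomial n v +
          Polynomial.monomial n (y j * w) := map_add _ _ _
      refine ⟨heq ▸ add_mem hv' hz', ?_⟩
      have := Ideal.add_mem _ (partialIdeal_mono _ _ (Nat.le_succ j) hv'')
        (le_partialIdeal (reesIdeal J I) h (j + 1) hz'')
      convert this using 1
      exact Subtype.ext heq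

theorem mem_of_monomial_mem {B : Ideal (reesAlgebra I)} {f : reesAlgebra I}
    (hf : ∀ n, ∃ hc : Polynomial.monomial n ((f : Polynomial A).coeff n) ∈ reesAlgebra I,
      (⟨_, hc⟩ : reesAlgebra I) ∈ B) : f ∈ B := by
  choose hc hB using hf
  have : f = ∑ n ∈ (f : Polynomial A).support, ⟨_, hc n⟩ := by
    refine Subtype.ext ?_
    rw [AddSubmonoidClass.coe_finsetSum]
    exact (f : Polynomial A).as_sum_support
  rw [this]
  exact Ideal.sum_mem _ fun n _ => hB n

/-- An ideal generated by homogeneous elements contains f exactly when it contains each component of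
f. -/
theorem mem_partialIdeal_iff_coeff (hIJ : I ≤ J)
    (hh : ∀ i, (h i : Polynomial A) = Polynomial.monomial (a i) (y i))
    {j : ℕ} {f : reesAlgebra I} :
    f ∈ partialIdeal (reesIdeal J I) h j ↔
      ∀ n, (f : Polynomial A).coeff n ∈ leadIdeal J I y a j n :=
  ⟨coeff_mem_leadIdeal hh, fun hf => mem_of_monomial_mem fun n =>
    monomial_mem_partialIdeal hIJ hh (hf n)⟩

end LeadIdeal

end QuasiSocle

namespace QuasiSocle

theorem map_mem_partialIdeal_iff {S T : Type*} [CommRing S] [CommRing T] {π : S →+* T}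
    (hπ : Function.Surjective π) {K : Ideal S} (hK : RingHom.ker π = K) {y : ℕ → S} {j : ℕ}
    {u : S} : π u ∈ partialIdeal ⊥ (fun i => π (y i)) j ↔ u ∈ partialIdeal K y j := by
  induction j generalizing u with
  | zero => rw [← hK]; rfl
  | succ j ih =>
    rw [mem_partialIdeal_succ, mem_partialIdeal_succ]
    constructor
    · rintro ⟨v, hv, w, hw⟩
      obtain ⟨w, rfl⟩ := hπ w
      refine ⟨u - y j * w, ih.mp ?_, w, by ring⟩
      rw [map_sub, map_mul, hw, add_sub_cancel_right]
      exact hv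
    · rintro ⟨v, hv, w, rfl⟩
      exact ⟨_, ih.mpr hv, π w, by rw [map_add, map_mul]⟩

theorem exists_max_of_bounded {P : ℕ → Prop} (N : ℕ) (h : ∃ n, P n)
    (hN : ∀ n, P n → n ≤ N) : ∃ n, P n ∧ ∀ k, P k → k ≤ n := by
  classical
  obtain ⟨n, hn⟩ := h
  refine ⟨_, Nat.findGreatest_spec (hN n hn) hn, fun k hk => Nat.le_findGreatest (hN k hk) hk⟩

/-! ### Homogeneous elements of the Rees algebra and powers of a reduction. -/

section ReesMonomial

variable {A : Type u} [CommRing A]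

/-- The element of the Rees algebra given by an element of `Iⁿ`. -/
noncomputable def reesMonomial {I : Ideal A} {n : ℕ} {u : A} (hu : u ∈ I ^ n) : reesAlgebra I :=
  ⟨Polynomial.monomial n u, reesAlgebra.monomial_mem.mpr hu⟩

theorem pow_le_partialIdeal_mul {I : Ideal A} {x : ℕ → A} {d n₀ : ℕ}
    (hred : I ^ (n₀ + 1) ≤ partialIdeal ⊥ x d * I ^ n₀) {n : ℕ} (hn : n₀ ≤ n) :
    I ^ (n + 1) ≤ partialIdeal ⊥ x d * I ^ n := by
  obtain ⟨k, rfl⟩ := Nat.exists_eq_add_of_le hn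
  calc I ^ (n₀ + k + 1) = I ^ (n₀ + 1) * I ^ k := by ring
    _ ≤ partialIdeal ⊥ x d * I ^ n₀ * I ^ k := Ideal.mul_mono_left hred
    _ = _ := by ring

theorem partialIdeal_mul_pow_le (I : Ideal A) (x : ℕ → A) (d n : ℕ) :
    partialIdeal ⊥ x d * I ^ n ≤ weightedIdeal I x (fun _ => 1) d (n + 1) := by
  induction d with
  | zero => simp [partialIdeal]
  | succ d ih =>
    rw [partialIdeal, Ideal.sup_mul]
    exact sup_le_sup ih le_rfl

theorem coeff_mul_reesMonomial {I : Ideal A} {n : ℕ} {u : A} (hu : u ∈ I ^ n)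
    (s : reesAlgebra I) (k : ℕ) :
    ((s * reesMonomial hu : reesAlgebra I) : Polynomial A).coeff (k + n) =
      (s : Polynomial A).coeff k * u := by
  change ((s : Polynomial A) * Polynomial.monomial n u).coeff (k + n) = _
  exact Polynomial.coeff_mul_monomial _ _ _ _

end ReesMonomial

/-! ### Consequences of the Gorenstein property of G(m), degree by degree. -/

section GorensteinCone

variable {A : Type u} [CommRing A] [IsLocalRing A] {G : Type u} [CommRing G]
  {π : reesAlgebra (maximalIdeal A) →+* G} {P : Ideal G} [P.IsMaximal]

/-- A presentation of the associated graded ring of the maximal ideal, with its irrelevant ideal. -/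
structure IsTangentCone (π : reesAlgebra (maximalIdeal A) →+* G) (P : Ideal G) : Prop where
  surjective : Function.Surjective π
  ker_eq : RingHom.ker π = reesIdeal (maximalIdeal A) (maximalIdeal A)
  mem_iff : ∀ f, π f ∈ P ↔ (f : Polynomial A).coeff 0 ∈ maximalIdeal A

/-- The map from the Rees algebra of the maximal ideal to a localization of a quotient of it. -/
noncomputable def reesToLocal (π : reesAlgebra (maximalIdeal A) →+* G) (P : Ideal G)
    [P.IsMaximal] : reesAlgebra (maximalIdeal A) →+* Localization.AtPrime P :=
  (algebraMap G (Localization.AtPrime P)).comp π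

theorem IsTangentCone.mem_partialIdeal_iff (hπ : IsTangentCone π P)
    {h : ℕ → reesAlgebra (maximalIdeal A)} {j : ℕ} {f : reesAlgebra (maximalIdeal A)} :
    reesToLocal π P f ∈ partialIdeal ⊥ (fun i => reesToLocal π P (h i)) j ↔
      ∃ s : reesAlgebra (maximalIdeal A), (s : Polynomial A).coeff 0 ∉ maximalIdeal A ∧
        s * f ∈ partialIdeal (reesIdeal (maximalIdeal A) (maximalIdeal A)) h j := by
  have h1 : partialIdeal ⊥ (fun i => reesToLocal π P (h i)) j =
      (partialIdeal ⊥ (fun i => π (h i)) j).map (algebraMap G (Localization.AtPrime P)) :=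
    partialIdeal_map (algebraMap G (Localization.AtPrime P)) _ j
  rw [h1]
  change algebraMap G _ (π f) ∈ _ ↔ _
  rw [IsLocalization.algebraMap_mem_map_algebraMap_iff P.primeCompl]
  constructor
  · rintro ⟨s, hs, hsf⟩
    obtain ⟨s, rfl⟩ := hπ.surjective s
    refine ⟨s, fun h => hs ((hπ.mem_iff s).mpr h), ?_⟩
    rw [← map_mul] at hsf
    exact (map_mem_partialIdeal_iff hπ.surjective hπ.ker_eq).mp hsf
  · rintro ⟨s, hs, hsf⟩
    refine ⟨π s, fun h => hs ((hπ.mem_iff s).mp h), ?_⟩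
    rw [← map_mul]
    exact (map_mem_partialIdeal_iff hπ.surjective hπ.ker_eq).mpr hsf

theorem IsTangentCone.exists_mul_eq (hπ : IsTangentCone π P) (b : Localization.AtPrime P) :
    ∃ s g : reesAlgebra (maximalIdeal A), (s : Polynomial A).coeff 0 ∉ maximalIdeal A ∧
      reesToLocal π P s * b = reesToLocal π P g := by
  obtain ⟨⟨g, s⟩, hgs⟩ := IsLocalization.surj P.primeCompl b
  obtain ⟨g, rfl⟩ := hπ.surjective g
  obtain ⟨s, hs⟩ := s
  obtain ⟨s, rfl⟩ := hπ.surjective s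
  refine ⟨s, g, fun h => hs ((hπ.mem_iff s).mpr h), ?_⟩
  rw [mul_comm]
  exact hgs

theorem IsTangentCone.maximalIdeal_le (hπ : IsTangentCone π P)
    {L : Ideal (Localization.AtPrime P)}
    (hL : ∀ f : reesAlgebra (maximalIdeal A), (f : Polynomial A).coeff 0 ∈ maximalIdeal A →
      reesToLocal π P f ∈ L) :
    maximalIdeal (Localization.AtPrime P) ≤ L := by
  rw [← IsLocalization.AtPrime.map_eq_maximalIdeal P, Ideal.map_le_iff_le_comap]
  intro g hg
  obtain ⟨g, rfl⟩ := hπ.surjective g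
  exact hL g ((hπ.mem_iff g).mp hg)

theorem IsTangentCone.mem_maximalIdeal (hπ : IsTangentCone π P)
    {f : reesAlgebra (maximalIdeal A)} (hf : (f : Polynomial A).coeff 0 ∈ maximalIdeal A) :
    reesToLocal π P f ∈ maximalIdeal (Localization.AtPrime P) := by
  rw [← IsLocalization.AtPrime.map_eq_maximalIdeal P]
  exact Ideal.mem_map_of_mem _ ((hπ.mem_iff f).mpr hf)

/-- Since (x₀, …) is a reduction, a high power of a form of positive degree lies in the ideal
generated by the degree one forms of the xᵢ, and the aᵢ-th power of the i-th of these is `h i`. -/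
theorem mem_radical_of_coeff_zero_mem {x : ℕ → A} {a : ℕ → ℕ} {d n₀ : ℕ}
    (hx : ∀ i, x i ∈ maximalIdeal A)
    (hred : maximalIdeal A ^ (n₀ + 1) ≤ partialIdeal ⊥ x d * maximalIdeal A ^ n₀)
    {h : ℕ → reesAlgebra (maximalIdeal A)}
    (hh : ∀ i, (h i : Polynomial A) = Polynomial.monomial (a i) (x i ^ a i))
    {f : reesAlgebra (maximalIdeal A)} (hf : (f : Polynomial A).coeff 0 ∈ maximalIdeal A) :
    f ∈ (partialIdeal (reesIdeal (maximalIdeal A) (maximalIdeal A)) h d).radical := by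
  let h₁ : ℕ → reesAlgebra (maximalIdeal A) := fun i => reesMonomial (n := 1) (u := x i) (by simpa using hx i)
  have h₁B : partialIdeal (reesIdeal (maximalIdeal A) (maximalIdeal A)) h₁ d ≤
      (partialIdeal (reesIdeal (maximalIdeal A) (maximalIdeal A)) h d).radical := by
    refine partialIdeal_le ((le_partialIdeal _ _ _).trans Ideal.le_radical) fun i hi => ?_
    refine ⟨a i, ?_⟩
    have : h₁ i ^ a i = h i := by
      refine Subtype.ext ?_
      rw [hh]
      change Polynomial.monomial 1 (x i) ^ a i = _
      rw [Polynomial.monomial_pow, one_mul]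
    rw [this]
    exact mem_partialIdeal_of_lt _ _ hi
  refine mem_of_monomial_mem fun n => ?_
  have hn : (f : Polynomial A).coeff n ∈ maximalIdeal A ^ n := f.2 n
  refine ⟨reesAlgebra.monomial_mem.mpr hn, ?_⟩
  rcases Nat.eq_zero_or_pos n with rfl | hn0
  · refine Ideal.le_radical (le_partialIdeal _ _ _ (mem_reesIdeal_iff.mpr fun k => ?_))
    change (Polynomial.monomial 0 _).coeff k ∈ _
    rw [Polynomial.coeff_monomial]
    split_ifs with hk
    · subst hk
      simpa using hf
    · exact Ideal.zero_mem _
  · have hk : (f : Polynomial A).coeff n ^ (n₀ + 1) ∈ maximalIdeal A ^ (n * (n₀ + 1)) := by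
      rw [pow_mul]
      exact Ideal.pow_mem_pow hn _
    obtain ⟨k, hk1⟩ : ∃ k, n * (n₀ + 1) = k + 1 :=
      ⟨n * (n₀ + 1) - 1, (Nat.sub_add_cancel (Nat.mul_pos hn0 (Nat.succ_pos _))).symm⟩
    have hk0 : n₀ ≤ k := by
      have := Nat.le_mul_of_pos_left (n₀ + 1) hn0
      omega
    rw [hk1] at hk
    obtain ⟨hc, hc'⟩ := monomial_mem_partialIdeal (J := maximalIdeal A) (h := h₁) (a := fun _ => 1) le_rfl
      (fun i => rfl)
      (Ideal.mem_sup_left (partialIdeal_mul_pow_le _ x d k (pow_le_partialIdeal_mul hred hk0 hk)))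
    have := h₁B hc'
    refine (Ideal.radical_idem _).le ⟨n₀ + 1, ?_⟩
    convert this using 1
    refine Subtype.ext ?_
    change Polynomial.monomial n _ ^ (n₀ + 1) = Polynomial.monomial _ _
    rw [Polynomial.monomial_pow, hk1]

theorem coeff_zero_one_notMem :
    ((1 : reesAlgebra (maximalIdeal A)) : Polynomial A).coeff 0 ∉ maximalIdeal A := by
  have : ((1 : reesAlgebra (maximalIdeal A)) : Polynomial A).coeff 0 = 1 := by simp
  rw [this]
  exact (Ideal.ne_top_iff_one _).mp (IsLocalRing.maximalIdeal.isMaximal A).ne_top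

theorem mem_of_mul_mem_of_notMem {L : Ideal A} {s u : A} (hs : s ∉ maximalIdeal A)
    (h : s * u ∈ L) : u ∈ L := by
  have hs' : IsUnit s := by simpa using hs
  exact (Ideal.unit_mul_mem_iff_mem _ hs').mp h

theorem IsTangentCone.exists_pow_le [IsNoetherianRing (Localization.AtPrime P)]
    (hπ : IsTangentCone π P) {x : ℕ → A} {a : ℕ → ℕ} {d n₀ : ℕ}
    (hx : ∀ i, x i ∈ maximalIdeal A)
    (hred : maximalIdeal A ^ (n₀ + 1) ≤ partialIdeal ⊥ x d * maximalIdeal A ^ n₀)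
    {h : ℕ → reesAlgebra (maximalIdeal A)}
    (hh : ∀ i, (h i : Polynomial A) = Polynomial.monomial (a i) (x i ^ a i)) :
    ∃ k, maximalIdeal (Localization.AtPrime P) ^ k ≤
      partialIdeal ⊥ (fun i => reesToLocal π P (h i)) d := by
  refine Ideal.exists_pow_le_of_le_radical_of_fg ?_ (IsNoetherian.noetherian _)
  refine hπ.maximalIdeal_le fun f hf => ?_
  obtain ⟨k, hk⟩ := mem_radical_of_coeff_zero_mem hx hred hh hf
  refine ⟨k, ?_⟩
  rw [← map_pow]
  exact hπ.mem_partialIdeal_iff.mpr ⟨1, coeff_zero_one_notMem, by rwa [one_mul]⟩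

/-- Localizing loses nothing on forms: the denominator has a unit as its degree zero coefficient, so
it can be cancelled after comparing components in degree n. -/
theorem IsTangentCone.reesMonomial_mem_iff (hπ : IsTangentCone π P)
    {y : ℕ → A} {a : ℕ → ℕ} {h : ℕ → reesAlgebra (maximalIdeal A)}
    (hh : ∀ i, (h i : Polynomial A) = Polynomial.monomial (a i) (y i)) {j n : ℕ} {u : A}
    (hu : u ∈ maximalIdeal A ^ n) :
    reesToLocal π P (reesMonomial hu) ∈ partialIdeal ⊥ (fun i => reesToLocal π P (h i)) j ↔
      u ∈ leadIdeal (maximalIdeal A) (maximalIdeal A) y a j n := by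
  rw [hπ.mem_partialIdeal_iff]
  constructor
  · rintro ⟨s, hs, hsu⟩
    have := coeff_mem_leadIdeal hh hsu (0 + n)
    rw [coeff_mul_reesMonomial, zero_add] at this
    exact mem_of_mul_mem_of_notMem hs this
  · intro h
    obtain ⟨_, hc⟩ := monomial_mem_partialIdeal le_rfl hh h
    exact ⟨1, coeff_zero_one_notMem, by rw [one_mul]; exact hc⟩

/-- Taking e maximal makes the form u v a nonzero socle element of the graded quotient. -/
theorem exists_maximal_multiplier {y : ℕ → A} {a : ℕ → ℕ} {d ρ : ℕ}
    (hρ : ∀ n, ρ < n → maximalIdeal A ^ n ≤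
      leadIdeal (maximalIdeal A) (maximalIdeal A) y a d n) {n : ℕ} {u : A}
    (hu : u ∈ maximalIdeal A ^ n)
    (huL : u ∉ leadIdeal (maximalIdeal A) (maximalIdeal A) y a d n) :
    ∃ e, n + e ≤ ρ ∧ ∃ v ∈ maximalIdeal A ^ e,
      u * v ∉ leadIdeal (maximalIdeal A) (maximalIdeal A) y a d (n + e) ∧
      ∀ e', e < e' → ∀ v ∈ maximalIdeal A ^ e',
        u * v ∈ leadIdeal (maximalIdeal A) (maximalIdeal A) y a d (n + e') := by
  have hbound : ∀ e, (∃ v ∈ maximalIdeal A ^ e, u * v ∉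
      leadIdeal (maximalIdeal A) (maximalIdeal A) y a d (n + e)) → n + e ≤ ρ := by
    rintro e ⟨v, hv, huv⟩
    by_contra hlt
    refine huv (hρ _ (not_le.mp hlt) ?_)
    rw [pow_add]
    exact Ideal.mul_mem_mul hu hv
  obtain ⟨e, he, hmax⟩ := exists_max_of_bounded
    (P := fun e => ∃ v ∈ maximalIdeal A ^ e, u * v ∉
      leadIdeal (maximalIdeal A) (maximalIdeal A) y a d (n + e)) ρ
    ⟨0, 1, by simp, by simpa using huL⟩ (fun e he => by have := hbound e he; omega)
  obtain ⟨v, hv, huv⟩ := he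
  refine ⟨e, hbound e ⟨v, hv, huv⟩, v, hv, huv, fun e' he' v' hv' => ?_⟩
  by_contra hc
  exact absurd (hmax e' ⟨v', hv', hc⟩) (by omega)

/-- The forms `h i` are parameters of a local ring of finite injective dimension, hence regular.
Both t and a maximal multiple u v of u are nonzero socle elements, so t is a multiple of u v; a
degree comparison then forces u v to have degree ρ. -/
theorem IsTangentCone.regular_and_socle (hπ : IsTangentCone π P)
    (hP : IsGorensteinLocalRing (Localization.AtPrime P))
    {x : ℕ → A} {a : ℕ → ℕ} {d n₀ : ℕ} (hd : (d : ℕ∞) ≤ P.height)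
    (hx : ∀ i, x i ∈ maximalIdeal A) (ha : ∀ i, 0 < a i)
    (hred : maximalIdeal A ^ (n₀ + 1) ≤ partialIdeal ⊥ x d * maximalIdeal A ^ n₀) :
    (∀ j < d, ∀ n, ∀ u ∈ maximalIdeal A ^ n,
      x j ^ a j * u ∈ leadIdeal (maximalIdeal A) (maximalIdeal A) (fun i => x i ^ a i) a j
        (n + a j) →
      u ∈ leadIdeal (maximalIdeal A) (maximalIdeal A) (fun i => x i ^ a i) a j n) ∧
    ∀ ρ, (∀ n, ρ < n → maximalIdeal A ^ n ≤
        leadIdeal (maximalIdeal A) (maximalIdeal A) (fun i => x i ^ a i) a d n) →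
      ∀ t ∈ maximalIdeal A ^ ρ,
        t ∉ leadIdeal (maximalIdeal A) (maximalIdeal A) (fun i => x i ^ a i) a d ρ →
      ∀ n, ∀ u ∈ maximalIdeal A ^ n,
        u ∉ leadIdeal (maximalIdeal A) (maximalIdeal A) (fun i => x i ^ a i) a d n →
        ∃ e, n + e = ρ ∧ ∃ v ∈ maximalIdeal A ^ e, u * v ∉
          leadIdeal (maximalIdeal A) (maximalIdeal A) (fun i => x i ^ a i) a d ρ := by
  obtain ⟨hN, hid⟩ := hP
  let h : ℕ → reesAlgebra (maximalIdeal A) := fun i => reesMonomial (Ideal.pow_mem_pow (hx i) (a i))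
  have hh : ∀ i, (h i : Polynomial A) = Polynomial.monomial (a i) (x i ^ a i) := fun i => rfl
  let θ : ℕ → Localization.AtPrime P := fun i => reesToLocal π P (h i)
  have hθm : ∀ z ∈ (List.range' 0 d).map θ, z ∈ maximalIdeal (Localization.AtPrime P) := by
    intro z hz
    obtain ⟨i, -, rfl⟩ := List.mem_map.mp hz
    refine hπ.mem_maximalIdeal ?_
    rw [hh, Polynomial.coeff_monomial, if_neg (ha i).ne']
    exact Ideal.zero_mem _
  have hdim : (((List.range' 0 d).map θ).length : ℕ∞) ≤
      (maximalIdeal (Localization.AtPrime P)).height := by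
    rw [List.length_map, List.length_range']
    refine hd.trans (le_of_eq ?_)
    have h1 := IsLocalization.AtPrime.ringKrullDim_eq_height P (Localization.AtPrime P)
    rw [← IsLocalRing.maximalIdeal_height_eq_ringKrullDim] at h1
    exact_mod_cast h1.symm
  obtain ⟨k, hk⟩ := hπ.exists_pow_le hx hred hh
  change _ ≤ partialIdeal ⊥ θ d at hk
  rw [← ofList_range_map] at hk
  have hreg := gorenstein_regularModulo hid _ hθm hdim k hk
  have hsoc := gorenstein_socle hid _ hθm hreg
  rw [ofList_range_map] at hsoc
  have hreg' := (regularModulo_range_iff ⊥ θ 0 d).mp hreg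
  refine ⟨fun j hj n u hu hju => ?_, fun ρ hρ t ht htL n u hu huL => ?_⟩
  · have hju' : x j ^ a j * u ∈ maximalIdeal A ^ (n + a j) := by
      rw [add_comm, pow_add]
      exact Ideal.mul_mem_mul (Ideal.pow_mem_pow (hx j) _) hu
    rw [← hπ.reesMonomial_mem_iff hh hju'] at hju
    rw [← hπ.reesMonomial_mem_iff hh hu]
    refine hreg' j (Nat.zero_le _) (by omega) _ ?_
    change reesToLocal π P (h j) * reesToLocal π P (reesMonomial hu) ∈ partialIdeal ⊥ θ j
    rw [← map_mul]
    convert hju using 2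
    refine Subtype.ext ?_
    change Polynomial.monomial (a j) (x j ^ a j) * Polynomial.monomial n u =
      Polynomial.monomial _ _
    rw [Polynomial.monomial_mul_monomial, add_comm]
  · obtain ⟨e, hle, v, hv, huv, hbeyond⟩ := exists_maximal_multiplier hρ hu huL
    have hw : u * v ∈ maximalIdeal A ^ (n + e) := by
      rw [pow_add]
      exact Ideal.mul_mem_mul hu hv
    have hkill : ∀ (N : ℕ) (w : A) (hw : w ∈ maximalIdeal A ^ N),
        (∀ k, 0 < k → ∀ r ∈ maximalIdeal A ^ k, r * w ∈ leadIdeal (maximalIdeal A)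
          (maximalIdeal A) (fun i => x i ^ a i) a d (k + N)) →
        ∀ r ∈ maximalIdeal (Localization.AtPrime P),
          r * reesToLocal π P (reesMonomial hw) ∈ partialIdeal ⊥ θ d := by
      intro N w hw hk
      have : maximalIdeal (Localization.AtPrime P) ≤ Submodule.comap
          (LinearMap.mulRight _ (reesToLocal π P (reesMonomial hw))) (partialIdeal ⊥ θ d) := by
        refine hπ.maximalIdeal_le fun f hf => ?_
        change reesToLocal π P f * reesToLocal π P (reesMonomial hw) ∈ partialIdeal ⊥ θ d
        rw [← map_mul]
        refine hπ.mem_partialIdeal_iff.mpr ⟨1, coeff_zero_one_notMem, ?_⟩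
        rw [one_mul, mem_partialIdeal_iff_coeff le_rfl hh]
        intro k
        rcases lt_or_ge k N with hkN | hkN
        · change ((f : Polynomial A) * Polynomial.monomial N w).coeff k ∈ _
          rw [mul_comm, coeff_monomial_mul_eq, if_neg (by omega)]
          exact Ideal.zero_mem _
        · obtain ⟨k, rfl⟩ := Nat.exists_eq_add_of_le' hkN
          rw [coeff_mul_reesMonomial]
          rcases Nat.eq_zero_or_pos k with rfl | hk0
          · rw [zero_add]
            exact mul_pow_le_leadIdeal _ _ _ _ _ _ (Ideal.mul_mem_mul hf hw)
          · exact hk k hk0 _ (f.2 k)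
      exact this
    obtain ⟨b, hb⟩ := hsoc (reesToLocal π P (reesMonomial hw)) (reesToLocal π P (reesMonomial ht))
      (fun hc => huv ((hπ.reesMonomial_mem_iff hh hw).mp hc))
      (hkill _ _ hw fun k hk r hr => by
        have := hbeyond (k + e) (by omega) (r * v) (by
          rw [pow_add]
          exact Ideal.mul_mem_mul hr hv)
        rw [show r * (u * v) = u * (r * v) by ring, show k + (n + e) = n + (k + e) by ring]
        exact this)
      (hkill _ _ ht fun k hk r hr => hρ _ (by omega) (by
        rw [pow_add]
        exact Ideal.mul_mem_mul hr ht))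
    obtain ⟨s, g, hs, hsb⟩ := hπ.exists_mul_eq b
    -- The factor b and the membership live in the localization; s and then s' clear denominators,
    -- so that coefficients can be compared in degree ρ = r + (n + e).
    have hb' : reesToLocal π P (s * reesMonomial ht - g * reesMonomial hw) ∈
        partialIdeal ⊥ θ d := by
      rw [map_sub, map_mul, map_mul, ← hsb, mul_assoc, ← mul_sub]
      exact Ideal.mul_mem_left _ _ hb
    obtain ⟨s', hs', hmem⟩ := hπ.mem_partialIdeal_iff.mp hb'
    have hcoeff := coeff_mem_leadIdeal hh hmem (0 + ρ)
    obtain ⟨r, hr⟩ := Nat.exists_eq_add_of_le' hle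
    have hexp : ((s' * (s * reesMonomial ht - g * reesMonomial hw) :
        reesAlgebra (maximalIdeal A)) : Polynomial A).coeff (0 + ρ) =
        ((s' * s : reesAlgebra (maximalIdeal A)) : Polynomial A).coeff 0 * t -
          ((s' * g : reesAlgebra (maximalIdeal A)) : Polynomial A).coeff r * (u * v) := by
      rw [← coeff_mul_reesMonomial ht, ← coeff_mul_reesMonomial hw, mul_sub, ← mul_assoc,
        ← mul_assoc, ← hr, zero_add]
      exact Polynomial.coeff_sub _ _ _
    rw [hexp, zero_add] at hcoeff
    have hss : ((s' * s : reesAlgebra (maximalIdeal A)) : Polynomial A).coeff 0 ∉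
        maximalIdeal A := by
      change ((s' : Polynomial A) * (s : Polynomial A)).coeff 0 ∉ _
      rw [Polynomial.mul_coeff_zero]
      exact fun hc => ((IsLocalRing.maximalIdeal.isMaximal A).isPrime.mem_or_mem hc).elim hs' hs
    rcases Nat.eq_zero_or_pos r with rfl | hr0
    · rw [zero_add] at hr
      exact ⟨e, hr.symm, v, hv, by rwa [hr]⟩
    -- For r > 0 the coefficient of degree r kills u v by maximality of e, which would put a unit
    -- multiple of t in the ideal of forms.
    · refine absurd (mem_of_mul_mem_of_notMem hss ?_) htL
      refine (Submodule.sub_mem_iff_left _ ?_).mp hcoeff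
      have := hbeyond (r + e) (by omega)
        (((s' * g : reesAlgebra (maximalIdeal A)) : Polynomial A).coeff r * v) (by
          rw [pow_add]
          exact Ideal.mul_mem_mul ((s' * g).2 r) hv)
      rw [hr, show r + (n + e) = n + (r + e) by ring, mul_left_comm]
      exact this

theorem isTangentCone_mk : IsTangentCone (G := AssociatedGradedRing (maximalIdeal A))
    (Ideal.Quotient.mk _) irrelevantIdeal where
  surjective := Ideal.Quotient.mk_surjective
  ker_eq := Ideal.mk_ker
  mem_iff := mk_mem_irrelevantIdeal

theorem regular_and_socle_of_gorenstein [IsNoetherianRing A]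
    (hG : IsGorensteinRing (AssociatedGradedRing (maximalIdeal A)))
    {x : ℕ → A} {a : ℕ → ℕ} {d n₀ : ℕ} (hd : (d : ℕ∞) ≤ (maximalIdeal A).height)
    (hx : ∀ i, x i ∈ maximalIdeal A) (ha : ∀ i, 0 < a i)
    (hred : maximalIdeal A ^ (n₀ + 1) ≤ partialIdeal ⊥ x d * maximalIdeal A ^ n₀) :
    (∀ j < d, ∀ n, ∀ u ∈ maximalIdeal A ^ n,
      x j ^ a j * u ∈ leadIdeal (maximalIdeal A) (maximalIdeal A) (fun i => x i ^ a i) a j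
        (n + a j) →
      u ∈ leadIdeal (maximalIdeal A) (maximalIdeal A) (fun i => x i ^ a i) a j n) ∧
    ∀ ρ, (∀ n, ρ < n → maximalIdeal A ^ n ≤
        leadIdeal (maximalIdeal A) (maximalIdeal A) (fun i => x i ^ a i) a d n) →
      ∀ t ∈ maximalIdeal A ^ ρ,
        t ∉ leadIdeal (maximalIdeal A) (maximalIdeal A) (fun i => x i ^ a i) a d ρ →
      ∀ n, ∀ u ∈ maximalIdeal A ^ n,
        u ∉ leadIdeal (maximalIdeal A) (maximalIdeal A) (fun i => x i ^ a i) a d n →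
        ∃ e, n + e = ρ ∧ ∃ v ∈ maximalIdeal A ^ e, u * v ∉
          leadIdeal (maximalIdeal A) (maximalIdeal A) (fun i => x i ^ a i) a d ρ := by
  have h0 := @IsTangentCone.regular_and_socle A _ _ (AssociatedGradedRing (maximalIdeal A)) _
    (Ideal.Quotient.mk _) irrelevantIdeal irrelevantIdeal_isMaximal
  have h1 := h0 isTangentCone_mk
  have h2 := @hG.2 irrelevantIdeal irrelevantIdeal_isMaximal
  exact h1 h2 (hd.trans height_le_height_irrelevantIdeal) hx ha hred

end GorensteinCone

end QuasiSocle

namespace QuasiSocle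

/-! ### From regular forms in G(m) back to the ring A. -/

section Initial

variable {A : Type u} [CommRing A] {y : ℕ → A} {a : ℕ → ℕ}

theorem weightedIdeal_le_mul (I : Ideal A) {d n k : ℕ} (h : ∀ i < d, k + a i ≤ n) :
    weightedIdeal I y a d n ≤ partialIdeal ⊥ y d * I ^ k := by
  induction d with
  | zero => exact bot_le
  | succ d ih =>
    rw [partialIdeal, Ideal.sup_mul]
    refine sup_le_sup (ih fun i hi => h i (by omega)) (Ideal.mul_mono_right ?_)
    exact Ideal.pow_le_pow_right (by have := h d (by omega); omega)

theorem weightedIdeal_one_succ (I : Ideal A) (y : ℕ → A) (d n : ℕ) :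
    weightedIdeal I y (fun _ => 1) d (n + 1) = partialIdeal ⊥ y d * I ^ n :=
  le_antisymm (weightedIdeal_le_mul I fun _ _ => le_rfl) (partialIdeal_mul_pow_le I y d n)

/-- If the leading forms of `y₀, y₁, …` in the associated graded ring of `m` form a regular
sequence, then the leading forms of elements of `(y₀, …)` are the expected ones. -/
theorem partialIdeal_inf_pow_le {m : Ideal A} {d : ℕ} (hy : ∀ i, y i ∈ m ^ a i)
    (hreg : ∀ j < d, ∀ n, ∀ u ∈ m ^ n,
      y j * u ∈ leadIdeal m m y a j (n + a j) → u ∈ leadIdeal m m y a j n)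
    {j : ℕ} (hj : j ≤ d) (n : ℕ) :
    partialIdeal ⊥ y j ⊓ m ^ n ≤ weightedIdeal m y a j n := by
  induction j generalizing n with
  | zero => exact inf_le_left
  | succ j ih =>
    rintro f ⟨hf, hfn⟩
    have hmul : ∀ k, ∀ w ∈ m ^ k, y j * w ∈ m ^ (k + a j) := fun k w hw => by
      rw [add_comm, pow_add]
      exact Ideal.mul_mem_mul (hy j) hw
    -- The cofactor w of y j is pushed one power of m deeper at a time: regularity puts its leading
    -- form in the ideal of the earlier forms, and that part is absorbed into v.
    have key : ∀ k ≤ n - a j, ∃ v ∈ partialIdeal ⊥ y j, ∃ w ∈ m ^ k, f = v + y j * w := by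
      intro k
      induction k with
      | zero =>
        intro _
        obtain ⟨v, hv, w, rfl⟩ := mem_partialIdeal_succ.mp hf
        exact ⟨v, hv, w, by simp, rfl⟩
      | succ k ihk =>
        intro hk
        obtain ⟨v, hv, w, hw, hvw⟩ := ihk (by omega)
        have hv' : v ∈ m ^ (k + a j) := by
          rw [eq_sub_of_add_eq hvw.symm]
          exact Ideal.sub_mem _ (Ideal.pow_le_pow_right (by omega) hfn) (hmul k w hw)
        have hw' : y j * w ∈ leadIdeal m m y a j (k + a j) := by
          rw [eq_sub_of_add_eq' hvw.symm]
          refine Ideal.sub_mem _ ?_ (Ideal.mem_sup_left (ih (by omega) _ ⟨hv, hv'⟩))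
          exact mul_pow_le_leadIdeal _ _ _ _ _ _ (pow_le_mul_pow le_rfl (by omega) hfn)
        obtain ⟨p, hp, z, hz, rfl⟩ := Submodule.mem_sup.mp (hreg j (by omega) k w hw hw')
        rw [← pow_succ'] at hz
        refine ⟨v + y j * p, Ideal.add_mem _ hv (Ideal.mul_mem_left _ _
          (weightedIdeal_le_partialIdeal _ _ _ _ _ hp)), z, hz, ?_⟩
        rw [hvw]
        ring
    obtain ⟨v, hv, w, hw, hvw⟩ := key _ le_rfl
    refine mem_weightedIdeal_succ.mpr ⟨v, ih (by omega) n ⟨hv, ?_⟩, w, hw, hvw⟩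
    rw [eq_sub_of_add_eq hvw.symm]
    exact Ideal.sub_mem _ hfn (Ideal.pow_le_pow_right (by omega) (hmul _ w hw))

theorem mem_of_forall_mem_sup_pow [IsLocalRing A] [IsNoetherianRing A] {L : Ideal A} {u : A}
    (h : ∀ n, u ∈ L ⊔ maximalIdeal A ^ n) : u ∈ L := by
  rw [← Submodule.Quotient.mk_eq_zero]
  have := Ideal.iInf_pow_smul_eq_bot_of_isLocalRing (M := A ⧸ L) (maximalIdeal A)
    (IsLocalRing.maximalIdeal.isMaximal A).ne_top
  rw [← Submodule.mem_bot A, ← this, Submodule.mem_iInf]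
  intro n
  obtain ⟨v, hv, w, hw, rfl⟩ := Submodule.mem_sup.mp (h n)
  rw [Submodule.Quotient.mk_add, (Submodule.Quotient.mk_eq_zero L).mpr hv, zero_add]
  have : Submodule.Quotient.mk (p := L) w = w • Submodule.Quotient.mk (p := L) 1 := by
    rw [← Submodule.Quotient.mk_smul, smul_eq_mul, mul_one]
  rw [this]
  exact Submodule.smul_mem_smul hw trivial

/-- Regularity of the leading forms moves u into the ideal of the earlier elements modulo ever
higher powers of m; Krull's intersection theorem finishes. -/
theorem mem_partialIdeal_of_mul_mem [IsLocalRing A] [IsNoetherianRing A] {d : ℕ}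
    (hy : ∀ i, y i ∈ maximalIdeal A ^ a i)
    (hreg : ∀ j < d, ∀ n, ∀ u ∈ maximalIdeal A ^ n,
      y j * u ∈ leadIdeal (maximalIdeal A) (maximalIdeal A) y a j (n + a j) →
        u ∈ leadIdeal (maximalIdeal A) (maximalIdeal A) y a j n)
    {j : ℕ} (hj : j < d) {u : A} (hu : y j * u ∈ partialIdeal ⊥ y j) :
    u ∈ partialIdeal ⊥ y j := by
  refine mem_of_forall_mem_sup_pow fun n => ?_
  induction n with
  | zero => simp
  | succ n ih =>
    obtain ⟨v, hv, w, hw, rfl⟩ := Submodule.mem_sup.mp ih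
    rw [mul_add] at hu
    have h1 := (Submodule.add_mem_iff_right _ (Ideal.mul_mem_left _ _ hv)).mp hu
    have h2 : y j * w ∈ maximalIdeal A ^ (n + a j) := by
      rw [add_comm, pow_add]
      exact Ideal.mul_mem_mul (hy j) hw
    obtain ⟨p, hp, z, hz, rfl⟩ := Submodule.mem_sup.mp (hreg j hj n w hw
      (Ideal.mem_sup_left (partialIdeal_inf_pow_le hy hreg hj.le _ ⟨h1, h2⟩)))
    rw [← pow_succ'] at hz
    rw [← add_assoc]
    exact Submodule.add_mem_sup
      (Ideal.add_mem _ hv (weightedIdeal_le_partialIdeal _ _ _ _ _ hp)) hz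

end Initial

/-! ### The Valabrega-Valla condition. -/

section Descent

variable {A : Type u} [CommRing A] {y : ℕ → A} {d : ℕ} {I J : Ideal A}

theorem mem_mul_succ {K : Ideal A} {j : ℕ} {f : A} (hf : f ∈ partialIdeal ⊥ y (j + 1) * K) :
    ∃ g ∈ partialIdeal ⊥ y j * K, ∃ w ∈ K, f = g + y j * w := by
  rw [partialIdeal, Ideal.sup_mul] at hf
  obtain ⟨g, hg, z, hz, rfl⟩ := Submodule.mem_sup.mp hf
  obtain ⟨w, hw, rfl⟩ := Ideal.mem_span_singleton_mul.mp hz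
  exact ⟨g, hg, w, hw, rfl⟩

/-- The Valabrega-Valla condition passes from a regular sequence to its initial segments. -/
theorem partialIdeal_inf_mul_pow_le
    (hreg : ∀ j < d, ∀ u, y j * u ∈ partialIdeal ⊥ y j → u ∈ partialIdeal ⊥ y j)
    (hyI : ∀ i < d, y i ∈ I) (hyJ : ∀ i < d, y i ∈ J)
    (hd : ∀ n, partialIdeal ⊥ y d ⊓ J * I ^ (n + 1) ≤ partialIdeal ⊥ y d * (J * I ^ n))
    {j : ℕ} (hj : j ≤ d) (n : ℕ) :
    partialIdeal ⊥ y j ⊓ J * I ^ (n + 1) ≤ partialIdeal ⊥ y j * (J * I ^ n) := by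
  induction hj using Nat.decreasingInduction generalizing n with
  | self => exact hd n
  | of_succ j hj ih =>
    induction n with
    | zero =>
      rintro f ⟨hf, hfJ⟩
      obtain ⟨g, hg, w, hw, rfl⟩ := mem_mul_succ (ih 0
        ⟨partialIdeal_mono _ _ (Nat.le_succ j) hf, hfJ⟩)
      refine Ideal.add_mem _ hg ?_
      have hw' := hreg j hj w ((Submodule.add_mem_iff_right _ (Ideal.mul_le_left hg)).mp hf)
      rw [mul_comm (y j), pow_zero, mul_one]
      exact Ideal.mul_mem_mul hw' (hyJ j hj)
    | succ n ihn =>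
      rintro f ⟨hf, hfJ⟩
      obtain ⟨g, hg, w, hw, rfl⟩ := mem_mul_succ (ih (n + 1)
        ⟨partialIdeal_mono _ _ (Nat.le_succ j) hf, hfJ⟩)
      refine Ideal.add_mem _ hg ?_
      have hw' := hreg j hj w ((Submodule.add_mem_iff_right _ (Ideal.mul_le_left hg)).mp hf)
      -- Regularity has placed w in the shorter ideal, so the inner induction on the exponent
      -- applies to w; the factor y j ∈ I restores the lost power of I. For exponent 0 the factor y
      -- j ∈ J plays this role.
      have := Ideal.mul_mem_mul (hyI j hj) (ihn ⟨hw', hw⟩)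
      rwa [mul_left_comm, mul_left_comm I, ← pow_succ'] at this

/-- The leading forms of a regular sequence satisfying the Valabrega-Valla condition form a regular
sequence. -/
theorem mem_leadIdeal_of_mul_mem
    (hreg : ∀ j < d, ∀ u, y j * u ∈ partialIdeal ⊥ y j → u ∈ partialIdeal ⊥ y j)
    (hyI : ∀ i < d, y i ∈ I) (hyJ : ∀ i < d, y i ∈ J)
    (hd : ∀ n, partialIdeal ⊥ y d ⊓ I ^ (n + 1) ≤ partialIdeal ⊥ y d * I ^ n)
    (hdJ : ∀ n, partialIdeal ⊥ y d ⊓ J * I ^ (n + 1) ≤ partialIdeal ⊥ y d * (J * I ^ n))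
    {j : ℕ} (hj : j < d) {n : ℕ} {u : A} (hu : u ∈ I ^ n)
    (hju : y j * u ∈ leadIdeal J I y (fun _ => 1) j (n + 1)) :
    u ∈ leadIdeal J I y (fun _ => 1) j n := by
  obtain ⟨p, hp, z, hz, hpz⟩ := Submodule.mem_sup.mp hju
  have hp' := weightedIdeal_le_partialIdeal _ _ _ _ _ hp
  have hzQ : z ∈ partialIdeal ⊥ y (j + 1) := by
    rw [eq_sub_of_add_eq' hpz]
    refine Ideal.sub_mem _ (Ideal.mul_mem_right _ _ (mem_partialIdeal_of_lt _ _ (Nat.lt_succ_self j)))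
      (partialIdeal_mono _ _ (Nat.le_succ j) hp')
  obtain ⟨p', hp', w, hw, rfl⟩ := mem_mul_succ
    (partialIdeal_inf_mul_pow_le hreg hyI hyJ hdJ hj n ⟨hzQ, hz⟩)
  have huw : u - w ∈ partialIdeal ⊥ y j := by
    refine hreg j hj _ ?_
    rw [mul_sub, ← hpz, ← add_assoc, add_sub_cancel_right]
    exact Ideal.add_mem _ (weightedIdeal_le_partialIdeal _ _ _ _ _ hp) (Ideal.mul_le_left hp')
  have huwI : u - w ∈ I ^ n := Ideal.sub_mem _ hu (Ideal.mul_le_right hw)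
  rw [← sub_add_cancel u w]
  refine Submodule.add_mem_sup ?_ hw
  cases n with
  | zero => rwa [weightedIdeal_zero]
  | succ n =>
    rw [weightedIdeal_one_succ]
    -- The error w has been split off inside J Iⁿ⁺¹; the remainder u - w is only known to lie in
    -- Iⁿ⁺¹, which is the case J = ⊤ of the descent.
    have := partialIdeal_inf_mul_pow_le (J := ⊤) hreg hyI (fun _ _ => trivial)
      (by simpa only [Ideal.top_mul] using hd) hj.le n ⟨huw, by rwa [Ideal.top_mul]⟩
    rwa [Ideal.top_mul] at this

end Descent

end QuasiSocle

namespace QuasiSocle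

/-! ### Powers of sums of ideals and the determinant trick. -/

section Integral

variable {A : Type u} [CommRing A]

theorem sup_pow_succ (Q M : Ideal A) (n : ℕ) :
    (Q ⊔ M) ^ (n + 1) = Q * (Q ⊔ M) ^ n ⊔ M ^ (n + 1) := by
  induction n with
  | zero => simp
  | succ n ih =>
    refine le_antisymm ?_ (sup_le ?_ (Ideal.pow_right_mono le_sup_right _))
    · conv_lhs => rw [pow_succ', Ideal.sup_mul]
      refine sup_le le_sup_left ?_
      conv_lhs => rw [ih, Ideal.mul_sup, ← pow_succ', mul_left_comm]
      refine sup_le_sup_right (Ideal.mul_mono_right ?_) _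
      rw [pow_succ']
      exact Ideal.mul_mono_left le_sup_right
    · conv_rhs => rw [pow_succ']
      exact Ideal.mul_mono_left le_sup_left

theorem sup_pow_le (Q M : Ideal A) (n : ℕ) : (Q ⊔ M) ^ n ≤ Q ⊔ M ^ n := by
  cases n with
  | zero => simp
  | succ n =>
    rw [sup_pow_succ]
    exact sup_le (Ideal.mul_le_left.trans le_sup_left) le_sup_right

theorem mem_integralClosureOfIdeal_of_eval_eq_zero [Nontrivial A] {Q : Ideal A}
    {p : Polynomial A} (hp : p.Monic) (hc : ∀ k, p.coeff k ∈ Q ^ (p.natDegree - k)) {u : A}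
    (hu : p.eval u = 0) : u ∈ integralClosureOfIdeal Q := by
  refine ⟨p.natDegree, ?_, fun j => p.coeff (p.natDegree - j), fun j hj => ?_, ?_⟩
  · refine Nat.pos_of_ne_zero fun h0 => ?_
    rw [Polynomial.Monic.natDegree_eq_zero hp] at h0
    simp [h0] at hu
  · have := hc (p.natDegree - j)
    rwa [Nat.sub_sub_self (Finset.mem_Icc.mp hj).2] at this
  · rw [Polynomial.eval_eq_sum_range, Finset.sum_range_succ, hp.coeff_natDegree, one_mul,
      add_comm] at hu
    rw [← hu]
    congr 1
    refine Finset.sum_nbij' (fun j => p.natDegree - j) (fun j => p.natDegree - j) ?_ ?_ ?_ ?_ ?_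
    all_goals intro j hj; simp only [Finset.mem_Icc, Finset.mem_range] at *; try omega

/-- Determinant trick: Cayley-Hamilton for multiplication by u on N gives a monic polynomial with
coefficients in powers of Q whose value at u kills N, and N is faithful. -/
theorem mem_integralClosureOfIdeal_of_mul_le [Nontrivial A] {Q N : Ideal A} (hN : N.FG)
    (hfaith : ∀ r, (∀ z ∈ N, r * z = 0) → r = 0) {u : A} (hu : ∀ z ∈ N, u * z ∈ Q * N) :
    u ∈ integralClosureOfIdeal Q := by
  have : Module.Finite A N := Module.Finite.of_fg hN
  let φ : Module.End A N := Algebra.lsmul A A N u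
  have hrange : LinearMap.range φ ≤ Q • (⊤ : Submodule A N) := by
    rintro _ ⟨z, rfl⟩
    have h1 : (Q • (⊤ : Submodule A N)).map N.subtype = Q * N := by
      rw [Submodule.map_smul'', Submodule.map_top, Submodule.range_subtype, smul_eq_mul]
    have h2 := hu z z.2
    rw [← h1] at h2
    obtain ⟨w, hw, hwz⟩ := h2
    have : φ z = w := Subtype.ext hwz.symm
    rwa [this]
  obtain ⟨p, hp, -, hc, h0⟩ :=
    LinearMap.exists_monic_and_natDegree_eq_and_coeff_mem_pow_and_aeval_eq_zero A φ Q hrange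
  refine mem_integralClosureOfIdeal_of_eval_eq_zero hp hc (hfaith _ fun z hz => ?_)
  rw [Polynomial.aeval_algHom_apply, Polynomial.coe_aeval_eq_eval] at h0
  exact congrArg Subtype.val (LinearMap.congr_fun h0 ⟨z, hz⟩)

end Integral

/-! ### Integral dependence of powers of parameters. -/

section Parameters

variable {A : Type u} [CommRing A] [IsLocalRing A] {x : ℕ → A} {a : ℕ → ℕ}
  {d : ℕ}

theorem maximalIdeal_le_radical_partialIdeal {n₀ : ℕ}
    (hred : maximalIdeal A ^ (n₀ + 1) ≤ partialIdeal ⊥ x d * maximalIdeal A ^ n₀) :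
    maximalIdeal A ≤ (partialIdeal ⊥ x d).radical :=
  fun _ hu => ⟨n₀ + 1, Ideal.mul_le_left (hred (Ideal.pow_mem_pow hu _))⟩

/-- A power `xᵢᴸ` of a parameter is integral over `(x₀^a₀, …)` only if `aᵢ ≤ L`. -/
theorem le_of_pow_mem_integralClosureOfIdeal [IsNoetherianRing A]
    (hd : (d : ℕ∞) ≤ (maximalIdeal A).height)
    (hx : ∀ i, x i ∈ maximalIdeal A) (ha : ∀ i, 0 < a i)
    (hrad : maximalIdeal A ≤ (partialIdeal ⊥ x d).radical) {i L : ℕ} (hi : i < d)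
    (hL : x i ^ L ∈ integralClosureOfIdeal (partialIdeal ⊥ (fun k => x k ^ a k) d)) :
    a i ≤ L := by
  by_contra! hlt
  let K : Ideal A := Ideal.span (x '' (Set.Iio d \ {i}))
  have hK : ∀ k < d, k ≠ i → x k ∈ K := fun k hk hki => Ideal.subset_span ⟨k, ⟨hk, hki⟩, rfl⟩
  have hKm : K ≤ maximalIdeal A := by
    rw [Ideal.span_le]
    rintro _ ⟨k, -, rfl⟩
    exact hx k
  have hQ : partialIdeal ⊥ (fun k => x k ^ a k) d ≤ K ⊔ Ideal.span {x i ^ a i} := by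
    refine partialIdeal_le bot_le fun k hk => ?_
    by_cases hki : k = i
    · subst hki
      exact Ideal.mem_sup_right (Ideal.mem_span_singleton_self _)
    · exact Ideal.mem_sup_left (Ideal.pow_mem_of_mem _ (hK k hk hki) _ (ha k))
  have hQpow : ∀ j, partialIdeal ⊥ (fun k => x k ^ a k) d ^ j ≤
      K ⊔ Ideal.span {x i ^ (a i * j)} := by
    intro j
    refine (Ideal.pow_right_mono hQ j).trans ?_
    rw [pow_mul, ← Ideal.span_singleton_pow (x i ^ a i)]
    exact sup_pow_le K (Ideal.span {x i ^ a i}) j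
  obtain ⟨n, hn, c, hc, heq⟩ := hL
  -- Modulo the other parameters, the j-th term of the integral equation is divisible by x i to the
  -- power a i * j + L * (n - j), which exceeds L * n because j ≥ 1 and L < a i.
  have hmem : x i ^ (L * n) ∈ K ⊔ Ideal.span {x i ^ (L * n + 1)} := by
    rw [← pow_mul] at heq
    rw [eq_neg_of_add_eq_zero_left heq]
    refine neg_mem (Ideal.sum_mem _ fun j hj => ?_)
    obtain ⟨v, hv, w, hw, hvw⟩ := Submodule.mem_sup.mp (hQpow j (hc j hj))
    obtain ⟨w, rfl⟩ := Ideal.mem_span_singleton'.mp hw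
    rw [← hvw, add_mul]
    refine Submodule.add_mem_sup (Ideal.mul_mem_right _ _ hv) ?_
    rw [Ideal.mem_span_singleton, ← pow_mul, mul_assoc, ← pow_add]
    refine Dvd.dvd.mul_left (pow_dvd_pow _ ?_) _
    rw [Finset.mem_Icc] at hj
    have h1 : (L + 1) * j ≤ a i * j := Nat.mul_le_mul_right _ hlt
    have h2 : L * n = L * j + L * (n - j) := by rw [← mul_add, Nat.add_sub_cancel' hj.2]
    rw [add_mul, one_mul] at h1
    omega
  have hxK : x i ∈ K.radical := by
    obtain ⟨v, hv, w, hw, hvw⟩ := Submodule.mem_sup.mp hmem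
    obtain ⟨r, rfl⟩ := Ideal.mem_span_singleton'.mp hw
    refine ⟨L * n, mem_of_mul_mem_of_notMem (s := 1 - r * x i) (fun h => ?_) ?_⟩
    · exact (Ideal.ne_top_iff_one _).mp (IsLocalRing.maximalIdeal.isMaximal A).ne_top
        (by simpa using Ideal.add_mem _ h (Ideal.mul_mem_left _ r (hx i)))
    · have : (1 - r * x i) * x i ^ (L * n) = v := by
        rw [sub_mul, one_mul, mul_assoc, ← pow_succ', sub_eq_iff_eq_add]
        exact hvw.symm
      rwa [this]
  have hmK : maximalIdeal A ≤ K.radical := by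
    refine hrad.trans (Ideal.radical_le_radical_iff.mpr (partialIdeal_le bot_le fun k hk => ?_))
    by_cases hki : k = i
    · rwa [hki]
    · exact Ideal.le_radical (hK k hk hki)
  -- The maximal ideal is now minimal over the d - 1 generators of K, against Krull's height
  -- theorem.
  have hmin : maximalIdeal A ∈ K.minimalPrimes :=
    ⟨⟨inferInstance, hKm⟩, fun p hp _ => hmK.trans (hp.1.radical_le_iff.mpr hp.2)⟩
  have hfin : (Set.Iio d \ {i}).Finite := (Set.finite_Iio d).sdiff
  have h1 := Ideal.height_le_card_of_mem_minimalPrimes_span (hfin.image x) hmin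
  have h2 := Set.ncard_image_le (f := x) hfin
  have h3 : (Set.Iio d \ {i}).ncard = d - 1 := by
    rw [Set.ncard_sdiff_singleton_of_mem (show i ∈ Set.Iio d from hi)]
    congr 1
    rw [Set.ncard_eq_toFinset_card']
    simp
  have h4 : (d : ℕ∞) ≤ ((x '' (Set.Iio d \ {i})).ncard : ℕ∞) := hd.trans h1
  rw [Nat.cast_le] at h4
  omega

end Parameters

/-! ### The colon ideal Q : m^q and the powers of Q + m^L. -/

section Colon

variable {A : Type u} [CommRing A] [IsLocalRing A] {y : ℕ → A} {a : ℕ → ℕ} {d ρ : ℕ}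

theorem pow_le_weightedIdeal
    (hinter : ∀ n, partialIdeal ⊥ y d ⊓ maximalIdeal A ^ n ≤
      weightedIdeal (maximalIdeal A) y a d n)
    (hρ : maximalIdeal A ^ (ρ + 1) ≤ partialIdeal ⊥ y d) {n : ℕ} (hn : ρ < n) :
    maximalIdeal A ^ n ≤ weightedIdeal (maximalIdeal A) y a d n :=
  (le_inf ((Ideal.pow_le_pow_right hn).trans hρ) le_rfl).trans (hinter n)

/-- If u ≡ w mod Q with w of order k ≤ ρ - q and nonzero leading form, the socle property gives v of
order ρ - k ≥ q with w v nonzero in degree ρ, although w v ∈ Q; so u climbs to order ρ + 1 - q. For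
q > ρ both sides are the unit ideal. -/
theorem colon_pow_maximalIdeal
    (hinter : ∀ n, partialIdeal ⊥ y d ⊓ maximalIdeal A ^ n ≤
      weightedIdeal (maximalIdeal A) y a d n)
    (hρ : maximalIdeal A ^ (ρ + 1) ≤ partialIdeal ⊥ y d)
    (hsoc : ∀ n, ∀ u ∈ maximalIdeal A ^ n,
      u ∉ leadIdeal (maximalIdeal A) (maximalIdeal A) y a d n →
        ∃ e, n + e = ρ ∧ ∃ v ∈ maximalIdeal A ^ e, u * v ∉
          leadIdeal (maximalIdeal A) (maximalIdeal A) y a d ρ) (q : ℕ) :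
    Submodule.colon (partialIdeal ⊥ y d) ((maximalIdeal A ^ q : Ideal A) : Set A) =
      partialIdeal ⊥ y d ⊔ maximalIdeal A ^ (ρ + 1 - q) := by
  refine le_antisymm (fun u hu => ?_) (sup_le (fun u hu => ?_) fun u hu => ?_)
  · rw [Submodule.mem_colon] at hu
    have key : ∀ k ≤ ρ + 1 - q, u ∈ partialIdeal ⊥ y d ⊔ maximalIdeal A ^ k := by
      intro k
      induction k with
      | zero => simp
      | succ k ih =>
        intro hk
        obtain ⟨p, hp, w, hw, rfl⟩ := Submodule.mem_sup.mp (ih (by omega))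
        refine Ideal.add_mem _ (Ideal.mem_sup_left hp) ?_
        have hle : leadIdeal (maximalIdeal A) (maximalIdeal A) y a d k ≤
            partialIdeal ⊥ y d ⊔ maximalIdeal A ^ (k + 1) := by
          rw [leadIdeal, ← pow_succ']
          exact sup_le_sup_right (weightedIdeal_le_partialIdeal _ _ _ _ _) _
        refine hle ?_
        by_contra hwL
        obtain ⟨e, he, v, hv, hwv⟩ := hsoc k w hw hwL
        refine hwv (Ideal.mem_sup_left (hinter ρ ⟨?_, ?_⟩))
        · have := hu v (Ideal.pow_le_pow_right (by omega) hv)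
          rw [smul_eq_mul, add_mul] at this
          exact (Submodule.add_mem_iff_right _ (Ideal.mul_mem_right _ _ hp)).mp this
        · rw [← he, pow_add]
          exact Ideal.mul_mem_mul hw hv
    exact key _ le_rfl
  · rw [Submodule.mem_colon]
    exact fun v _ => Ideal.mul_mem_right _ _ hu
  · rw [Submodule.mem_colon]
    intro v hv
    have h1 := Ideal.mul_mem_mul hu hv
    rw [← pow_add] at h1
    exact hρ (Ideal.pow_le_pow_right (by omega) h1)

variable {L : ℕ}

theorem pow_le_partialIdeal_mul_pow
    (hinter : ∀ n, partialIdeal ⊥ y d ⊓ maximalIdeal A ^ n ≤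
      weightedIdeal (maximalIdeal A) y a d n)
    (hρ : maximalIdeal A ^ (ρ + 1) ≤ partialIdeal ⊥ y d) (hL : ∀ i < d, a i ≤ L) {k : ℕ}
    (hk : ρ < k + L) : maximalIdeal A ^ (k + L) ≤ partialIdeal ⊥ y d * maximalIdeal A ^ k :=
  (pow_le_weightedIdeal hinter hρ hk).trans
    (weightedIdeal_le_mul _ fun i hi => by have := hL i hi; omega)

/-- The Valabrega-Valla condition for `Q + mᴸ`. -/
theorem partialIdeal_inf_pow_mul_sup_pow_le
    (hinter : ∀ n, partialIdeal ⊥ y d ⊓ maximalIdeal A ^ n ≤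
      weightedIdeal (maximalIdeal A) y a d n) (hL : ∀ i < d, a i ≤ L) (c n : ℕ) :
    partialIdeal ⊥ y d ⊓ maximalIdeal A ^ c *
        (partialIdeal ⊥ y d ⊔ maximalIdeal A ^ L) ^ (n + 1) ≤
      partialIdeal ⊥ y d * (maximalIdeal A ^ c *
        (partialIdeal ⊥ y d ⊔ maximalIdeal A ^ L) ^ n) := by
  rintro f ⟨hf, hfc⟩
  rw [sup_pow_succ, Ideal.mul_sup] at hfc
  obtain ⟨g, hg, z, hz, rfl⟩ := Submodule.mem_sup.mp hfc
  rw [mul_left_comm] at hg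
  refine Ideal.add_mem _ hg ?_
  have hzQ := (Submodule.add_mem_iff_right _ (Ideal.mul_le_left hg)).mp hf
  rw [← pow_mul, ← pow_add] at hz
  -- Only the part z in m^(c + L(n+1)) needs work, the rest being visibly a multiple of Q. Since a i
  -- ≤ L, its cofactors have order at least c + L n.
  have h1 := weightedIdeal_le_mul (y := y) (k := c + L * n) _ (fun i hi => by
    have := hL i hi
    rw [mul_add]
    omega) (hinter _ ⟨hzQ, hz⟩)
  rw [pow_add, pow_mul] at h1
  exact Ideal.mul_mono_right (Ideal.mul_mono_right (Ideal.pow_right_mono le_sup_right _)) h1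

/-- Everything rests on m^(L(n+1)): it lies in Q m^(Ln) once L(n+1) > ρ, and otherwise it contains
m^ρ, which is not inside Q. -/
theorem sup_pow_succ_eq_iff {q : ℕ}
    (hinter : ∀ n, partialIdeal ⊥ y d ⊓ maximalIdeal A ^ n ≤
      weightedIdeal (maximalIdeal A) y a d n)
    (hρ : maximalIdeal A ^ (ρ + 1) ≤ partialIdeal ⊥ y d)
    (hρ' : ¬ maximalIdeal A ^ ρ ≤ partialIdeal ⊥ y d) (hL : ∀ i < d, a i ≤ L)
    (hqL : q + L = ρ + 1) (n : ℕ) :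
    (partialIdeal ⊥ y d ⊔ maximalIdeal A ^ L) ^ (n + 1) =
        partialIdeal ⊥ y d * (partialIdeal ⊥ y d ⊔ maximalIdeal A ^ L) ^ n ↔ q ≤ n * L := by
  constructor
  · intro h
    by_contra hlt
    refine hρ' (le_trans (Ideal.pow_le_pow_right (n := ρ) (m := L * (n + 1)) ?_) ?_)
    · rw [mul_add, mul_comm]
      omega
    · rw [pow_mul]
      refine (Ideal.pow_right_mono (le_sup_right (a := partialIdeal ⊥ y d)) _).trans ?_
      rw [h]
      exact Ideal.mul_le_left
  · intro h
    rw [sup_pow_succ, sup_eq_left, ← pow_mul]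
    have h1 := pow_le_partialIdeal_mul_pow hinter hρ hL (k := L * n) (by
      rw [mul_comm] at h
      omega)
    rw [mul_add, mul_one]
    refine h1.trans ?_
    rw [pow_mul]
    exact Ideal.mul_mono_right (Ideal.pow_right_mono le_sup_right _)

theorem pow_mul_sup_eq {q : ℕ}
    (hinter : ∀ n, partialIdeal ⊥ y d ⊓ maximalIdeal A ^ n ≤
      weightedIdeal (maximalIdeal A) y a d n)
    (hρ : maximalIdeal A ^ (ρ + 1) ≤ partialIdeal ⊥ y d) (hL : ∀ i < d, a i ≤ L)
    (hqL : q + L = ρ + 1) :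
    maximalIdeal A ^ q * (partialIdeal ⊥ y d ⊔ maximalIdeal A ^ L) =
      maximalIdeal A ^ q * partialIdeal ⊥ y d := by
  rw [Ideal.mul_sup, sup_eq_left, ← pow_add, mul_comm]
  exact pow_le_partialIdeal_mul_pow hinter hρ hL (by omega)

end Colon

end QuasiSocle

namespace QuasiSocle

/-! ### Regular sequences remain regular after replacing elements by powers. -/

section Powers

variable {S : Type*} [CommRing S]

theorem regularModulo_top (l : List S) : RegularModulo ⊤ l := by
  induction l with
  | nil => trivial
  | cons x l ih => exact ⟨fun _ _ => trivial, by rwa [top_sup_eq]⟩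

/-- Given an exact sequence `0 → S ⧸ K → S ⧸ L → S ⧸ M → 0` whose first map is multiplication by
`x`, a sequence that is regular on the outer terms is regular on the middle one. -/
theorem RegularModulo.of_exact {x : S} {l : List S} {K L M : Ideal S}
    (hM : M = L ⊔ Ideal.span {x}) (hK : ∀ u, x * u ∈ L ↔ u ∈ K) (hlK : RegularModulo K l)
    (hlM : RegularModulo M l) : RegularModulo L l := by
  induction l generalizing K L M with
  | nil => trivial
  | cons y l ih =>
    have hreg : ∀ u, y * u ∈ L → u ∈ L := by
      intro u hu
      have huM := hlM.1 u (hM ▸ Ideal.mem_sup_left hu)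
      rw [hM] at huM
      obtain ⟨r, hr, z, hz, rfl⟩ := Submodule.mem_sup.mp huM
      obtain ⟨v, rfl⟩ := Ideal.mem_span_singleton.mp hz
      refine Ideal.add_mem _ hr ((hK v).mpr (hlK.1 v ((hK _).mp ?_)))
      rw [mul_left_comm]
      rw [mul_add] at hu
      exact (Submodule.add_mem_iff_right _ (Ideal.mul_mem_left _ _ hr)).mp hu
    refine ⟨hreg, ih (K := K ⊔ Ideal.span {y}) (M := M ⊔ Ideal.span {y}) ?_ (fun u => ?_)
      hlK.2 hlM.2⟩
    · rw [hM, sup_right_comm]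
    · constructor
      · intro hu
        obtain ⟨r, hr, z, hz, hxu⟩ := Submodule.mem_sup.mp hu
        obtain ⟨v, rfl⟩ := Ideal.mem_span_singleton.mp hz
        have hvM : v ∈ M := by
          refine hlM.1 v ?_
          rw [eq_sub_of_add_eq' hxu, hM]
          exact Ideal.sub_mem _ (Ideal.mem_sup_right
            (Ideal.mul_mem_right _ _ (Ideal.mem_span_singleton_self x))) (Ideal.mem_sup_left hr)
        rw [hM] at hvM
        obtain ⟨r', hr', z, hz', rfl⟩ := Submodule.mem_sup.mp hvM
        obtain ⟨w, rfl⟩ := Ideal.mem_span_singleton.mp hz'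
        have : u - y * w ∈ K := by
          rw [← hK]
          have : x * (u - y * w) = r + y * r' := by
            rw [mul_sub, ← hxu]
            ring
          rw [this]
          exact Ideal.add_mem _ hr (Ideal.mul_mem_left _ _ hr')
        rw [← sub_add_cancel u (y * w)]
        exact Submodule.add_mem_sup this
          (Ideal.mul_mem_right _ _ (Ideal.mem_span_singleton_self y))
      · intro hu
        obtain ⟨r, hr, z, hz, rfl⟩ := Submodule.mem_sup.mp hu
        rw [mul_add]
        exact Submodule.add_mem_sup ((hK r).mpr hr) (Ideal.mul_mem_left _ _ hz)

/-- Induction on e through the exact sequence 0 → S ⧸ (J + xᵉ) → S ⧸ (J + xᵉ⁺¹) → S ⧸ (J + x) → 0.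
-/
theorem RegularModulo.pow_cons {J : Ideal S} {x : S} {l : List S} (hl : RegularModulo J (x :: l))
    (e : ℕ) : RegularModulo J (x ^ e :: l) := by
  refine ⟨?_, ?_⟩
  · intro u hu
    induction e with
    | zero => simpa using hu
    | succ e ih =>
      rw [pow_succ', mul_assoc] at hu
      exact ih (hl.1 _ hu)
  · induction e with
    | zero =>
      rw [pow_zero, Ideal.span_singleton_one, sup_top_eq]
      exact regularModulo_top l
    | succ e ih =>
      refine RegularModulo.of_exact (x := x) (M := J ⊔ Ideal.span {x}) ?_ (fun u => ?_) ih hl.2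
      · refine le_antisymm (sup_le_sup_right le_sup_left _)
          (sup_le (sup_le le_sup_left (le_sup_of_le_right ?_)) le_sup_right)
        rw [Ideal.span_singleton_le_span_singleton]
        exact dvd_pow_self x e.succ_ne_zero
      · constructor
        · intro hu
          obtain ⟨r, hr, z, hz, hxu⟩ := Submodule.mem_sup.mp hu
          obtain ⟨v, rfl⟩ := Ideal.mem_span_singleton.mp hz
          have : u - x ^ e * v ∈ J := by
            refine hl.1 _ ?_
            have : x * (u - x ^ e * v) = r := by
              rw [mul_sub, ← hxu]
              ring
            rwa [this]
          rw [← sub_add_cancel u (x ^ e * v)]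
          exact Submodule.add_mem_sup this
            (Ideal.mul_mem_right _ _ (Ideal.mem_span_singleton_self _))
        · intro hu
          obtain ⟨r, hr, z, hz, rfl⟩ := Submodule.mem_sup.mp hu
          obtain ⟨v, rfl⟩ := Ideal.mem_span_singleton.mp hz
          rw [mul_add, ← mul_assoc, ← pow_succ']
          exact Submodule.add_mem_sup (Ideal.mul_mem_left _ _ hr)
            (Ideal.mul_mem_right _ _ (Ideal.mem_span_singleton_self _))

theorem RegularModulo.map_pow {J : Ideal S} {y : ℕ → S} {l : List ℕ}
    (hl : RegularModulo J (l.map y)) (e : ℕ → ℕ) :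
    RegularModulo J (l.map fun i => y i ^ e i) := by
  induction l generalizing J with
  | nil => trivial
  | cons i l ih =>
    have := RegularModulo.pow_cons (x := y i) hl (e i)
    exact ⟨this.1, ih this.2⟩

end Powers

/-! ### Regularity of homogeneous elements checked in each degree. -/

section Graded

variable {A : Type u} [CommRing A] {J I : Ideal A} {y : ℕ → A} {a : ℕ → ℕ}
  {h : ℕ → reesAlgebra I} {d : ℕ}

/-- Homogeneous elements of the Rees algebra form a regular sequence modulo `⨁ J Iⁿ` if and only
if they do so degreewise. -/
theorem regularModulo_reesIdeal_iff (hIJ : I ≤ J)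
    (hh : ∀ i, (h i : Polynomial A) = Polynomial.monomial (a i) (y i)) :
    RegularModulo (reesIdeal J I) ((List.range' 0 d).map h) ↔
      ∀ j < d, ∀ n, ∀ u ∈ I ^ n, y j * u ∈ leadIdeal J I y a j (n + a j) →
        u ∈ leadIdeal J I y a j n := by
  refine (regularModulo_range_iff (reesIdeal J I) h 0 d).trans ⟨fun H j hj n u hu hju => ?_,
    fun H j _ hj f hf => ?_⟩
  · have hm := H j (Nat.zero_le _) (by omega) (reesMonomial hu) (by
      obtain ⟨_, hc⟩ := monomial_mem_partialIdeal hIJ hh hju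
      convert hc using 1
      refine Subtype.ext ?_
      change (h j : Polynomial A) * Polynomial.monomial n u = Polynomial.monomial _ _
      rw [hh, Polynomial.monomial_mul_monomial, add_comm])
    have := coeff_mem_leadIdeal hh hm n
    change (Polynomial.monomial n u).coeff n ∈ _ at this
    rwa [Polynomial.coeff_monomial, if_pos rfl] at this
  · rw [mem_partialIdeal_iff_coeff hIJ hh] at hf ⊢
    intro n
    refine H j (by omega) n _ (f.2 n) ?_
    have := hf (n + a j)
    change ((h j : Polynomial A) * (f : Polynomial A)).coeff _ ∈ _ at this
    rwa [hh, coeff_monomial_mul_eq, if_pos (by omega), Nat.add_sub_cancel] at this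

theorem mem_leadIdeal_pow_of_mul_mem (hIJ : I ≤ J) (hy : ∀ i, y i ∈ I)
    (hreg : ∀ j < d, ∀ n, ∀ u ∈ I ^ n, y j * u ∈ leadIdeal J I y (fun _ => 1) j (n + 1) →
      u ∈ leadIdeal J I y (fun _ => 1) j n) (e : ℕ → ℕ) :
    ∀ j < d, ∀ n, ∀ u ∈ I ^ n,
      y j ^ e j * u ∈ leadIdeal J I (fun i => y i ^ e i) e j (n + e j) →
        u ∈ leadIdeal J I (fun i => y i ^ e i) e j n := by
  let θ : ℕ → reesAlgebra I := fun i => reesMonomial (n := 1) (u := y i) (by simpa using hy i)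
  have hθ : ∀ i, (θ i : Polynomial A) = Polynomial.monomial 1 (y i) := fun i => rfl
  refine (regularModulo_reesIdeal_iff (h := fun i => θ i ^ e i) hIJ (fun i => ?_)).mp
    (RegularModulo.map_pow ((regularModulo_reesIdeal_iff hIJ hθ).mpr hreg) e)
  rw [SubmonoidClass.coe_pow, hθ, Polynomial.monomial_pow, one_mul]

end Graded

theorem coe_reesMonomial {A : Type u} [CommRing A] {I : Ideal A} {n : ℕ} {u : A}
    (hu : u ∈ I ^ n) : (reesMonomial hu : Polynomial A) = Polynomial.monomial n u := rfl

/-! ### Non-homogeneous elements with regular top forms. -/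

section TopForms

variable {A : Type u} [CommRing A] {J I : Ideal A} {y : ℕ → A} {e : ℕ → ℕ}
  {g : ℕ → reesAlgebra I} {d : ℕ}

/-- The top form of a product is the product of the top forms, where w is only required to have
degree at most N modulo `reesIdeal J I`. -/
theorem coeff_mul_sub_mem {p w : reesAlgebra I} {r N : ℕ}
    (hp : ∀ k, r < k → (p : Polynomial A).coeff k = 0)
    (hw : ∀ k, N < k → (w : Polynomial A).coeff k ∈ J * I ^ k) :
    ((p * w : reesAlgebra I) : Polynomial A).coeff (N + r) -
      (p : Polynomial A).coeff r * (w : Polynomial A).coeff N ∈ J * I ^ (N + r) := by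
  change ((p : Polynomial A) * (w : Polynomial A)).coeff (N + r) - _ ∈ _
  rw [Polynomial.coeff_mul, ← Finset.add_sum_erase _ _
    (show (r, N) ∈ Finset.HasAntidiagonal.antidiagonal (N + r) by simp [add_comm]),
    add_sub_cancel_left]
  refine Ideal.sum_mem _ fun ⟨i, k⟩ hik => ?_
  simp only [Finset.mem_erase, ne_eq, Prod.mk.injEq, not_and,
    Finset.HasAntidiagonal.mem_antidiagonal] at hik
  rcases lt_or_ge r i with hi | hi
  · rw [hp i hi, zero_mul]
    exact Ideal.zero_mem _
  · rw [← hik.2, pow_add, mul_left_comm]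
    exact Ideal.mul_mem_mul (p.2 i) (hw k (by
      rcases hi.eq_or_lt with rfl | hi
      · exact absurd (by omega) (hik.1 rfl)
      · omega))

theorem coeff_mul_mem {p w : reesAlgebra I} {r M k : ℕ}
    (hp : ∀ k, r < k → (p : Polynomial A).coeff k = 0)
    (hw : ∀ k, M ≤ k → (w : Polynomial A).coeff k ∈ J * I ^ k) (hk : M + r ≤ k) :
    ((p * w : reesAlgebra I) : Polynomial A).coeff k ∈ J * I ^ k := by
  change ((p : Polynomial A) * (w : Polynomial A)).coeff k ∈ _
  rw [Polynomial.coeff_mul]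
  refine Ideal.sum_mem _ fun ⟨i, l⟩ hil => ?_
  rw [Finset.HasAntidiagonal.mem_antidiagonal] at hil
  dsimp only at hil ⊢
  rcases lt_or_ge r i with hi | hi
  · rw [hp i hi, zero_mul]
    exact Ideal.zero_mem _
  · rw [← hil, pow_add, mul_left_comm]
    exact Ideal.mul_mem_mul (p.2 i) (hw l (by omega))

/-- Lifts an element of the ideal of top forms to an element of the ideal of the gᵢ with this top
coefficient and nothing above it; subtracting such lifts lowers degrees. -/
theorem exists_mem_partialIdeal_of_mem_leadIdeal (hIJ : I ≤ J)
    (hg : ∀ i k, e i < k → (g i : Polynomial A).coeff k = 0)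
    (hgy : ∀ i, (g i : Polynomial A).coeff (e i) = y i) {j n : ℕ} {c : A}
    (hc : c ∈ leadIdeal J I y e j n) :
    ∃ p ∈ partialIdeal (reesIdeal J I) g j, (p : Polynomial A).coeff n = c ∧
      ∀ k, n < k → (p : Polynomial A).coeff k = 0 := by
  have hmon : ∀ z ∈ J * I ^ n, ∃ p ∈ reesIdeal J I, (p : Polynomial A).coeff n = z ∧
      ∀ k, n < k → (p : Polynomial A).coeff k = 0 := by
    intro z hz
    have hzI : z ∈ I ^ n := Ideal.mul_le_right hz
    refine ⟨reesMonomial hzI, mem_reesIdeal_iff.mpr fun k => ?_, ?_, fun k hk => ?_⟩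
    all_goals rw [coe_reesMonomial, Polynomial.coeff_monomial]
    · split_ifs with hnk
      · rwa [← hnk]
      · exact Ideal.zero_mem _
    · rw [if_pos rfl]
    · rw [if_neg hk.ne]
  induction j generalizing c with
  | zero => exact hmon c (by simpa [leadIdeal, weightedIdeal] using hc)
  | succ j ih =>
    obtain ⟨v, hv, w, hw, rfl⟩ := mem_leadIdeal_succ.mp hc
    obtain ⟨p, hp, hpv, hp0⟩ := ih hv
    by_cases hn : e j ≤ n
    · have hmul : ∀ k, ((g j * reesMonomial hw : reesAlgebra I) : Polynomial A).coeff
          (k + (n - e j)) = (g j : Polynomial A).coeff k * w := coeff_mul_reesMonomial hw (g j)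
      refine ⟨p + g j * reesMonomial hw, mem_partialIdeal_succ.mpr ⟨p, hp, _, rfl⟩, ?_,
        fun k hk => ?_⟩
      all_goals rw [Subalgebra.coe_add, Polynomial.coeff_add]
      · have := hmul (e j)
        rw [Nat.add_sub_cancel' hn, hgy] at this
        rw [hpv, this]
      · have := hmul (k - (n - e j))
        rw [Nat.sub_add_cancel (by omega), hg _ _ (by omega), zero_mul] at this
        rw [hp0 k hk, this, add_zero]
    · obtain ⟨p', hp', hpw, hp'0⟩ := hmon (y j * w) (pow_le_mul_pow hIJ (not_le.mp hn)
        (Ideal.mul_mem_right _ _ (hgy j ▸ (g j).2 (e j))))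
      refine ⟨p + p', Ideal.add_mem _ (partialIdeal_mono _ _ (Nat.le_succ j) hp)
        (le_partialIdeal _ _ _ hp'), ?_, fun k hk => ?_⟩
      all_goals rw [Subalgebra.coe_add, Polynomial.coeff_add]
      · rw [hpv, hpw]
      · rw [hp0 k hk, hp'0 k hk, add_zero]

variable (hIJ : I ≤ J) (hg : ∀ i k, e i < k → (g i : Polynomial A).coeff k = 0)
  (hgy : ∀ i, (g i : Polynomial A).coeff (e i) = y i)
  (hreg : ∀ j < d, ∀ n, ∀ u ∈ I ^ n,
    y j * u ∈ leadIdeal J I y e j (n + e j) → u ∈ leadIdeal J I y e j n)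

include hIJ hg hgy hreg

/-- The leading forms of the elements of the ideal generated by the `gᵢ` are the expected ones. -/
theorem coeff_mem_leadIdeal_of_mem_partialIdeal {j : ℕ} (hj : j ≤ d) {f : reesAlgebra I}
    (hf : f ∈ partialIdeal (reesIdeal J I) g j) {n : ℕ}
    (hfn : ∀ k, n < k → (f : Polynomial A).coeff k ∈ J * I ^ k) :
    (f : Polynomial A).coeff n ∈ leadIdeal J I y e j n := by
  induction j generalizing f n with
  | zero => exact mul_pow_le_leadIdeal _ _ _ _ _ _ (hf n)
  | succ j ih =>
    -- The degree of the cofactor w modulo `reesIdeal J I` is lowered until g j * w has degree at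
    -- most n there: an excess top coefficient is, by regularity, a top coefficient p of the earlier
    -- ideal, and g j * p is moved into v.
    have key : ∀ M, ∀ v ∈ partialIdeal (reesIdeal J I) g j, ∀ w, f = v + g j * w →
        (∀ k, M + (n + 1 - e j) ≤ k → (w : Polynomial A).coeff k ∈ J * I ^ k) →
        ∃ v ∈ partialIdeal (reesIdeal J I) g j, ∃ w, f = v + g j * w ∧
          ∀ k, n + 1 - e j ≤ k → (w : Polynomial A).coeff k ∈ J * I ^ k := by
      intro M
      induction M with
      | zero => exact fun v hv w hvw hw => ⟨v, hv, w, hvw, by simpa using hw⟩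
      | succ M ihM =>
        intro v hv w hvw hw
        obtain ⟨N, hN⟩ : ∃ N, N = M + (n + 1 - e j) := ⟨_, rfl⟩
        have hv' : ∀ k, (v : Polynomial A).coeff k = (f : Polynomial A).coeff k -
            ((g j * w : reesAlgebra I) : Polynomial A).coeff k := fun k => by
          rw [hvw, Subalgebra.coe_add, Polynomial.coeff_add, add_sub_cancel_right]
        have hvN : ∀ k, N + e j < k → (v : Polynomial A).coeff k ∈ J * I ^ k := fun k hk => by
          rw [hv']
          exact Ideal.sub_mem _ (hfn k (by omega))
            (coeff_mul_mem (M := N + 1) (hg j) (fun k hk => hw k (by omega)) (by omega))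
        have h1 := ih (by omega) hv hvN
        have h2 := coeff_mul_sub_mem (J := J) (w := w) (N := N) (hg j)
          (fun k hk => hw k (by omega))
        have h3 : y j * (w : Polynomial A).coeff N ∈ leadIdeal J I y e j (N + e j) := by
          have h4 := hfn (N + e j) (by omega)
          have : y j * (w : Polynomial A).coeff N = (f : Polynomial A).coeff (N + e j) -
              (((g j * w : reesAlgebra I) : Polynomial A).coeff (N + e j) -
                (g j : Polynomial A).coeff (e j) * (w : Polynomial A).coeff N) -
                (v : Polynomial A).coeff (N + e j) := by
            rw [hv', hgy]
            ring
          rw [this]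
          exact Ideal.sub_mem _ (mul_pow_le_leadIdeal _ _ _ _ _ _ (Ideal.sub_mem _ h4 h2)) h1
        obtain ⟨p, hp, hpN, hp0⟩ := exists_mem_partialIdeal_of_mem_leadIdeal hIJ hg hgy
          (hreg j (by omega) N _ (w.2 N) h3)
        refine ihM (v + g j * p) (Ideal.add_mem _ hv (Ideal.mul_mem_left _ _ hp)) (w - p)
          (by rw [hvw]; ring) fun k hk => ?_
        rw [AddSubgroupClass.coe_sub, Polynomial.coeff_sub]
        rcases hk.eq_or_lt with rfl | hk
        · rw [← hN, hpN, sub_self]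
          exact Ideal.zero_mem _
        · rw [hp0 k (by omega), sub_zero]
          exact hw k (by omega)
    obtain ⟨v₀, hv₀, w₀, hvw₀⟩ := mem_partialIdeal_succ.mp hf
    obtain ⟨v, hv, w, hvw, hw⟩ := key ((w₀ : Polynomial A).natDegree + 1) v₀ hv₀ w₀ hvw₀
      (fun k hk => by
        rw [Polynomial.coeff_eq_zero_of_natDegree_lt (by omega)]
        exact Ideal.zero_mem _)
    have hf' : ∀ k, (f : Polynomial A).coeff k = (v : Polynomial A).coeff k +
        ((g j * w : reesAlgebra I) : Polynomial A).coeff k := fun k => by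
      rw [hvw, Subalgebra.coe_add, Polynomial.coeff_add]
    have hvn : ∀ k, n < k → (v : Polynomial A).coeff k ∈ J * I ^ k := fun k hk => by
      rw [← sub_eq_of_eq_add (hf' k)]
      refine Ideal.sub_mem _ (hfn k hk) ?_
      rcases le_or_gt (e j) (n + 1) with hle | hlt
      · exact coeff_mul_mem (hg j) hw (by omega)
      · exact mem_reesIdeal_iff.mp (Ideal.mul_mem_left _ (g j)
          (mem_reesIdeal_iff.mpr fun k => hw k (by omega))) k
    have hvlead := ih (by omega) hv hvn
    rw [hf']
    by_cases hn : e j ≤ n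
    · have h2 := coeff_mul_sub_mem (J := J) (w := w) (N := n - e j) (hg j)
        (fun k hk => hw k (by omega))
      rw [Nat.sub_add_cancel hn, hgy] at h2
      refine mem_leadIdeal_succ.mpr ⟨(v : Polynomial A).coeff n + _,
        Ideal.add_mem _ hvlead (mul_pow_le_leadIdeal _ _ _ _ _ _ h2), _, w.2 (n - e j), ?_⟩
      ring
    · refine leadIdeal_mono_left J I y e n (Nat.le_succ j) (Ideal.add_mem _ hvlead
        (mul_pow_le_leadIdeal _ _ _ _ _ _ ?_))
      exact mem_reesIdeal_iff.mp (Ideal.mul_mem_left _ (g j)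
        (mem_reesIdeal_iff.mpr fun k => hw k (by omega))) n

/-- Elements of the Rees algebra whose top forms form a regular sequence form a regular
sequence. -/
theorem regularModulo_of_topForms :
    RegularModulo (reesIdeal J I) ((List.range' 0 d).map g) := by
  refine (regularModulo_range_iff (reesIdeal J I) g 0 d).mpr fun j _ hj f hf => ?_
  have key : ∀ M, ∀ f : reesAlgebra I, g j * f ∈ partialIdeal (reesIdeal J I) g j →
      (∀ k, M ≤ k → (f : Polynomial A).coeff k ∈ J * I ^ k) →
      f ∈ partialIdeal (reesIdeal J I) g j := by
    intro M
    induction M with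
    | zero => exact fun f _ hf => le_partialIdeal _ _ _ fun n => hf n (Nat.zero_le n)
    | succ M ih =>
      intro f hgf hf
      have h1 := coeff_mem_leadIdeal_of_mem_partialIdeal hIJ hg hgy hreg (by omega) hgf
        (n := M + e j) (fun k hk => coeff_mul_mem (M := M + 1) (hg j) hf (by omega))
      have h2 := coeff_mul_sub_mem (J := J) (w := f) (N := M) (hg j) (fun k hk => hf k (by omega))
      rw [hgy] at h2
      have h3 := Ideal.sub_mem _ h1 (mul_pow_le_leadIdeal J I y e j _ h2)
      rw [sub_sub_cancel] at h3
      obtain ⟨p, hp, hpN, hp0⟩ := exists_mem_partialIdeal_of_mem_leadIdeal hIJ hg hgy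
        (hreg j (by omega) M _ (f.2 M) h3)
      rw [← sub_add_cancel f p]
      refine Ideal.add_mem _ (ih _ ?_ fun k hk => ?_) hp
      · rw [mul_sub]
        exact Ideal.sub_mem _ hgf (Ideal.mul_mem_left _ _ hp)
      · rw [AddSubgroupClass.coe_sub, Polynomial.coeff_sub]
        rcases hk.eq_or_lt with rfl | hk
        · rw [hpN, sub_self]
          exact Ideal.zero_mem _
        · rw [hp0 k hk, sub_zero]
          exact hf k (by omega)
  refine key ((f : Polynomial A).natDegree + 1) f hf fun k hk => ?_
  rw [Polynomial.coeff_eq_zero_of_natDegree_lt (by omega)]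
  exact Ideal.zero_mem _

end TopForms

end QuasiSocle

namespace QuasiSocle

/-! ### Finiteness of quotients of the Rees algebra. -/

section Finite

variable {A : Type u} [CommRing A] {I : Ideal A} {y : ℕ → A} {d : ℕ}

/-- The `n`-th homogeneous component of the Rees algebra. -/
noncomputable def reesComponent (I : Ideal A) (n : ℕ) : (I ^ n : Ideal A) →ₗ[A] reesAlgebra I where
  toFun u := reesMonomial u.2
  map_add' u v := Subtype.ext (map_add (Polynomial.monomial n) (u : A) v)
  map_smul' r u := Subtype.ext (by
    change Polynomial.monomial n (r * (u : A)) = r • Polynomial.monomial n (u : A)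
    rw [Polynomial.smul_monomial, smul_eq_mul])

/-- A quotient of the Rees algebra of `I` in which the degree one elements given by generators of a
reduction of `I` are integral is a finite module. -/
theorem finite_of_isIntegral [IsNoetherianRing A] {T : Type*} [CommRing T] [Algebra A T]
    (π : reesAlgebra I →ₐ[A] T) (hπ : Function.Surjective π) {N : ℕ}
    (hred : I ^ (N + 1) ≤ partialIdeal ⊥ y d * I ^ N) {θ : ℕ → reesAlgebra I}
    (hθ : ∀ i, (θ i : Polynomial A) = Polynomial.monomial 1 (y i))
    (hint : ∀ i < d, IsIntegral A (π (θ i))) : Module.Finite A T := by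
  let D := Algebra.adjoin A ((fun i => π (θ i)) '' Set.Iio d)
  have hD : (Subalgebra.toSubmodule D).FG := by
    refine fg_adjoin_of_finite ((Set.finite_Iio d).image _) ?_
    rintro _ ⟨i, hi, rfl⟩
    exact hint i hi
  -- By the reduction property, the components of degree at most N generate T over the subalgebra D,
  -- which is finite over A by integrality.
  let W : Submodule A T := ⨆ n ∈ Finset.range (N + 1),
    (LinearMap.range (reesComponent I n)).map π.toLinearMap
  have hW : W.FG := by
    refine Submodule.fg_biSup _ _ fun n _ => Submodule.FG.map _ ?_
    rw [LinearMap.range_eq_map]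
    exact Submodule.FG.map _ (IsNoetherian.noetherian _)
  have hmul : ∀ i < d, ∀ t ∈ Subalgebra.toSubmodule D * W,
      π (θ i) * t ∈ Subalgebra.toSubmodule D * W := by
    intro i hi t ht
    have h1 : π (θ i) ∈ Subalgebra.toSubmodule D := Algebra.subset_adjoin ⟨i, hi, rfl⟩
    have := Submodule.mul_mem_mul h1 ht
    rwa [← mul_assoc, (Subalgebra.isIdempotentElem_toSubmodule D).eq] at this
  have key : ∀ n, ∀ f : reesAlgebra I, ∀ c, (f : Polynomial A) = Polynomial.monomial n c →
      π f ∈ Subalgebra.toSubmodule D * W := by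
    intro n
    induction n using Nat.strong_induction_on with
    | _ n ih =>
      intro f c hf
      have hc : c ∈ I ^ n := by
        rw [← reesAlgebra.monomial_mem, ← hf]
        exact f.2
      rcases lt_or_ge n (N + 1) with hn | hn
      · rw [← one_mul (π f)]
        refine Submodule.mul_mem_mul (one_mem D) ?_
        refine Submodule.mem_iSup_of_mem n (Submodule.mem_iSup_of_mem (Finset.mem_range.mpr hn) ?_)
        exact ⟨f, ⟨⟨c, hc⟩, Subtype.ext hf.symm⟩, rfl⟩
      · obtain ⟨n, rfl⟩ := Nat.exists_eq_add_of_le' (show 1 ≤ n by omega)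
        have hcQ : c ∈ weightedIdeal I y (fun _ => 1) d (n + 1) :=
          partialIdeal_mul_pow_le I y d n (pow_le_partialIdeal_mul hred (by omega) hc)
        have key' : ∀ j ≤ d, ∀ f : reesAlgebra I, ∀ c ∈ weightedIdeal I y (fun _ => 1) j (n + 1),
            (f : Polynomial A) = Polynomial.monomial (n + 1) c →
            π f ∈ Subalgebra.toSubmodule D * W := by
          intro j
          induction j with
          | zero =>
            intro _ f c hc hf
            have hc0 : c = 0 := hc
            rw [hc0, map_zero] at hf
            rw [show f = 0 from Subtype.ext hf, map_zero]
            exact Submodule.zero_mem _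
          | succ j ihj =>
            intro hj f c hc hf
            obtain ⟨v, hv, w, hw, rfl⟩ := mem_weightedIdeal_succ.mp hc
            rw [Nat.add_sub_cancel] at hw
            have hf' : (f - θ j * reesMonomial hw : reesAlgebra I) =
                Polynomial.monomial (n + 1) v := by
              rw [AddSubgroupClass.coe_sub, MulMemClass.coe_mul, hf, hθ, coe_reesMonomial,
                Polynomial.monomial_mul_monomial, add_comm 1 n, ← map_sub, add_sub_cancel_right]
            have h1 := ihj (by omega) _ v hv hf'
            have h2 := hmul j (by omega) _ (ih n (by omega) (reesMonomial hw) w rfl)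
            have h3 := Submodule.add_mem _ h1 h2
            rwa [← map_mul, ← map_add, sub_add_cancel] at h3
        exact key' d le_rfl f c hcQ hf
  refine ⟨?_⟩
  have htop : (⊤ : Submodule A T) = Subalgebra.toSubmodule D * W := by
    refine le_antisymm (fun t _ => ?_) le_top
    obtain ⟨f, rfl⟩ := hπ t
    have : f = ∑ n ∈ (f : Polynomial A).support, reesMonomial (f.2 n) := by
      refine Subtype.ext ?_
      rw [AddSubmonoidClass.coe_finsetSum]
      exact (f : Polynomial A).as_sum_support
    rw [this, map_sum]
    exact Submodule.sum_mem _ fun n _ => key n _ _ rfl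
  rw [htop]
  exact hD.mul hW

theorem coeff_aeval_reesAlgebra {θ : reesAlgebra I} {z : A}
    (hθ : (θ : Polynomial A) = Polynomial.monomial 1 z) (h : Polynomial A) (k : ℕ) :
    (Polynomial.aeval θ h : Polynomial A).coeff k = h.coeff k * z ^ k := by
  have h1 : ((Polynomial.aeval θ h : reesAlgebra I) : Polynomial A) =
      Polynomial.aeval (θ : Polynomial A) h :=
    (Polynomial.aeval_algHom_apply (reesAlgebra I).val θ h).symm
  have h2 : Polynomial.aeval (θ : Polynomial A) h = h.comp (Polynomial.C z * Polynomial.X) := by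
    rw [hθ, ← Polynomial.C_mul_X_eq_monomial]
    rfl
  rw [h1, h2, Polynomial.comp_C_mul_X_coeff]

end Finite

/-! ### The Cohen-Macaulay property at all maximal ideals. -/

section MaximalIdeals

variable {A : Type u} [CommRing A] [IsLocalRing A] {I : Ideal A} {y : ℕ → A}
  {d : ℕ}

theorem isField_of_isIntegral [IsNoetherianRing A] {N : ℕ}
    (hred : I ^ (N + 1) ≤ partialIdeal ⊥ y d * I ^ N)
    {θ : ℕ → reesAlgebra I} (hθ : ∀ i, (θ i : Polynomial A) = Polynomial.monomial 1 (y i))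
    {T : Type*} [CommRing T] [IsDomain T] [Algebra A T] (π : reesAlgebra I →ₐ[A] T)
    (hπ : Function.Surjective π) (hT : ∀ c ∈ maximalIdeal A, algebraMap A T c = 0)
    (hint : ∀ i < d, IsIntegral A (π (θ i))) : IsField T := by
  have := finite_of_isIntegral π hπ hred hθ hint
  have hker : RingHom.ker (algebraMap A T) = maximalIdeal A :=
    ((IsLocalRing.maximalIdeal.isMaximal A).eq_of_le (RingHom.ker_ne_top _) hT).symm
  have hbot : (⊥ : Ideal T).IsMaximal := by
    refine Ideal.isMaximal_of_isIntegral_of_isMaximal_comap (R := A) _ ?_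
    rw [← RingHom.ker_eq_comap_bot, hker]
    exact IsLocalRing.maximalIdeal.isMaximal A
  exact Ring.isField_iff_maximal_bot.mpr hbot

theorem isMaximal_of_isIntegral [IsNoetherianRing A] {N : ℕ}
    (hred : I ^ (N + 1) ≤ partialIdeal ⊥ y d * I ^ N)
    {θ : ℕ → reesAlgebra I} (hθ : ∀ i, (θ i : Polynomial A) = Polynomial.monomial 1 (y i))
    (p : Ideal (reesAlgebra I)) [p.IsPrime]
    (hp : ∀ c ∈ maximalIdeal A, algebraMap A (reesAlgebra I) c ∈ p)
    (hint : ∀ i < d, ∃ h : Polynomial A, h.Monic ∧ Polynomial.aeval (θ i) h ∈ p) :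
    p.IsMaximal := by
  refine Ideal.Quotient.maximal_of_isField p (isField_of_isIntegral (T := reesAlgebra I ⧸ p)
    hred hθ (Ideal.Quotient.mkₐ A p) (Ideal.Quotient.mkₐ_surjective A p)
    (fun c hc => Ideal.Quotient.eq_zero_iff_mem.mpr (hp c hc)) fun i hi => ?_)
  obtain ⟨h, hh, hhp⟩ := hint i hi
  refine ⟨h, hh, ?_⟩
  rw [← Polynomial.aeval_def, Polynomial.aeval_algHom_apply]
  exact Ideal.Quotient.eq_zero_iff_mem.mpr hhp

/-- By Zariski's lemma the residue field at p is finite over that of A, so every element of it is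
integral. -/
theorem exists_monic_aeval_mem [IsNoetherianRing A] (p : Ideal (reesAlgebra I)) [hpm : p.IsMaximal]
    (hp : ∀ c ∈ maximalIdeal A, algebraMap A (reesAlgebra I) c ∈ p) (f : reesAlgebra I) :
    ∃ h : Polynomial A, h.Monic ∧ Polynomial.aeval f h ∈ p := by
  let := Ideal.Quotient.field p
  let := Ideal.Quotient.field (maximalIdeal A)
  let φ : A ⧸ maximalIdeal A →+* reesAlgebra I ⧸ p :=
    Ideal.Quotient.lift _ (algebraMap A (reesAlgebra I ⧸ p)) fun c hc =>
      Ideal.Quotient.eq_zero_iff_mem.mpr (hp c hc)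
  let := φ.toAlgebra
  have : IsScalarTower A (A ⧸ maximalIdeal A) (reesAlgebra I ⧸ p) :=
    IsScalarTower.of_algebraMap_eq fun _ => rfl
  have : Algebra.FiniteType A (reesAlgebra I ⧸ p) :=
    Algebra.FiniteType.of_surjective (Ideal.Quotient.mkₐ A p) (Ideal.Quotient.mkₐ_surjective A p)
  have : Algebra.FiniteType (A ⧸ maximalIdeal A) (reesAlgebra I ⧸ p) :=
    Algebra.FiniteType.of_restrictScalars_finiteType A _ _
  have : Module.Finite (A ⧸ maximalIdeal A) (reesAlgebra I ⧸ p) :=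
    finite_of_finite_type_of_isJacobsonRing _ _
  have : Module.Finite A (reesAlgebra I ⧸ p) := Module.Finite.trans (A ⧸ maximalIdeal A) _
  obtain ⟨h, hh, h0⟩ := Algebra.IsIntegral.isIntegral (R := A) (Ideal.Quotient.mkₐ A p f)
  refine ⟨h, hh, ?_⟩
  rw [← Polynomial.aeval_def, Polynomial.aeval_algHom_apply] at h0
  exact Ideal.Quotient.eq_zero_iff_mem.mp h0

/-- If the degree one elements given by generators of a reduction of `I` form a regular sequence in
`⨁ Iⁿ / J Iⁿ`, where `J` is primary to the maximal ideal, then this ring is Cohen-Macaulay. -/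
theorem isCohenMacaulayRing_of_regular [IsNoetherianRing A] {J : Ideal A} (hIJ : I ≤ J) {k N : ℕ}
    (hJ : maximalIdeal A ^ k ≤ J) (hy : ∀ i, y i ∈ I)
    (hred : I ^ (N + 1) ≤ partialIdeal ⊥ y d * I ^ N)
    (hreg : ∀ j < d, ∀ n, ∀ u ∈ I ^ n, y j * u ∈ leadIdeal J I y (fun _ => 1) j (n + 1) →
      u ∈ leadIdeal J I y (fun _ => 1) j n) {S : Type u} [CommRing S] {π : reesAlgebra I →+* S}
    (hπ : Function.Surjective π) (hker : RingHom.ker π = reesIdeal J I) :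
    IsCohenMacaulayRing S := by
  have hN : IsNoetherianRing S := isNoetherianRing_of_surjective _ _ π hπ
  refine ⟨hN, fun P hP => ?_⟩
  have hm : ∀ p' : Ideal S, p'.IsPrime → ∀ c ∈ maximalIdeal A,
      algebraMap A (reesAlgebra I) c ∈ p'.comap π := by
    intro p' hp' c hc
    refine (hp'.comap π).mem_of_pow_mem k ?_
    have : algebraMap A (reesAlgebra I) c ^ k ∈ RingHom.ker π := by
      rw [hker, ← map_pow, mem_reesIdeal_iff]
      intro n
      change (Polynomial.C (c ^ k)).coeff n ∈ _
      rw [Polynomial.coeff_C]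
      split_ifs with hn
      · rw [hn, pow_zero, mul_one]
        exact hJ (Ideal.pow_mem_pow hc k)
      · exact Ideal.zero_mem _
    rw [Ideal.mem_comap, RingHom.mem_ker.mp this]
    exact Ideal.zero_mem _
  let θ : ℕ → reesAlgebra I := fun i => reesMonomial (n := 1) (u := y i) (by simpa using hy i)
  have hθ : ∀ i, (θ i : Polynomial A) = Polynomial.monomial 1 (y i) := fun i => rfl
  have hPm : (P.comap π).IsMaximal := Ideal.comap_isMaximal_of_surjective π hπ
  -- P need not contain the degree one forms themselves, but it contains a monic polynomial in each;
  -- its top form is a power of the form θ i.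
  choose h hmon hmem using fun i => exists_monic_aeval_mem (P.comap π) (hm P hP.isPrime) (θ i)
  let g : ℕ → reesAlgebra I := fun i => Polynomial.aeval (θ i) (h i)
  have hgreg : RegularModulo (reesIdeal J I) ((List.range' 0 d).map g) := by
    refine regularModulo_of_topForms (y := fun i => y i ^ (h i).natDegree)
      (e := fun i => (h i).natDegree) hIJ (fun i l hl => ?_) (fun i => ?_)
      (mem_leadIdeal_pow_of_mul_mem hIJ hy hreg _)
    · rw [coeff_aeval_reesAlgebra (hθ i), Polynomial.coeff_eq_zero_of_natDegree_lt hl, zero_mul]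
    · rw [coeff_aeval_reesAlgebra (hθ i), (hmon i).coeff_natDegree, one_mul]
  have hSreg : RegularModulo ⊥ ((List.range' 0 d).map fun i => π (g i)) := by
    refine (regularModulo_range_iff ⊥ (fun i => π (g i)) 0 d).mpr fun j _ hj u hu => ?_
    obtain ⟨u, rfl⟩ := hπ u
    rw [← map_mul, map_mem_partialIdeal_iff hπ hker] at hu
    rw [map_mem_partialIdeal_iff hπ hker]
    exact (regularModulo_range_iff (reesIdeal J I) g 0 d).mp hgreg j (Nat.zero_le _) hj u hu
  have hloc := hSreg.isWeaklyRegular.isRegular_of_isLocalization_of_mem (Localization.AtPrime P) P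
    (by
      intro r hr
      obtain ⟨i, -, rfl⟩ := List.mem_map.mp hr
      exact hmem i)
  have hNL : IsNoetherianRing (Localization.AtPrime P) :=
    IsLocalization.isNoetherianRing P.primeCompl _ hN
  refine ⟨hNL, _, ?_, hloc, ?_⟩
  · intro r hr
    obtain ⟨r, hr', rfl⟩ := List.mem_map.mp hr
    obtain ⟨i, -, rfl⟩ := List.mem_map.mp hr'
    exact (IsLocalization.AtPrime.to_map_mem_maximal_iff _ P _).mpr (hmem i)
  -- A prime over the g i has a quotient integral over A, so it is maximal; hence P is minimal over
  -- d elements and Krull bounds its height by d. The regular sequence gives the opposite bound.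
  · have hmin : P ∈ (Ideal.span ((fun i => π (g i)) '' Set.Iio d)).minimalPrimes := by
      refine ⟨⟨hP.isPrime, ?_⟩, fun p' ⟨hp', hle⟩ hp'P => ?_⟩
      · rw [Ideal.span_le]
        rintro _ ⟨i, -, rfl⟩
        exact hmem i
      · have := hp'.comap π
        have hmax : (p'.comap π).IsMaximal := isMaximal_of_isIntegral hred hθ (p'.comap π)
          (hm p' hp') fun i hi => ⟨h i, hmon i, hle (Ideal.subset_span ⟨i, hi, rfl⟩)⟩
        have := hmax.eq_of_le hPm.ne_top (Ideal.comap_mono hp'P)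
        exact (Ideal.comap_injective_of_surjective π hπ this).ge
    have h1 := Ideal.height_le_card_of_mem_minimalPrimes_span ((Set.finite_Iio d).image _) hmin
    have h2 : (((fun i => π (g i)) '' Set.Iio d).ncard : ℕ∞) ≤ d := by
      refine Nat.cast_le.mpr ((Set.ncard_image_le (Set.finite_Iio d)).trans ?_)
      rw [Set.ncard_eq_toFinset_card']
      simp
    have h3 := IsLocalization.AtPrime.ringKrullDim_eq_height P (Localization.AtPrime P)
    have h4 := ringKrullDim_add_length_eq_ringKrullDim_of_isRegular _ hloc
    refine le_antisymm ?_ ?_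
    · rw [h3]
      simp only [List.length_map, List.length_range']
      exact_mod_cast h1.trans h2
    · rw [← h4]
      have : Nontrivial (Localization.AtPrime P ⧸ Ideal.ofList (List.map (algebraMap S
          (Localization.AtPrime P)) ((List.range' 0 d).map fun i => π (g i)))) := by
        refine Ideal.Quotient.nontrivial_iff.mpr fun htop => hloc.top_ne_smul ?_
        rw [htop]
        simp
      exact le_add_of_nonneg_left ringKrullDim_nonneg_of_nontrivial

end MaximalIdeals

end QuasiSocle

namespace QuasiSocle

/-! ### The equivalences and the final assembly. -/

section Main

variable {A : Type u} [CommRing A]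

theorem exists_pow_succ_le_and_not_pow_le {Q m : Ideal A} (hm : m.FG) (hmQ : m ≤ Q.radical)
    (hQ : Q ≠ ⊤) : ∃ ρ, m ^ (ρ + 1) ≤ Q ∧ ¬ m ^ ρ ≤ Q := by
  classical
  have hex := Ideal.exists_pow_le_of_le_radical_of_fg hmQ hm
  obtain ⟨ρ, hρ⟩ := Nat.exists_eq_succ_of_ne_zero (n := Nat.find hex) fun h0 => hQ (by
    have := Nat.find_spec hex
    rw [h0, pow_zero, Ideal.one_eq_top] at this
    exact top_le_iff.mp this)
  refine ⟨ρ, ?_, Nat.find_min hex (by omega)⟩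
  have := Nat.find_spec hex
  rwa [hρ] at this

theorem isNilpotencyIndex_map_mk {Q m : Ideal A} {ρ : ℕ} (h1 : m ^ (ρ + 1) ≤ Q)
    (h2 : ¬ m ^ ρ ≤ Q) : IsNilpotencyIndex (m.map (Ideal.Quotient.mk Q)) ρ := by
  have key : ∀ n, m.map (Ideal.Quotient.mk Q) ^ n = ⊥ ↔ m ^ n ≤ Q := fun n => by
    rw [← Ideal.map_pow, Ideal.map_eq_bot_iff_le_ker, Ideal.mk_ker]
  refine ⟨fun h => h2 ((key ρ).mp h), fun n hn => ?_⟩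
  by_contra! hlt
  exact hn ((key n).mpr ((Ideal.pow_le_pow_right hlt).trans h1))

theorem span_range_eq_partialIdeal {d : ℕ} {z : Fin d → A} {w : ℕ → A}
    (hw : ∀ i : Fin d, w i = z i) : Ideal.span (Set.range z) = partialIdeal ⊥ w d := by
  rw [partialIdeal_eq_span]
  congr 1
  ext u
  constructor
  · rintro ⟨i, rfl⟩
    exact ⟨i, i.2, hw i⟩
  · rintro ⟨i, hi, rfl⟩
    exact ⟨⟨i, hi⟩, (hw ⟨i, hi⟩).symm⟩

theorem isReductionNumber_ceil {Q I : Ideal A} {q L : ℕ} (hL : 0 < L)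
    (h : ∀ n, I ^ (n + 1) = Q * I ^ n ↔ q ≤ n * L) :
    IsReductionNumber Q I ⌈(q : ℚ) / (L : ℚ)⌉₊ := by
  have key : ∀ n, I ^ (n + 1) = Q * I ^ n ↔ ⌈(q : ℚ) / (L : ℚ)⌉₊ ≤ n := fun n => by
    rw [h, Nat.ceil_le, div_le_iff₀ (by exact_mod_cast hL)]
    exact_mod_cast Iff.rfl
  exact ⟨(key _).mpr le_rfl, fun n hn => (key n).mp hn⟩

variable [IsLocalRing A] [IsNoetherianRing A] {x : ℕ → A} {a : ℕ → ℕ} {d : ℕ}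

theorem quasiSocle_tfae_and_isCohenMacaulay (hd : 0 < d) (hdim : (d : ℕ∞) ≤ (maximalIdeal A).height)
    (hG : IsGorensteinRing (AssociatedGradedRing (maximalIdeal A)))
    (hx : ∀ i, x i ∈ maximalIdeal A) (ha : ∀ i, 0 < a i) (hxd : ∀ i, d ≤ i → x i = 0) {n₀ : ℕ}
    (hred : maximalIdeal A ^ (n₀ + 1) ≤ partialIdeal ⊥ x d * maximalIdeal A ^ n₀)
    {q : ℕ} {Q I : Ideal A} (hQ : Q = partialIdeal ⊥ (fun i => x i ^ a i) d)
    (hI : I = Submodule.colon Q ((maximalIdeal A ^ q : Ideal A) : Set A)) {ρ : ℕ}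
    (hρ : maximalIdeal A ^ (ρ + 1) ≤ Q) (hρ' : ¬ maximalIdeal A ^ ρ ≤ Q) {ℓ : ℤ}
    (hℓ : ℓ = (ρ : ℤ) + 1 - (q : ℤ)) :
    List.TFAE [(I : Set A) ⊆ integralClosureOfIdeal Q,
        maximalIdeal A ^ q * I = maximalIdeal A ^ q * Q, ∀ i < d, (a i : ℤ) ≤ ℓ] ∧
      ((I : Set A) ⊆ integralClosureOfIdeal Q →
        IsReductionNumber Q I ⌈(q : ℚ) / (ℓ : ℚ)⌉₊ ∧
        IsCohenMacaulayRing (AssociatedGradedRing I) ∧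
        IsCohenMacaulayRing (FiberCone I)) := by
  subst hQ
  obtain ⟨hlead, hsocle⟩ := regular_and_socle_of_gorenstein hG hdim hx ha hred
  have hy : ∀ i, x i ^ a i ∈ maximalIdeal A ^ a i := fun i => Ideal.pow_mem_pow (hx i) _
  have hinter : ∀ n, partialIdeal ⊥ (fun i => x i ^ a i) d ⊓ maximalIdeal A ^ n ≤
      weightedIdeal (maximalIdeal A) (fun i => x i ^ a i) a d n := fun n =>
    partialIdeal_inf_pow_le hy hlead le_rfl n
  have hregular : ∀ j < d, ∀ u, x j ^ a j * u ∈ partialIdeal ⊥ (fun i => x i ^ a i) j →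
      u ∈ partialIdeal ⊥ (fun i => x i ^ a i) j := fun j hj u hu =>
    mem_partialIdeal_of_mul_mem (y := fun i => x i ^ a i) hy hlead hj hu
  have hsoc : ∀ n, ∀ u ∈ maximalIdeal A ^ n,
      u ∉ leadIdeal (maximalIdeal A) (maximalIdeal A) (fun i => x i ^ a i) a d n →
        ∃ e, n + e = ρ ∧ ∃ v ∈ maximalIdeal A ^ e, u * v ∉
          leadIdeal (maximalIdeal A) (maximalIdeal A) (fun i => x i ^ a i) a d ρ := by
    obtain ⟨t, ht, htQ⟩ := SetLike.not_le_iff_exists.mp hρ'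
    refine hsocle ρ (fun n hn => (pow_le_weightedIdeal hinter hρ hn).trans le_sup_left) t ht
      fun h => htQ ?_
    rw [leadIdeal, ← pow_succ'] at h
    exact sup_le (weightedIdeal_le_partialIdeal _ _ _ _ _) hρ h
  rw [colon_pow_maximalIdeal hinter hρ hsoc] at hI
  obtain ⟨L, hL⟩ : ∃ L, L = ρ + 1 - q := ⟨_, rfl⟩
  rw [← hL] at hI
  -- The integer ℓ may be negative, while L is the truncated difference; as every a i is positive,
  -- both impose the same bound.
  have hiff : (∀ i < d, (a i : ℤ) ≤ ℓ) ↔ ∀ i < d, a i ≤ L := by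
    refine forall₂_congr fun i _ => ?_
    have := ha i
    omega
  have h12 : (I : Set A) ⊆ integralClosureOfIdeal (partialIdeal ⊥ (fun i => x i ^ a i) d) →
      ∀ i < d, a i ≤ L := fun h i hi =>
    le_of_pow_mem_integralClosureOfIdeal hdim hx ha (maximalIdeal_le_radical_partialIdeal hred) hi
      (h (hI ▸ Ideal.mem_sup_right (Ideal.pow_mem_pow (hx i) L)))
  -- The bound 0 < a 0 ≤ L, available because d > 0, shows that the subtraction defining L is not
  -- truncated.
  have hqL : (∀ i < d, a i ≤ L) → 0 < L ∧ q + L = ρ + 1 := fun h => by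
    have := h 0 hd
    have := ha 0
    omega
  have h23 : (∀ i < d, a i ≤ L) → maximalIdeal A ^ q * I =
      maximalIdeal A ^ q * partialIdeal ⊥ (fun i => x i ^ a i) d := fun h => by
    rw [hI]
    exact pow_mul_sup_eq hinter hρ h (hqL h).2
  have h31 : maximalIdeal A ^ q * I =
      maximalIdeal A ^ q * partialIdeal ⊥ (fun i => x i ^ a i) d →
      (I : Set A) ⊆ integralClosureOfIdeal (partialIdeal ⊥ (fun i => x i ^ a i) d) := by
    intro h u hu
    -- The ideal m^q is faithful, since it contains the q-th power of the nonzerodivisor x 0 ^ a 0.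
    refine mem_integralClosureOfIdeal_of_mul_le (N := maximalIdeal A ^ q)
      (IsNoetherian.noetherian _) (fun r hr => ?_) fun z hz => ?_
    · have hreg0 : ∀ n, (x 0 ^ a 0) ^ n * r = 0 → r = 0 := by
        intro n
        induction n with
        | zero => simp
        | succ n ih =>
          intro hn
          rw [pow_succ', mul_assoc] at hn
          exact ih (by simpa [partialIdeal] using hregular 0 hd _ (by simp [partialIdeal, hn]))
      refine hreg0 q ?_
      rw [mul_comm]
      exact hr _ (Ideal.pow_mem_pow (Ideal.pow_mem_of_mem _ (hx 0) _ (ha 0)) q)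
    · rw [mul_comm u, mul_comm _ (maximalIdeal A ^ q), ← h]
      exact Ideal.mul_mem_mul hz hu
  refine ⟨?_, fun h => ?_⟩
  · rw [hiff]
    tfae_have 1 → 3 := h12
    tfae_have 3 → 2 := h23
    tfae_have 2 → 1 := h31
    tfae_finish
  · have haL := h12 h
    obtain ⟨hL0, hqL⟩ := hqL haL
    have hℓL : ((ℓ : ℤ) : ℚ) = (L : ℚ) := by
      rw [show ℓ = (L : ℤ) by omega, Int.cast_natCast]
    have hyI : ∀ i, x i ^ a i ∈ I := by
      intro i
      rcases lt_or_ge i d with hi | hi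
      · rw [hI]
        exact Ideal.mem_sup_left (mem_partialIdeal_of_lt _ (fun i => x i ^ a i) hi)
      · rw [hxd i hi, zero_pow (ha i).ne']
        exact Ideal.zero_mem _
    have hIm : I ≤ maximalIdeal A := by
      rw [hI]
      refine sup_le (partialIdeal_le bot_le fun i _ => Ideal.pow_mem_of_mem _ (hx i) _ (ha i)) ?_
      exact Ideal.pow_le_self hL0.ne'
    have hVV : ∀ c n, partialIdeal ⊥ (fun i => x i ^ a i) d ⊓
        maximalIdeal A ^ c * I ^ (n + 1) ≤
          partialIdeal ⊥ (fun i => x i ^ a i) d * (maximalIdeal A ^ c * I ^ n) := by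
      rw [hI]
      exact partialIdeal_inf_pow_mul_sup_pow_le hinter haL
    have hVV0 : ∀ n, partialIdeal ⊥ (fun i => x i ^ a i) d ⊓ I ^ (n + 1) ≤
        partialIdeal ⊥ (fun i => x i ^ a i) d * I ^ n := by
      simpa using hVV 0
    have hiffn : ∀ n, I ^ (n + 1) = partialIdeal ⊥ (fun i => x i ^ a i) d * I ^ n ↔
        q ≤ n * L := by
      rw [hI]
      exact sup_pow_succ_eq_iff hinter hρ hρ' haL hqL
    -- The exponent n = q satisfies q ≤ n L because L > 0, so Q is a reduction of I.
    have hredI := ((hiffn q).mpr (Nat.le_mul_of_pos_right q hL0)).le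
    have hmI : maximalIdeal A ^ L ≤ I := hI ▸ le_sup_right
    refine ⟨?_, ?_, ?_⟩
    · rw [hℓL]
      exact isReductionNumber_ceil hL0 hiffn
    · refine isCohenMacaulayRing_of_regular (J := I) le_rfl hmI hyI hredI
        (fun j hj n u hu hju => mem_leadIdeal_of_mul_mem hregular (fun i _ => hyI i)
          (fun i _ => hyI i) hVV0 (fun n => ?_) hj hu hju)
        Ideal.Quotient.mk_surjective Ideal.mk_ker
      rw [← pow_succ', ← pow_succ']
      exact hVV0 (n + 1)
    · refine isCohenMacaulayRing_of_regular (J := maximalIdeal A) (k := 1) hIm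
        (pow_one _).le hyI hredI
        (fun j hj n u hu hju => mem_leadIdeal_of_mul_mem hregular (fun i _ => hyI i)
          (fun i _ => hIm (hyI i)) hVV0 (fun n => ?_) hj hu hju)
        Ideal.Quotient.mk_surjective Ideal.mk_ker
      simpa using hVV 1 n

end Main

end QuasiSocle

theorem theorem1p2 {A : Type u} [CommRing A] [IsLocalRing A] [IsNoetherianRing A]
    (d : ℕ) (hd : 0 < d) (hdim : ringKrullDim A = (d : WithBot ℕ∞))
    (hG : QuasiSocle.IsGorensteinRing (QuasiSocle.AssociatedGradedRing (maximalIdeal A)))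
    (x : Fin d → A)
    (hx : QuasiSocle.IsReduction (Ideal.span (Set.range x)) (maximalIdeal A))
    (a : Fin d → ℕ) (ha : ∀ i, 0 < a i) (q : ℕ) (hq : 0 < q)
    (Q I : Ideal A)
    (hQ : Q = Ideal.span (Set.range fun i => x i ^ a i))
    (hI : I = Submodule.colon Q ((maximalIdeal A ^ q : Ideal A) : Set A)) :
    ∃ ρ : ℕ,
      QuasiSocle.IsNilpotencyIndex ((maximalIdeal A).map (Ideal.Quotient.mk Q)) ρ ∧
      ∀ ℓ : ℤ, ℓ = (ρ : ℤ) + 1 - (q : ℤ) →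
        List.TFAE
          [(I : Set A) ⊆ QuasiSocle.integralClosureOfIdeal Q,
            maximalIdeal A ^ q * I = maximalIdeal A ^ q * Q,
            ∀ i, (a i : ℤ) ≤ ℓ] ∧
        ((I : Set A) ⊆ QuasiSocle.integralClosureOfIdeal Q →
          QuasiSocle.IsReductionNumber Q I ⌈(q : ℚ) / (ℓ : ℚ)⌉₊ ∧
          QuasiSocle.IsCohenMacaulayRing (QuasiSocle.AssociatedGradedRing I) ∧
          QuasiSocle.IsCohenMacaulayRing (QuasiSocle.FiberCone I)) := by
  obtain ⟨hxm, n₀, hred⟩ := hx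
  have hdim' : (d : ℕ∞) ≤ (maximalIdeal A).height := by
    rw [← IsLocalRing.maximalIdeal_height_eq_ringKrullDim] at hdim
    exact_mod_cast hdim.ge
  -- The families are continued by 0 and by exponent 1, so that all x' i lie in the maximal ideal,
  -- all a' i stay positive, and every x' i ^ a' i, being 0 beyond d, lies in I.
  let x' : ℕ → A := fun i => if h : i < d then x ⟨i, h⟩ else 0
  let a' : ℕ → ℕ := fun i => if h : i < d then a ⟨i, h⟩ else 1
  have hx' : ∀ i : Fin d, x' i = x i := fun i => dif_pos i.2
  have ha' : ∀ i : Fin d, a' i = a i := fun i => dif_pos i.2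
  have hx'm : ∀ i, x' i ∈ maximalIdeal A := by
    intro i
    by_cases hi : i < d
    · exact (hx' ⟨i, hi⟩).symm ▸ hxm (Ideal.subset_span ⟨⟨i, hi⟩, rfl⟩)
    · simp [x', hi]
  have ha'0 : ∀ i, 0 < a' i := by
    intro i
    by_cases hi : i < d
    · exact (ha' ⟨i, hi⟩).symm ▸ ha ⟨i, hi⟩
    · simp [a', hi]
  have hQ' : Q = QuasiSocle.partialIdeal ⊥ (fun i => x' i ^ a' i) d := by
    rw [hQ]
    exact QuasiSocle.span_range_eq_partialIdeal fun i => by rw [hx', ha']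
  rw [QuasiSocle.span_range_eq_partialIdeal hx'] at hred
  have hQm : Q ≤ maximalIdeal A := by
    rw [hQ']
    exact QuasiSocle.partialIdeal_le bot_le fun i _ =>
      Ideal.pow_mem_of_mem _ (hx'm i) _ (ha'0 i)
  have hmQ : maximalIdeal A ≤ Q.radical := by
    refine (QuasiSocle.maximalIdeal_le_radical_partialIdeal hred.le).trans
      (Ideal.radical_le_radical_iff.mpr (QuasiSocle.partialIdeal_le bot_le fun i hi => ⟨a' i, ?_⟩))
    rw [hQ']
    exact QuasiSocle.mem_partialIdeal_of_lt _ (fun i => x' i ^ a' i) hi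
  obtain ⟨ρ, hρ, hρ'⟩ := QuasiSocle.exists_pow_succ_le_and_not_pow_le
    (IsNoetherian.noetherian (maximalIdeal A)) hmQ
    (ne_top_of_le_ne_top (IsLocalRing.maximalIdeal.isMaximal A).ne_top hQm)
  refine ⟨ρ, QuasiSocle.isNilpotencyIndex_map_mk hρ hρ', fun ℓ hℓ => ?_⟩
  have hiff : (∀ i, (a i : ℤ) ≤ ℓ) ↔ ∀ i < d, (a' i : ℤ) ≤ ℓ :=
    ⟨fun h i hi => (ha' ⟨i, hi⟩).symm ▸ h ⟨i, hi⟩, fun h i => ha' i ▸ h i i.2⟩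
  rw [hiff]
  exact QuasiSocle.quasiSocle_tfae_and_isCohenMacaulay hd hdim' hG hx'm ha'0
    (fun i hi => dif_neg (not_lt.mpr hi)) hred.le hQ' hI hρ hρ' hℓ
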